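/- **Conventions.** Let $D\ge 5$. A *theory* is a function $\mathcal L(g^{ab},R_{abcd})$ of a Lorentzian metric and its Riemann tensor in $D$ dimensions. With $P^{abcd}=\partial\mathcal L/\partial R_{abcd}$ (the derivative at fixed metric, with the algebraic symmetries of the Riemann tensor), its field equations are $$\mathcal E_{ab}=P_{acde}R_b{}^{cde}-\tfrac12\mathcal L\,g_{ab}+2\nabla^c\nabla^dP_{acbd}=0 .$$ The curvature is $R_{abc}{}^d=-2\partial_{[a}\Gamma_{b]c}{}^d+2\Gamma_{c[a}{}^e\Gamma_{b]e}{}^d$, $R_{ab}=R_{adb}{}^d$, $R=R_a{}^a$; $Z_{ab}=R_{ab}-\frac1D g_{ab}R$ is the traceless Ricci tensor and $W_{abcd}$ is the Weyl tensor. Here $d\Omega^2_{D-2}$ is the metric of the round unit sphere. * $\mathcal L$ is a *Cosmological Gravity* if for each $k\in\{-1,0,1\}$ its field equations on the metrics $$-F(t)\,dt^2+\frac{a(t)^2}{1-kr^2}\,dr^2+a(t)^2r^2\,d\Omega^2_{D-2}\qquad(a,F>0\text{ smooth},\ r>0,\ 1-kr^2>0)$$ are of second order in time derivatives: every component $\mathcal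 E_{ab}$ at a point is a function of the point and of $a,\dot a,\ddot a,F,\dot F,\ddot F$ at the time of that point. * $\mathcal L$ is *quasitopological* if on the metrics $ds_f^2=-f(r)\,dt^2+\frac{dr^2}{f(r)}+r^2\,d\Omega^2_{D-2}$ ($r>0$, $f$ smooth and non-zero) the field equations reduce to a single equation for $f$ which integrates to an algebraic one. That is, there is a smooth function $H(r,\phi)$ on $(0,\infty)\times\mathbb R$ such that for all such $f$ $$\mathcal E^t{}_t=\mathcal E^r{}_r,\qquad r^{D-2}\,\mathcal E^t{}_t=\frac{d}{dr}H(r,f(r)),$$ and, on every open interval of $r$, $ds_f^2$ solves all field equations $\mathcal E_{ab}=0$ if and only if $H(r,f(r))$ is constant. * $\mathcal L$ is a *Cosmological Quasitopological Gravity* if it is both. **Building blocks.** Put $$\mathsf W_2=\tfrac{4\,W_{abcd}W^{abcd}}{(D-2)^2(D-1)(D-3)},\quad \mathsf Z_2=\tfrac{2\,Z^a_bZ^b_a}{D(D-2)},\quad \mathsf W_3=\tfrac{8\,W_{ab}{}^{cd}W_{cd}{}^{ef}W_{ef}{}^{ab}}{(D-3)(D-2)\left(2(2-(D-3)^2)+(D-2)^2(D-3)^2\right)},$$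 $$\mathsf Y_3=\tfrac{8\,W_{ac}{}^{bd}Z^a_bZ^c_d}{D^2(D-2)(D-3)},\quad \mathsf X_3=-\tfrac{8\,W_{acde}W^{bcde}Z^a_b}{(D-1)^2(D-2)(D-3)(D-4)},\quad \mathsf Z_3=-\tfrac{4\,Z^a_bZ^b_cZ^c_a}{D(D-2)(D-4)},$$ $$\mathsf Y_4=-\tfrac{16\,Z^a_bZ_{ac}W^{bdce}Z_{de}}{D^2(D-2)(D-3)(D-4)},\quad \mathsf X_4=-\tfrac{32\,Z^{ab}W_{acbd}W^{cefg}W^d{}_{efg}}{D(D-1)^2(D-2)(D-3)^2(D-4)},\quad \mathcal K_2=\tfrac{Z_{ab}Z^{ab}}{D(D-1)},$$ and, with $\pi_l=0$ for even $l$ and $\pi_l=1$ for odd $l$, $$\mathcal I^{(1)}_l=\mathsf W_2^{\frac{l-\pi_l}2}\big((1-\pi_l)\mathsf W_2+\pi_l\mathsf W_3\big),\qquad \mathcal I^{(2)}_l=\mathsf Z_2^{\frac{l-\pi_l}2}\big((1-\pi_l)\mathsf Z_2+\pi_l\mathsf Z_3\big),$$ $$\mathcal I^{(3)}_l=\mathsf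 W_2^{\frac{l-\pi_l}2}\big((1-\pi_l)\mathsf X_3+\pi_l\mathsf X_4\big),\qquad \mathcal I^{(4)}_l=\mathsf Z_2^{\frac{l-\pi_l}2}\big((1-\pi_l)\mathsf Y_3+\pi_l\mathsf Y_4\big).$$ Let $\gamma_{n,l,p}=0$ unless $l,p\ge-2$ and $l+p+4\le n$, in which case $$\gamma_{n,l,p}=\frac{n!\,\big(D(D(l-2)+4)(l+1)+4(D-1)(Dl+1)(p+2)+4(D-1)^2(p+2)^2\big)}{2^{2-l+p}\,(D^2-D)^{-p-l-3}\,(D-2)^{l+2}\,(l+2)!\,(p+2)!\,(n-l-p-4)!}.$$ Define $\mathcal Z_{(1)}=R$, $\ \mathcal Z_{(2)}=R^2+\frac{(D-1)D}{(D-3)(D-2)}W_{abcd}W^{abcd}-\frac{4D(D-1)}{(D-2)^2}Z_{ab}Z^{ab}$, and for $n\ge3$ $$\mathcal Z_{(n)}=R^n+\sum_{l=0}^{n-2}R^{n-l-2}\big(\gamma_{n,-2,l}\mathcal I^{(1)}_l+\gamma_{n,l,-2}\mathcal I^{(2)}_l\big)+\sum_{l=0}^{n-3}R^{n-l-3}\big(\gamma_{n,-1,l}\mathcal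 I^{(3)}_l+\gamma_{n,l,-1}\mathcal I^{(4)}_l\big)+\sum_{l=0}^{n-4}\sum_{p=0}^{n-l-4}\gamma_{n,l,p}R^{n-l-p-4}\mathcal I^{(1)}_p\mathcal I^{(2)}_l .$$ For $l\ge0$ let $$\mathcal T^{\mathcal Z}_{(l+2)}=\frac{2\,\mathcal K_2^{\frac{l-2-\pi_l}2}}{D^3(D^2-4D+3)}\Big[(1-\pi_l)(D-2)\Big(Z_a^bZ_b^cZ_c^dZ_d^a-\tfrac{D^2-6D+12}{2D(D-2)}(Z_a^bZ_b^a)^2\Big)-\pi_l\Big(Z_a^bZ_b^cZ_c^dZ_d^eZ_e^a-\tfrac{D(D-4)+8}{2D(D-2)}Z_a^bZ_b^a\,Z_c^dZ_d^eZ_e^c\Big)\Big],$$ $$\eta_{n,l}=-\frac{2^{l+1}(l+1)(D-1)^{l+2}D^{l+2}}{(D-2)^{l+3}}\binom n{l+2}\Big(2(D-2)+\frac{(D(l-2)+4)(D(l+1-2\lfloor l/2\rfloor)-4)}{D-4}\Big(\frac{2D-2}{D-2}\Big)^{\lfloor l/2\rfloor}\Big)$$ (one has $\eta_{n,0}=\eta_{n,1}=0$;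 the corresponding terms below, which contain $\mathcal K_2^{-1}$, are read as $0$). **Theorem.** Set $\mathsf Q_{(n)}=\mathcal Z_{(n)}$ for $1\le n\le3$ and $$\mathsf Q_{(n)}=\mathcal Z_{(n)}+\sum_{l=0}^{n-2}\eta_{n,l}\,R^{n-l-2}\,\mathcal T^{\mathcal Z}_{(l+2)}\qquad(n\ge4).$$ Then for all $D\ge5$ and $n\ge1$, $\mathsf Q_{(n)}$ is a Cosmological Quasitopological Gravity. -/

import Mathlib

open scoped ContDiff

noncomputable section

namespace HigherCurvature

/-! ### Tensor calculus in a coordinate chart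

Coordinates are indexed by a finite type `ι`, points are `x : ι → ℝ`, and a metric is a field of
symmetric matrices `g x a b`. The curvature conventions are those of Wald. -/

section Chart

variable {ι : Type} [Fintype ι] [DecidableEq ι]

/-- Components of a covariant tensor of rank four. -/
abbrev Tensor4 (ι : Type) : Type := ι → ι → ι → ι → ℝ

/-- The partial derivative `∂_a φ` at `x`. -/
def pd (a : ι) (φ : (ι → ℝ) → ℝ) (x : ι → ℝ) : ℝ :=
  deriv (fun s => φ (Function.update x a s)) (x a)

/-- The Christoffel symbols `Γ_{ab}^c`. -/
def christoffel (g : (ι → ℝ) → Matrix ι ι ℝ) (a b c : ι) (x : ι → ℝ) : ℝ :=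
  (1 / 2) * ∑ d, (g x)⁻¹ c d *
    (pd a (fun y => g y b d) x + pd b (fun y => g y a d) x - pd d (fun y => g y a b) x)

/-- The Riemann tensor `R_{abc}^d = -2 ∂_{[a} Γ_{b]c}^d + 2 Γ_{c[a}^e Γ_{b]e}^d`. -/
def riemannMixed (g : (ι → ℝ) → Matrix ι ι ℝ) (x : ι → ℝ) (a b c d : ι) : ℝ :=
  -(pd a (christoffel g b c d) x - pd b (christoffel g a c d) x)
    + ∑ e, (christoffel g c a e x * christoffel g b e d x
      - christoffel g c b e x * christoffel g a e d x)

/-- The Riemann tensor `R_{abcd}` with all indices down. -/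
def riemann (g : (ι → ℝ) → Matrix ι ι ℝ) (x : ι → ℝ) : Tensor4 ι :=
  fun a b c d => ∑ e, riemannMixed g x a b c e * g x e d

/-- The covariant derivative `∇_e T_{abcd}` of a covariant tensor of rank four. -/
def covDeriv4 (g : (ι → ℝ) → Matrix ι ι ℝ) (T : (ι → ℝ) → Tensor4 ι)
    (x : ι → ℝ) (e a b c d : ι) : ℝ :=
  pd e (fun y => T y a b c d) x
    - ∑ f, (christoffel g e a f x * T x f b c d + christoffel g e b f x * T x a f c d
      + christoffel g e c f x * T x a b f d + christoffel g e d f x * T x a b c f)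

/-- The second covariant derivative `∇_h ∇_e T_{abcd}` of a covariant tensor of rank four. -/
def covDeriv4Twice (g : (ι → ℝ) → Matrix ι ι ℝ) (T : (ι → ℝ) → Tensor4 ι)
    (x : ι → ℝ) (h e a b c d : ι) : ℝ :=
  pd h (fun y => covDeriv4 g T y e a b c d) x
    - ∑ f, (christoffel g h e f x * covDeriv4 g T x f a b c d
      + christoffel g h a f x * covDeriv4 g T x e f b c d
      + christoffel g h b f x * covDeriv4 g T x e a f c d
      + christoffel g h c f x * covDeriv4 g T x e a b f d
      + christoffel g h d f x * covDeriv4 g T x e a b c f)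

/-- All four indices raised with the metric `g`. -/
def raise4 (g : Matrix ι ι ℝ) (T : Tensor4 ι) : Tensor4 ι :=
  fun a b c d => ∑ p, ∑ q, ∑ r, ∑ s, g⁻¹ a p * g⁻¹ b q * g⁻¹ c r * g⁻¹ d s * T p q r s

/-- All four indices lowered with the metric `g`. -/
def lower4 (g : Matrix ι ι ℝ) (T : Tensor4 ι) : Tensor4 ι :=
  fun a b c d => ∑ p, ∑ q, ∑ r, ∑ s, g a p * g b q * g c r * g d s * T p q r s

/-! ### Theories built from the metric and the curvature, and their field equations -/

/-- A Lagrangian `𝓛(g^{ab}, R_{abcd})`: a function of the metric (through `g_{ab}` and its inverse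
`g^{ab}`) and of the Riemann tensor with all indices down. -/
abbrev Lagrangian (ι : Type) : Type := Matrix ι ι ℝ → Tensor4 ι → ℝ

/-- Antisymmetrization in the first pair and in the last pair of indices, followed by
symmetrization under the exchange of the pairs. -/
def pairSymm (T : Tensor4 ι) : Tensor4 ι := fun a b c d =>
  (1 / 8) * (T a b c d - T b a c d - T a b d c + T b a d c
    + T c d a b - T d c a b - T c d b a + T d c b a)

/-- The projection onto the tensors with the algebraic symmetries of the Riemann tensor
(including the cyclic identity). -/
def riemannProj (T : Tensor4 ι) : Tensor4 ι := fun a b c d =>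
  pairSymm T a b c d
    - (1 / 3) * (pairSymm T a b c d + pairSymm T a c d b + pairSymm T a d b c)

/-- The coordinate tensor whose only non-zero component is a `1` at position `abcd`. -/
def basisTensor (a b c d : ι) : Tensor4 ι := fun p q r s =>
  if p = a ∧ q = b ∧ r = c ∧ s = d then 1 else 0

/-- `P^{abcd} = ∂𝓛/∂R_{abcd}`, the derivative at fixed metric. As usual, it is the tensor with the
symmetries of the Riemann tensor such that `d𝓛(δR) = P^{abcd} δR_{abcd}` for every variation `δR`
with the symmetries of the Riemann tensor. -/
def derivCurv (L : Lagrangian ι) (g : Matrix ι ι ℝ) (Rm : Tensor4 ι) : Tensor4 ι :=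
  fun a b c d => deriv (fun s : ℝ => L g (Rm + s • riemannProj (basisTensor a b c d))) 0

/-- The field `P_{abcd}` of a metric, with indices down. -/
def pField (L : Lagrangian ι) (g : (ι → ℝ) → Matrix ι ι ℝ) (x : ι → ℝ) : Tensor4 ι :=
  lower4 (g x) (derivCurv L (g x) (riemann g x))

/-- The gravitational field equations of the theory `L`,
`𝓔_{ab} = P_{acde} R_b^{cde} - (1/2) 𝓛 g_{ab} + 2 ∇^c ∇^d P_{acbd}`. -/
def fieldEq (L : Lagrangian ι) (g : (ι → ℝ) → Matrix ι ι ℝ) (x : ι → ℝ) (a b : ι) : ℝ :=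
  (∑ c, ∑ d, ∑ e, ∑ p, ∑ q, ∑ r, pField L g x a c d e *
      ((g x)⁻¹ c p * (g x)⁻¹ d q * (g x)⁻¹ e r * riemann g x b p q r))
    - (1 / 2) * L (g x) (riemann g x) * g x a b
    + 2 * ∑ c, ∑ d, ∑ p, ∑ q, (g x)⁻¹ c p * (g x)⁻¹ d q *
      covDeriv4Twice g (pField L g) x p q a c b d

/-- The field equations with the first index raised, `𝓔^a_b`. -/
def fieldEqMixed (L : Lagrangian ι) (g : (ι → ℝ) → Matrix ι ι ℝ) (x : ι → ℝ) (a b : ι) : ℝ :=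
  ∑ c, (g x)⁻¹ a c * fieldEq L g x c b

end Chart

/-! ### The two families of metrics -/

/-- Labels of the coordinates `(t, r, y_1, …, y_{D-2})` of a `D`-dimensional spacetime: `inl 0` is
`t`, `inl 1` is `r`, and `inr i` are stereographic coordinates on the sphere `S^{D-2}`. -/
abbrev Coord (D : ℕ) : Type := Fin 2 ⊕ Fin (D - 2)

/-- The label of the coordinate `t`. -/
abbrev tIdx (D : ℕ) : Coord D := Sum.inl 0

/-- The label of the coordinate `r`. -/
abbrev rIdx (D : ℕ) : Coord D := Sum.inl 1

/-- The conformal factor of the metric `dΩ² = 4 |dy|² / (1 + |y|²)²` of the round unit sphere in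
stereographic coordinates. -/
def sphereFactor (D : ℕ) (x : Coord D → ℝ) : ℝ := 4 / (1 + ∑ i, x (Sum.inr i) ^ 2) ^ 2

/-- The FLRW metric `-F(t) dt² + a(t)² dr² / (1 - k r²) + a(t)² r² dΩ²_{D-2}`. -/
def flrw (D : ℕ) (k : ℝ) (a F : ℝ → ℝ) (x : Coord D → ℝ) : Matrix (Coord D) (Coord D) ℝ :=
  Matrix.diagonal (Sum.elim
    ![-F (x (tIdx D)), a (x (tIdx D)) ^ 2 / (1 - k * x (rIdx D) ^ 2)]
    (fun _ => a (x (tIdx D)) ^ 2 * x (rIdx D) ^ 2 * sphereFactor D x))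

/-- The static and spherically symmetric metric `-f(r) dt² + dr² / f(r) + r² dΩ²_{D-2}`. -/
def staticMetric (D : ℕ) (f : ℝ → ℝ) (x : Coord D → ℝ) : Matrix (Coord D) (Coord D) ℝ :=
  Matrix.diagonal (Sum.elim
    ![-f (x (rIdx D)), 1 / f (x (rIdx D))]
    (fun _ => x (rIdx D) ^ 2 * sphereFactor D x))

/-! ### Cosmological Gravities and Quasitopological Gravities -/

/-- Cosmological Gravity: on FLRW configurations every component of the field equations at a point
is a function of the point and of `a, a', a''` and `F, F', F''` at that time, so that the equations
are of second order in time derivatives. -/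
def IsCosmological (D : ℕ) (L : Lagrangian (Coord D)) : Prop :=
  ∀ k ∈ ({-1, 0, 1} : Set ℝ), ∀ b c : Coord D,
    ∃ Φ : (Coord D → ℝ) → ℝ × ℝ × ℝ → ℝ × ℝ × ℝ → ℝ,
      ∀ (a F : ℝ → ℝ) (x : Coord D → ℝ),
        ContDiffAt ℝ ∞ a (x (tIdx D)) → ContDiffAt ℝ ∞ F (x (tIdx D)) →
        0 < a (x (tIdx D)) → 0 < F (x (tIdx D)) →
        0 < x (rIdx D) → 0 < 1 - k * x (rIdx D) ^ 2 →
        fieldEq L (flrw D k a F) x b c =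
          Φ x
            (a (x (tIdx D)), deriv a (x (tIdx D)), deriv (deriv a) (x (tIdx D)))
            (F (x (tIdx D)), deriv F (x (tIdx D)), deriv (deriv F) (x (tIdx D)))

/-- Quasitopological Gravity: the field equations of the static and spherically symmetric metrics
reduce to a single equation for `f`, namely `𝓔^t_t = 𝓔^r_r = 0`, which integrates to an algebraic
equation `H(r, f(r)) = const`. -/
def IsQuasitopological (D : ℕ) (L : Lagrangian (Coord D)) : Prop :=
  ∃ H : ℝ → ℝ → ℝ,
    ContDiffOn ℝ ∞ (Function.uncurry H) (Set.Ioi 0 ×ˢ Set.univ) ∧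
    (∀ (f : ℝ → ℝ) (x : Coord D → ℝ),
      ContDiffAt ℝ ∞ f (x (rIdx D)) → f (x (rIdx D)) ≠ 0 → 0 < x (rIdx D) →
      fieldEqMixed L (staticMetric D f) x (tIdx D) (tIdx D) =
          fieldEqMixed L (staticMetric D f) x (rIdx D) (rIdx D) ∧
        x (rIdx D) ^ (D - 2) * fieldEqMixed L (staticMetric D f) x (tIdx D) (tIdx D) =
          deriv (fun s => H s (f s)) (x (rIdx D))) ∧
    (∀ (I : Set ℝ) (f : ℝ → ℝ), IsOpen I → I.OrdConnected → I ⊆ Set.Ioi 0 →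
      ContDiffOn ℝ ∞ f I → (∀ s ∈ I, f s ≠ 0) →
      ((∀ x : Coord D → ℝ, x (rIdx D) ∈ I → ∀ b c, fieldEq L (staticMetric D f) x b c = 0) ↔
        ∃ C : ℝ, ∀ s ∈ I, H s (f s) = C))

/-- Cosmological Quasitopological Gravity: a Cosmological Gravity that is quasitopological. -/
def IsCosmologicalQuasitopological (D : ℕ) (L : Lagrangian (Coord D)) : Prop :=
  IsCosmological D L ∧ IsQuasitopological D L

/-! ### Curvature invariants -/

section Invariants

variable (D : ℕ) (g : Matrix (Coord D) (Coord D) ℝ) (Rm : Tensor4 (Coord D))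

/-- The Ricci tensor `R_{ab} = R_{adb}^d`. -/
def ricci : Matrix (Coord D) (Coord D) ℝ := fun a b => ∑ d, ∑ e, g⁻¹ e d * Rm a d b e

/-- The Ricci scalar `R`. -/
def scal : ℝ := ∑ a, ∑ b, g⁻¹ a b * ricci D g Rm a b

/-- The traceless Ricci tensor `Z_{ab}`. -/
def zLow : Matrix (Coord D) (Coord D) ℝ :=
  fun a b => ricci D g Rm a b - (1 / (D : ℝ)) * g a b * scal D g Rm

/-- `Z^a_b`, the first index being the upper one. -/
def zMix : Matrix (Coord D) (Coord D) ℝ := g⁻¹ * zLow D g Rm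

/-- `Z^{ab}`. -/
def zUp : Matrix (Coord D) (Coord D) ℝ := g⁻¹ * zLow D g Rm * g⁻¹

/-- The trace of the `m`-th power of the endomorphism `Z^a_b`: for `m = 2` this is `Z_{ab} Z^{ab}`,
for `m = 3` it is `Z^a_b Z^b_c Z^c_a`, and so on. -/
def zTrace (m : ℕ) : ℝ := Matrix.trace (zMix D g Rm ^ m)

/-- The Weyl tensor `W_{abcd} = R_{abcd} + (2/(D-2)) (g_{b[c} R_{d]a} - g_{a[c} R_{d]b})
+ (2/((D-1)(D-2))) R g_{c[a} g_{b]d}`. -/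
def weyl : Tensor4 (Coord D) := fun a b c d =>
  Rm a b c d
    + (1 / ((D : ℝ) - 2)) *
      ((g b c * ricci D g Rm d a - g b d * ricci D g Rm c a)
        - (g a c * ricci D g Rm d b - g a d * ricci D g Rm c b))
    + (1 / (((D : ℝ) - 1) * ((D : ℝ) - 2))) * scal D g Rm * (g c a * g b d - g c b * g a d)

/-- `W^{abcd}`. -/
def weylUp : Tensor4 (Coord D) := raise4 g (weyl D g Rm)

/-- `W_{ab}^{cd}`. -/
def weylMix : Tensor4 (Coord D) := fun a b c d =>
  ∑ p, ∑ q, g⁻¹ c p * g⁻¹ d q * weyl D g Rm a b p q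

/-- `W_{abcd} W^{abcd}`. -/
def weylSq : ℝ := ∑ a, ∑ b, ∑ c, ∑ d, weyl D g Rm a b c d * weylUp D g Rm a b c d

/-- `𝖶₂ = 4 W_{abcd} W^{abcd} / ((D-2)² (D-1) (D-3))`. -/
def W2 : ℝ :=
  4 / (((D : ℝ) - 2) ^ 2 * ((D : ℝ) - 1) * ((D : ℝ) - 3)) * weylSq D g Rm

/-- `𝖹₂ = 2 Z^a_b Z_a^b / (D (D-2))`. -/
def Z2 : ℝ := 2 / ((D : ℝ) * ((D : ℝ) - 2)) * zTrace D g Rm 2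

/-- `𝖶₃`, proportional to `W_{ab}^{cd} W_{cd}^{ef} W_{ef}^{ab}`. -/
def W3 : ℝ :=
  8 / (((D : ℝ) - 3) * ((D : ℝ) - 2) *
      (2 * (2 - ((D : ℝ) - 3) ^ 2) + ((D : ℝ) - 2) ^ 2 * ((D : ℝ) - 3) ^ 2)) *
    ∑ a, ∑ b, ∑ c, ∑ d, ∑ e, ∑ f,
      weylMix D g Rm a b c d * weylMix D g Rm c d e f * weylMix D g Rm e f a b

/-- `𝖸₃`, proportional to `W_{ac}^{bd} Z^a_b Z^c_d`. -/
def Y3 : ℝ :=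
  8 / ((D : ℝ) ^ 2 * ((D : ℝ) - 2) * ((D : ℝ) - 3)) *
    ∑ a, ∑ b, ∑ c, ∑ d, weylMix D g Rm a c b d * zMix D g Rm a b * zMix D g Rm c d

/-- `𝖷₃`, proportional to `W_{acde} W^{bcde} Z^a_b`. -/
def X3 : ℝ :=
  -8 / (((D : ℝ) - 1) ^ 2 * ((D : ℝ) - 2) * ((D : ℝ) - 3) * ((D : ℝ) - 4)) *
    ∑ a, ∑ b, ∑ c, ∑ d, ∑ e,
      weyl D g Rm a c d e * weylUp D g Rm b c d e * zMix D g Rm a b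

/-- `𝖹₃`, proportional to `Z^a_b Z^b_c Z^c_a`. -/
def Z3 : ℝ := -4 / ((D : ℝ) * ((D : ℝ) - 2) * ((D : ℝ) - 4)) * zTrace D g Rm 3

/-- `𝖸₄`, proportional to `Z^a_b Z_{ac} W^{bdce} Z_{de}`. -/
def Y4 : ℝ :=
  -16 / ((D : ℝ) ^ 2 * ((D : ℝ) - 2) * ((D : ℝ) - 3) * ((D : ℝ) - 4)) *
    ∑ a, ∑ b, ∑ c, ∑ d, ∑ e,
      zMix D g Rm a b * zLow D g Rm a c * weylUp D g Rm b d c e * zLow D g Rm d e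

/-- `𝖷₄`, proportional to `Z^{ab} W_{acbd} W^{cefg} W^d_{efg}`. -/
def X4 : ℝ :=
  -32 / ((D : ℝ) * ((D : ℝ) - 1) ^ 2 * ((D : ℝ) - 2) * ((D : ℝ) - 3) ^ 2 * ((D : ℝ) - 4)) *
    ∑ a, ∑ b, ∑ c, ∑ d, ∑ e, ∑ f, ∑ h,
      zUp D g Rm a b * weyl D g Rm a c b d * weylUp D g Rm c e f h *
        ∑ p, g⁻¹ d p * weyl D g Rm p e f h

/-- `𝓘^{(1)}_l = 𝖶₂^{(l-π_l)/2} ((1-π_l) 𝖶₂ + π_l 𝖶₃)`, where `π_l` is the parity of `l`. -/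
def I1 (l : ℕ) : ℝ :=
  W2 D g Rm ^ (l / 2) * (if Even l then W2 D g Rm else W3 D g Rm)

/-- `𝓘^{(2)}_l`. -/
def I2 (l : ℕ) : ℝ :=
  Z2 D g Rm ^ (l / 2) * (if Even l then Z2 D g Rm else Z3 D g Rm)

/-- `𝓘^{(3)}_l`. -/
def I3 (l : ℕ) : ℝ :=
  W2 D g Rm ^ (l / 2) * (if Even l then X3 D g Rm else X4 D g Rm)

/-- `𝓘^{(4)}_l`. -/
def I4 (l : ℕ) : ℝ :=
  Z2 D g Rm ^ (l / 2) * (if Even l then Y3 D g Rm else Y4 D g Rm)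

end Invariants

/-! ### The theories -/

/-- The constants `γ_{n,l,p}`, non-zero only for `l, p ≥ -2` and `l + p + 4 ≤ n`. -/
def gammaCoeff (D n : ℕ) (l p : ℤ) : ℝ :=
  if -2 ≤ l ∧ -2 ≤ p ∧ l + p + 4 ≤ n then
    ((n.factorial : ℝ) *
        ((D : ℝ) * ((D : ℝ) * ((l : ℝ) - 2) + 4) * ((l : ℝ) + 1)
          + 4 * ((D : ℝ) - 1) * ((D : ℝ) * (l : ℝ) + 1) * ((p : ℝ) + 2)
          + 4 * ((D : ℝ) - 1) ^ 2 * ((p : ℝ) + 2) ^ 2)) /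
      ((2 : ℝ) ^ (2 - l + p) * ((D : ℝ) ^ 2 - (D : ℝ)) ^ (-p - l - 3) *
        ((D : ℝ) - 2) ^ (l + 2) * ((l + 2).toNat.factorial : ℝ) *
        ((p + 2).toNat.factorial : ℝ) * (((n : ℤ) - l - p - 4).toNat.factorial : ℝ))
  else 0

/-- The theories `𝓩_{(n)}`, `n ≥ 1`. -/
def curlyZ (D n : ℕ) : Lagrangian (Coord D) := fun g Rm =>
  if n = 1 then scal D g Rm
  else if n = 2 then
    scal D g Rm ^ 2
      + ((D : ℝ) - 1) * (D : ℝ) * weylSq D g Rm / (((D : ℝ) - 3) * ((D : ℝ) - 2))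
      - 4 * (D : ℝ) * ((D : ℝ) - 1) * zTrace D g Rm 2 / ((D : ℝ) - 2) ^ 2
  else
    scal D g Rm ^ n
      + ∑ l ∈ Finset.range (n - 1), scal D g Rm ^ (n - l - 2) *
          (gammaCoeff D n (-2) l * I1 D g Rm l + gammaCoeff D n l (-2) * I2 D g Rm l)
      + ∑ l ∈ Finset.range (n - 2), scal D g Rm ^ (n - l - 3) *
          (gammaCoeff D n (-1) l * I3 D g Rm l + gammaCoeff D n l (-1) * I4 D g Rm l)
      + ∑ l ∈ Finset.range (n - 3), ∑ p ∈ Finset.range (n - l - 3),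
          gammaCoeff D n l p * scal D g Rm ^ (n - l - p - 4) * I1 D g Rm p * I2 D g Rm l

/-- `𝓚₂ = Z_{ab} Z^{ab} / (D (D-1))`. -/
def K2 (D : ℕ) : Lagrangian (Coord D) := fun g Rm =>
  1 / ((D : ℝ) * ((D : ℝ) - 1)) * zTrace D g Rm 2

/-- `trivialT D m` is the invariant `𝓣^𝓩_{(m+2)}`, `m ≥ 0`. For `m = 0, 1` it contains the
inverse of `𝓚₂`. -/
def trivialT (D m : ℕ) : Lagrangian (Coord D) := fun g Rm =>
  2 * K2 D g Rm ^ (((m : ℤ) - 2 - (m : ℤ) % 2) / 2) /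
      ((D : ℝ) ^ 3 * ((D : ℝ) ^ 2 - 4 * (D : ℝ) + 3)) *
    (if Even m then
      ((D : ℝ) - 2) * (zTrace D g Rm 4
        - ((D : ℝ) ^ 2 - 6 * (D : ℝ) + 12) / (2 * (D : ℝ) * ((D : ℝ) - 2)) *
          zTrace D g Rm 2 ^ 2)
    else
      -(zTrace D g Rm 5
        - ((D : ℝ) * ((D : ℝ) - 4) + 8) / (2 * (D : ℝ) * ((D : ℝ) - 2)) *
          (zTrace D g Rm 2 * zTrace D g Rm 3)))

/-- The constants `η_{n,l}`; `l / 2` is the integer part of one half of `l`. They vanish for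
`l = 0, 1`, so that the inverse powers of `𝓚₂` do not appear in the theories below. -/
def etaCoeff (D n l : ℕ) : ℝ :=
  -((2 : ℝ) ^ (l + 1) * ((l : ℝ) + 1) * ((D : ℝ) - 1) ^ (l + 2) * (D : ℝ) ^ (l + 2) /
      ((D : ℝ) - 2) ^ (l + 3)) * (n.choose (l + 2) : ℝ) *
    (2 * ((D : ℝ) - 2)
      + ((D : ℝ) * ((l : ℝ) - 2) + 4) *
          ((D : ℝ) * ((l : ℝ) + 1 - 2 * ((l / 2 : ℕ) : ℝ)) - 4) / ((D : ℝ) - 4) *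
        ((2 * (D : ℝ) - 2) / ((D : ℝ) - 2)) ^ (l / 2))

/-- The theories `𝖰_{(n)}`, `n ≥ 1`. -/
def curlyQ (D n : ℕ) : Lagrangian (Coord D) := fun g Rm =>
  if n ≤ 3 then curlyZ D n g Rm
  else curlyZ D n g Rm
    + ∑ l ∈ Finset.range (n - 1),
        etaCoeff D n l * scal D g Rm ^ (n - l - 2) * trivialT D l g Rm

end HigherCurvature

end

/-! # The theories `curlyQ` are Cosmological Quasitopological Gravities -/

/-! Both families of metrics are diagonal, and on both the curvature is sectional: `R_{abcd} =
K_{ab} (g_{ac} g_{bd} - g_{ad} g_{bc})` for a symmetric matrix `K`. For static metrics the entries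
of `K` are `A = -f''/2` on the `tr` plane, `B = -f'/(2r)` on planes mixing `t` or `r` with the
sphere, and `ψ = (1-f)/r²` on planes tangent to the sphere. For FLRW metrics they are `α` on planes
containing the time direction and `β` on spatial planes. On such tensors the Lagrangian is a
polynomial in `K` alone (`curlyQ_diagCurv`).

Values of the Lagrangian. On static curvatures the building blocks are monomials in two parameters
`z`, `w` and the terms with `𝓣` vanish, so the theory is a trinomial sum with quadratic weights. It
resums to powers of `ψ` with a part linear in `A` and a part quadratic in `B` (`curlyQOf_static`).
On FLRW curvatures the Weyl tensor vanishes, and the coefficients `η` are exactly the corrections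
that turn what remains into a weighted binomial sum, linear in `α` (`curlyQOf_cosmo`).

The tensor `P`. Invariance under reflections of the axes forces `P` to be sectional too, with
entries `p_{ab}` proportional to the derivatives of the Lagrangian with respect to `K_{ab}`
(`lower4_derivCurv`). Invariance under the permutations of the axes that preserve `K` leaves two or
three unknown entries, and these are read off from the partial derivatives of the two reduced
Lagrangians (`fderiv_secLag_static`, `fderiv_secLag_cosmo`).

Vanishing divergence. The Bianchi identities are `r ψ' = 2 (B - ψ)`, `r B' = A - B` and `β' = 2 H (α
- β)`, with `H = a'/a`. Together with the explicit reduced Lagrangians they give `∇^d P_{acbd} = 0`.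
The second-derivative term of the field equations then drops out, and `𝓔_{ab}` is diagonal with
entries `g_{aa} (2 ∑_c p_{ac} K_{ac} - 𝓛/2)` (`fieldEq_diagMetric`).

Conclusion. In the FLRW case this expression contains nothing beyond `a`, `a'`, `a''`, `F`, `F'` and
the point. In the static case `A` cancels from the `t` and `r` components, which agree; multiplied
by `r^(D-2)` they are the derivative of a constant multiple of `r^(D-1) ψ^n` (`hasDerivAt_staticH`).
The mixed angular components are `E + r E'/(D-2)` in terms of `E = 𝓔^t_t` (`static_sum_inr`), so
they impose nothing new. -/

open scoped ContDiff

noncomputable section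

namespace HigherCurvature

set_option linter.unusedSectionVars false

/-! ### Partial derivatives -/

section PartialDerivatives

variable {ι : Type} [DecidableEq ι]

/-- `φ` has the partial derivative `φ'` with respect to the coordinate `a` at `x`. -/
def HasPd (a : ι) (φ : (ι → ℝ) → ℝ) (φ' : ℝ) (x : ι → ℝ) : Prop :=
  HasDerivAt (fun s => φ (Function.update x a s)) φ' (x a)

variable {a : ι} {φ ψ : (ι → ℝ) → ℝ} {φ' ψ' : ℝ} {x : ι → ℝ}

theorem HasPd.pd_eq (h : HasPd a φ φ' x) : pd a φ x = φ' := HasDerivAt.deriv h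

theorem hasPd_const (c : ℝ) : HasPd a (fun _ => c) 0 x := hasDerivAt_const _ _

theorem HasPd.add (h : HasPd a φ φ' x) (k : HasPd a ψ ψ' x) :
    HasPd a (fun y => φ y + ψ y) (φ' + ψ') x := HasDerivAt.add h k

theorem HasPd.sub (h : HasPd a φ φ' x) (k : HasPd a ψ ψ' x) :
    HasPd a (fun y => φ y - ψ y) (φ' - ψ') x := HasDerivAt.sub h k

theorem HasPd.mul (h : HasPd a φ φ' x) (k : HasPd a ψ ψ' x) :
    HasPd a (fun y => φ y * ψ y) (φ' * ψ x + φ x * ψ') x := by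
  simpa only [HasPd, Function.update_eq_self] using HasDerivAt.fun_mul h k

theorem HasPd.div (h : HasPd a φ φ' x) (k : HasPd a ψ ψ' x) (h0 : ψ x ≠ 0) :
    HasPd a (fun y => φ y / ψ y) ((φ' * ψ x - φ x * ψ') / ψ x ^ 2) x := by
  simpa only [HasPd, Function.update_eq_self] using HasDerivAt.fun_div h k (by simpa using h0)

theorem HasPd.inv (h : HasPd a φ φ' x) (h0 : φ x ≠ 0) :
    HasPd a (fun y => (φ y)⁻¹) (-φ' / φ x ^ 2) x := by
  simpa only [HasPd, Function.update_eq_self] using HasDerivAt.fun_inv h (by simpa using h0)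

theorem HasPd.sum {κ : Type} (s : Finset κ) {φ : κ → (ι → ℝ) → ℝ} {φ' : κ → ℝ}
    (h : ∀ i ∈ s, HasPd a (φ i) (φ' i) x) :
    HasPd a (fun y => ∑ i ∈ s, φ i y) (∑ i ∈ s, φ' i) x := HasDerivAt.fun_sum h

theorem HasPd.ite (p : Prop) [Decidable p] (h : HasPd a φ φ' x) :
    HasPd a (fun y => if p then φ y else 0) (if p then φ' else 0) x := by
  split_ifs
  · exact h
  · exact hasPd_const 0

theorem HasPd.congr_value {φ'' : ℝ} (h : HasPd a φ φ' x) (e : φ' = φ'') : HasPd a φ φ'' x := e ▸ h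

/-- Identities that hold near a point can thus be differentiated along a coordinate line. -/
theorem tendsto_update_self (a : ι) (x : ι → ℝ) :
    Filter.Tendsto (fun s => Function.update x a s) (nhds (x a)) (nhds x) := by
  have : ContinuousAt (fun s : ℝ => Function.update x a s) (x a) := by fun_prop
  simpa [ContinuousAt] using this

theorem HasPd.congr_of_eventuallyEq (h : HasPd a φ φ' x) (k : ψ =ᶠ[nhds x] φ) :
    HasPd a ψ φ' x :=
  HasDerivAt.congr_of_eventuallyEq h ((tendsto_update_self a x).eventually k)

theorem pd_congr (k : ψ =ᶠ[nhds x] φ) : pd a ψ x = pd a φ x :=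
  Filter.EventuallyEq.deriv_eq ((tendsto_update_self a x).eventually k)

end PartialDerivatives

/-! ### Diagonal metrics -/

section DiagonalMetric

variable {ι : Type} [Fintype ι] [DecidableEq ι]

theorem inv_diagonal_of_ne {e : ι → ℝ} (he : ∀ a, e a ≠ 0) :
    (Matrix.diagonal e)⁻¹ = Matrix.diagonal (fun a => (e a)⁻¹) := by
  apply Matrix.inv_eq_right_inv
  rw [Matrix.diagonal_mul_diagonal]
  simp [he]

/-- The tensor `K_{ab} (g_{ac} g_{bd} - g_{ad} g_{bc})` for the diagonal metric with entries `e`. -/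
def diagCurv (e : ι → ℝ) (K : ι → ι → ℝ) : Tensor4 ι := fun a b c d =>
  e a * e b * K a b * ((if a = c then 1 else 0) * (if b = d then 1 else 0)
    - (if a = d then 1 else 0) * (if b = c then 1 else 0))

variable (e : ι → (ι → ℝ) → ℝ) (l : ι → ι → (ι → ℝ) → ℝ)

/-- The metric with diagonal entries `e`. -/
def diagMetric (x : ι → ℝ) : Matrix ι ι ℝ := Matrix.diagonal (fun a => e a x)

/-- The Christoffel symbols `Γ_{ab}^c` of a diagonal metric with entries `e`, in terms of the
logarithmic derivatives `l a b = ∂_b e_a / (2 e_a)`. -/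
def diagGamma (a b c : ι) (x : ι → ℝ) : ℝ :=
  (if b = c then l c a x else 0) + (if a = c then l c b x else 0)
    - (if a = b then e a x / e c x * l a c x else 0)

/-- The functions `l a b` are the logarithmic derivatives `∂_b e_a / (2 e_a)` at `x`. -/
def IsLogDeriv (x : ι → ℝ) : Prop :=
  (∀ a, e a x ≠ 0) ∧ ∀ a b, HasPd b (e a) (2 * l a b x * e a x) x

variable {e l} {x : ι → ℝ}

theorem pd_diagMetric (h : IsLogDeriv e l x) (a b c : ι) :
    pd a (fun y => diagMetric e y b c) x = if b = c then 2 * l b a x * e b x else 0 := by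
  by_cases hbc : b = c
  · subst hbc
    simpa [diagMetric] using (h.2 b a).pd_eq
  · simp only [diagMetric, Matrix.diagonal_apply_ne _ hbc, if_neg hbc]
    exact (hasPd_const 0).pd_eq

theorem christoffel_diagMetric (h : IsLogDeriv e l x) (a b c : ι) :
    christoffel (diagMetric e) a b c x = diagGamma e l a b c x := by
  have hc := h.1 c
  unfold christoffel
  rw [Finset.sum_eq_single c]
  · rw [pd_diagMetric h, pd_diagMetric h, pd_diagMetric h, diagMetric, inv_diagonal_of_ne h.1,
      Matrix.diagonal_apply_eq, diagGamma]
    by_cases hbc : b = c <;> by_cases hac : a = c <;> by_cases hab : a = b <;>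
      simp_all <;> field_simp
  · intro d _ hd
    rw [diagMetric, inv_diagonal_of_ne h.1, Matrix.diagonal_apply_ne _ hd.symm, zero_mul]
  · simp

variable {m : ι → ι → ι → ℝ}

theorem hasPd_diagGamma (h : IsLogDeriv e l x) (hm : ∀ a b c, HasPd c (l a b) (m a b c) x)
    (a b c d : ι) :
    HasPd d (diagGamma e l a b c)
      ((if b = c then m c a d else 0) + (if a = c then m c b d else 0)
        - (if a = b then e a x / e c x * (m a c d + 2 * (l a d x - l c d x) * l a c x) else 0)) x := by
  have hc := h.1 c
  refine (((hm c a d).ite _).add ((hm c b d).ite _)).sub (HasPd.ite _ ?_)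
  refine (((h.2 a d).div (h.2 c d) hc).mul (hm a c d)).congr_value ?_
  field_simp
  ring

theorem pd_christoffel_diagMetric (h : ∀ᶠ y in nhds x, IsLogDeriv e l y)
    (hm : ∀ a b c, HasPd c (l a b) (m a b c) x) (a b c d : ι) :
    pd d (christoffel (diagMetric e) a b c) x =
      (if b = c then m c a d else 0) + (if a = c then m c b d else 0)
        - (if a = b then e a x / e c x * (m a c d + 2 * (l a d x - l c d x) * l a c x) else 0) := by
  rw [pd_congr (h.mono fun y hy => christoffel_diagMetric hy a b c)]
  exact (hasPd_diagGamma h.self_of_nhds hm a b c d).pd_eq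

/-- A Christoffel symbol of a diagonal metric vanishes unless two of its indices agree, so the sum
over `f` collapses. Only for `c = a` and `b = d` does a genuine sum survive; it becomes the last
term of `IsSectional.diag`. -/
theorem sum_diagGamma_mul_diagGamma (a b c d : ι) :
    ∑ f, diagGamma e l c a f x * diagGamma e l b f d x =
      l a c x * diagGamma e l b a d x + l c a x * diagGamma e l b c d x
      - (if c = a then e c x / e d x * l c d x * l d b x else 0)
      - (if c = a then if b = d then ∑ f, e c x / e f x * l c f x * l d f x else 0 else 0)
      + (if c = a then e c x / e b x * l c b x * (e b x / e d x) * l b d x else 0) := by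
  have h1 : ∀ f, diagGamma e l c a f x * diagGamma e l b f d x =
      (if a = f then l a c x * diagGamma e l b a d x else 0)
      + (if c = f then l c a x * diagGamma e l b c d x else 0)
      - (if f = d then if c = a then e c x / e d x * l c d x * l d b x else 0 else 0)
      - (if c = a then if b = d then e c x / e f x * l c f x * l d f x else 0 else 0)
      + (if b = f then if c = a then e c x / e b x * l c b x * (e b x / e d x) * l b d x else 0
          else 0) := by
    intro f
    have h2 : diagGamma e l c a f x = (if a = f then l a c x else 0) + (if c = f then l c a x else 0)
      - (if c = a then e c x / e f x * l c f x else 0) := by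
      unfold diagGamma
      by_cases h1 : a = f <;> by_cases h2 : c = f <;> simp [h1, h2]
    rw [h2, sub_mul, add_mul]
    have h3 : ∀ g : ι, ∀ u : ℝ, (if g = f then u else 0) * diagGamma e l b f d x =
        if g = f then u * diagGamma e l b g d x else 0 := by
      intro g u; split_ifs with h
      · rw [h]
      · simp
    rw [h3, h3]
    have h4 : (if c = a then e c x / e f x * l c f x else 0) * diagGamma e l b f d x =
        (if f = d then if c = a then e c x / e d x * l c d x * l d b x else 0 else 0)
        + (if c = a then if b = d then e c x / e f x * l c f x * l d f x else 0 else 0)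
        - (if b = f then if c = a then e c x / e b x * l c b x * (e b x / e d x) * l b d x else 0
          else 0) := by
      unfold diagGamma
      by_cases hca : c = a
      · simp only [if_pos hca]
        rw [mul_sub, mul_add]
        congr 1
        · congr 1
          · split_ifs with h
            · rw [h]
            · simp
          · simp
        · split_ifs with h
          · rw [h]; ring
          · simp
      · simp [hca]
    rw [h4]
    ring
  simp only [h1, Finset.sum_add_distrib, Finset.sum_sub_distrib, Finset.sum_ite_eq,
    Finset.sum_ite_eq', Finset.mem_univ, if_true]
  congr 2
  split_ifs <;> simp

end DiagonalMetric

/-! ### Sectional form of the Riemann tensor of a diagonal metric -/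

section DiagonalCurvature

variable {ι : Type} [Fintype ι] [DecidableEq ι]
variable {e : ι → (ι → ℝ) → ℝ} {l : ι → ι → (ι → ℝ) → ℝ} {x : ι → ℝ}

/-- The algebraic conditions on the logarithmic derivatives `l` of a diagonal metric and on their
derivatives `m` under which the Riemann tensor is `K_{ab} (g_{ac} g_{bd} - g_{ad} g_{bc})`. -/
structure IsSectional (e : ι → (ι → ℝ) → ℝ) (l : ι → ι → (ι → ℝ) → ℝ) (m : ι → ι → ι → ℝ)
    (K : ι → ι → ℝ) (x : ι → ℝ) : Prop where
  hasPd : ∀ a b c, HasPd c (l a b) (m a b c) x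
  symm : ∀ a b c, m a b c = m a c b
  off : ∀ a b c, a ≠ b → b ≠ c → a ≠ c →
    m b a c + l b a x * l b c x = l b a x * l a c x + l b c x * l c a x
  diag : ∀ a b, a ≠ b → K a b =
    -(m a b b + l a b x ^ 2 - 2 * l a b x * l b b x) / e b x
      - (m b a a + l b a x ^ 2 - 2 * l b a x * l a a x) / e a x
      - ∑ f, l a f x * l b f x / e f x

variable {m : ι → ι → ι → ℝ} {K : ι → ι → ℝ}

/-- The cases follow the coincidences among the indices. Two distinct values, each occurring twice,
give the sectional curvature `diag`; three distinct values give the components that `off` makes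
vanish; in the remaining cases everything cancels because the mixed derivatives of the logarithms of
the metric entries commute (`symm`). -/
theorem riemannMixed_diagMetric (h : ∀ᶠ y in nhds x, IsLogDeriv e l y)
    (hK : IsSectional e l m K x) (a b c d : ι) :
    riemannMixed (diagMetric e) x a b c d = diagCurv (fun a => e a x) K a b c d / e d x := by
  have h0 := h.self_of_nhds
  have hne := h0.1
  unfold riemannMixed
  rw [Finset.sum_sub_distrib]
  simp only [christoffel_diagMetric h0, pd_christoffel_diagMetric h hK.hasPd,
    sum_diagGamma_mul_diagGamma, diagCurv]
  by_cases hab : a = b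
  · subst hab; ring
  have hba : b ≠ a := fun t => hab t.symm
  have ha := hne a
  have hb := hne b
  have hc := hne c
  have hd := hne d
  by_cases hca : c = a
  · subst hca
    by_cases hdb : d = b
    · subst hdb
      have e1 : ∑ f, e c x / e f x * l c f x * l d f x
          = e c x * ∑ f, l c f x * l d f x / e f x := by
        rw [Finset.mul_sum]
        exact Finset.sum_congr rfl fun f _ => by ring
      simp only [diagGamma, if_true, if_neg hab, if_neg hba, hK.diag c d hab, e1]
      field_simp
      ring
    · have hbd : b ≠ d := fun t => hdb t.symm
      by_cases hdc : d = c
      · subst hdc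
        simp only [diagGamma, if_true, if_neg hab, if_neg hba, hK.symm d b d]
        field_simp
        ring
      · have hcd : c ≠ d := fun t => hdc t.symm
        have := hK.off b c d hba hcd hbd
        simp only [diagGamma, if_true, if_neg hab, if_neg hba, if_neg hcd,
          if_neg hbd]
        field_simp
        linear_combination -(e c x) * this + e c x * hK.symm c b d
  · have hac : a ≠ c := fun t => hca t.symm
    by_cases hcb : c = b
    · subst hcb
      by_cases hda : d = a
      · subst hda
        have e1 : ∑ f, e c x / e f x * l c f x * l d f x
            = e c x * ∑ f, l d f x * l c f x / e f x := by
          rw [Finset.mul_sum]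
          exact Finset.sum_congr rfl fun f _ => by ring
        simp only [diagGamma, if_true, if_neg hab, if_neg hba, hK.diag d c hab, e1]
        field_simp
        ring
      · have had : a ≠ d := fun t => hda t.symm
        by_cases hdc : d = c
        · subst hdc
          simp only [diagGamma, if_true, if_neg hab, if_neg hba, hK.symm d a d]
          field_simp
          ring
        · have hcd : c ≠ d := fun t => hdc t.symm
          have := hK.off a c d hac hcd had
          simp only [diagGamma, if_true, if_neg hab, if_neg hba, if_neg hcd,
            if_neg had]
          field_simp
          linear_combination (e c x) * this - e c x * hK.symm c a d
    · have hbc : b ≠ c := fun t => hcb t.symm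
      by_cases hda : d = a
      · subst hda
        have := hK.off b d c hba hac hbc
        simp only [diagGamma, if_true, if_neg hab, if_neg hba, if_neg hac, if_neg hca,
          if_neg hbc, if_neg hcb, hK.symm d c b]
        linear_combination this
      · have had : a ≠ d := fun t => hda t.symm
        by_cases hdb : d = b
        · subst hdb
          have := hK.off a d c hab hbc hac
          simp only [diagGamma, if_true, if_neg hab, if_neg hba, if_neg hac, if_neg hca,
            if_neg hbc, if_neg hcb, hK.symm d c a]
          linear_combination -this
        · have hbd : b ≠ d := fun t => hdb t.symm
          simp only [diagGamma, if_neg hab, if_neg hba, if_neg hac, if_neg hca,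
            if_neg hbc, if_neg hcb, if_neg had, if_neg hbd,
            hK.symm d a b]
          split_ifs with h1
          · subst h1; ring
          · ring

theorem riemann_diagMetric (h : ∀ᶠ y in nhds x, IsLogDeriv e l y) (hK : IsSectional e l m K x) :
    riemann (diagMetric e) x = diagCurv (fun a => e a x) K := by
  funext a b c d
  unfold riemann
  rw [Finset.sum_eq_single d]
  · rw [riemannMixed_diagMetric h hK, diagMetric, Matrix.diagonal_apply_eq]
    exact div_mul_cancel₀ _ (h.self_of_nhds.1 d)
  · intro f _ hf
    rw [diagMetric, Matrix.diagonal_apply_ne _ hf, mul_zero]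
  · simp

end DiagonalCurvature

/-! ### Divergence and double divergence of a sectional tensor field -/

section DiagonalDivergence

variable {ι : Type} [Fintype ι] [DecidableEq ι]
variable {e : ι → (ι → ℝ) → ℝ} {l : ι → ι → (ι → ℝ) → ℝ} {x : ι → ℝ}
variable {p : ι → ι → (ι → ℝ) → ℝ} {n : ι → ι → ι → (ι → ℝ) → ℝ}

/-- The tensor field `p_{ab} (g_{ac} g_{bd} - g_{ad} g_{bc})` of the diagonal metric with
entries `e`. -/
def diagField (e : ι → (ι → ℝ) → ℝ) (p : ι → ι → (ι → ℝ) → ℝ) (x : ι → ℝ) : Tensor4 ι :=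
  diagCurv (fun a => e a x) (fun a b => p a b x)

/-- The covariant derivative of `diagField e p`, where `n a b c = ∂_c p_{ab}`. -/
def diagCov (e : ι → (ι → ℝ) → ℝ) (l : ι → ι → (ι → ℝ) → ℝ) (p : ι → ι → (ι → ℝ) → ℝ)
    (n : ι → ι → ι → (ι → ℝ) → ℝ) (q a b c d : ι) (x : ι → ℝ) : ℝ :=
  ((if a = c then 1 else 0) * (if b = d then 1 else 0)
      - (if a = d then 1 else 0) * (if b = c then 1 else 0)) *
    (e a x * e b x * (n a b q x + 2 * (l a q x + l b q x) * p a b x))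
  - ((if b = d then diagGamma e l q a c x * (e c x * e b x * p c b x) else 0)
      - (if b = c then diagGamma e l q a d x * (e d x * e b x * p d b x) else 0)
    + ((if a = c then diagGamma e l q b d x * (e a x * e d x * p a d x) else 0)
      - (if a = d then diagGamma e l q b c x * (e a x * e c x * p a c x) else 0))
    + ((if b = d then diagGamma e l q c a x * (e a x * e b x * p a b x) else 0)
      - (if a = d then diagGamma e l q c b x * (e a x * e b x * p a b x) else 0))
    + ((if a = c then diagGamma e l q d b x * (e a x * e b x * p a b x) else 0)
      - (if b = c then diagGamma e l q d a x * (e a x * e b x * p a b x) else 0)))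

theorem hasPd_diagField (h : IsLogDeriv e l x) (hp : ∀ a b c, HasPd c (p a b) (n a b c x) x)
    (q a b c d : ι) :
    HasPd q (fun y => diagField e p y a b c d)
      (((if a = c then 1 else 0) * (if b = d then 1 else 0)
        - (if a = d then 1 else 0) * (if b = c then 1 else 0)) *
      (e a x * e b x * (n a b q x + 2 * (l a q x + l b q x) * p a b x))) x := by
  refine ((((h.2 a q).mul (h.2 b q)).mul (hp a b q)).mul (hasPd_const _)).congr_value ?_
  ring

theorem covDeriv4_diagField (h : IsLogDeriv e l x)
    (hp : ∀ a b c, HasPd c (p a b) (n a b c x) x) (q a b c d : ι) :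
    covDeriv4 (diagMetric e) (diagField e p) x q a b c d = diagCov e l p n q a b c d x := by
  unfold covDeriv4
  rw [(hasPd_diagField h hp q a b c d).pd_eq, diagCov]
  congr 1
  simp only [christoffel_diagMetric h, diagField, diagCurv, Finset.sum_add_distrib]
  simp only [mul_sub, Finset.sum_sub_distrib, mul_ite, mul_one, mul_zero,
    Finset.sum_ite_eq, Finset.sum_ite_eq', Finset.mem_univ, if_true]
  refine congrArg₂ (· + ·) (congrArg₂ (· + ·) (congrArg₂ (· + ·) ?_ ?_) ?_) ?_ <;>
    refine congrArg₂ (· - ·) ?_ ?_ <;> split_ifs <;> simp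

theorem diagGamma_swap (a b c : ι) : diagGamma e l a b c x = diagGamma e l b a c x := by
  unfold diagGamma
  by_cases h : a = b
  · subst h; rfl
  · have h' : b ≠ a := fun t => h t.symm
    simp only [if_neg h, if_neg h']
    ring

theorem diagGamma_self (h : IsLogDeriv e l x) (a c : ι) : diagGamma e l a c a x = l a c x := by
  have := h.1 a
  unfold diagGamma
  by_cases h : a = c
  · subst h; simp; field_simp; ring
  · have h' : c ≠ a := fun t => h t.symm
    simp [h, h']

/-- This is `g^{qr} Γ_{qr}^c`, which enters the divergence when the connection acts on the
contracted slot. -/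
theorem sum_diagGamma_div (h : IsLogDeriv e l x) (c : ι) :
    ∑ q, (e q x)⁻¹ * diagGamma e l q q c x = (2 * l c c x - ∑ q, l q c x) / e c x := by
  have h1 : ∀ q, (e q x)⁻¹ * diagGamma e l q q c x =
      (if q = c then 2 * l c c x / e c x else 0) - l q c x / e c x := by
    intro q
    have := h.1 q
    have := h.1 c
    unfold diagGamma
    by_cases hq : q = c
    · subst hq; simp; field_simp; ring
    · simp [hq]; field_simp
  rw [Finset.sum_congr rfl fun q _ => h1 q, Finset.sum_sub_distrib, ← Finset.sum_div]
  simp [sub_div]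

/-- The divergence `∇^q P_{acbq}` of `diagField e p`, for `b = a ≠ c`. -/
theorem diagCov_div_same (h : IsLogDeriv e l x) {a c : ι} (hac : a ≠ c) :
    ∑ q, (e q x)⁻¹ * diagCov e l p n q a c a q x =
      e a x * (n a c c x + ∑ q, if q = a then 0 else l q c x * (p a c x - p a q x)) := by
  have hca : c ≠ a := hac.symm
  have ha := h.1 a
  have hc := h.1 c
  -- For generic `q` only the term with `p a q` and the contracted Christoffel symbol occur; the
  -- terms with an `if` are the corrections at `q = c` and `q = a`.
  have h1 : ∀ q, (e q x)⁻¹ * diagCov e l p n q a c a q x =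
      (if c = q then e a x * (n a c c x + 2 * (l a c x + l c c x) * p a c x) else 0)
      - (if c = q then l a c x * (e a x * p a c x) else 0)
      - e a x * (l q c x * p a q x)
      + (if a = q then l a c x * (e a x * p a a x) else 0)
      - (if c = q then l a c x * (e a x * p a c x) else 0)
      - (if a = q then l a c x * (e a x * p a c x) else 0)
      - (e a x * e c x * p a c x) * ((e q x)⁻¹ * diagGamma e l q q c x) := by
    intro q
    have hq := h.1 q
    simp only [diagCov, if_true, if_neg hca, diagGamma_self h]
    by_cases hqc : c = q
    · subst hqc
      simp only [if_true, if_neg hac, diagGamma_swap c a, diagGamma_self h]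
      field_simp
      ring
    · by_cases hqa : a = q
      · subst hqa
        simp only [if_true, if_neg hca, diagGamma_self h]
        have : diagGamma e l a a c x = - (e a x / e c x * l a c x) := by
          simp [diagGamma, hac]
        rw [this]
        field_simp
        ring
      · simp only [if_neg hqc, if_neg hqa]
        field_simp
        ring
  rw [Finset.sum_congr rfl fun q _ => h1 q]
  simp only [Finset.sum_add_distrib, Finset.sum_sub_distrib, Finset.sum_ite_eq,
    Finset.mem_univ, if_true, ← Finset.mul_sum, sum_diagGamma_div h]
  have h2 : ∀ q, (if q = a then 0 else l q c x * (p a c x - p a q x)) =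
      l q c x * p a c x - l q c x * p a q x
        - (if a = q then l a c x * (p a c x - p a a x) else 0) := by
    intro q
    by_cases hq : a = q
    · subst hq; simp; ring
    · have : q ≠ a := fun t => hq t.symm
      simp [hq, this]; ring
  rw [Finset.sum_congr rfl fun q _ => h2 q]
  simp only [Finset.sum_sub_distrib, Finset.sum_ite_eq, Finset.mem_univ, if_true,
    ← Finset.sum_mul]
  field_simp
  ring

theorem diagCov_antisymm (hs : ∀ a b, p a b x = p b a x) (hn : ∀ a b q, n a b q x = n b a q x)
    (q a b c d : ι) : diagCov e l p n q a b c d x = - diagCov e l p n q b a c d x := by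
  unfold diagCov
  rw [hs b a, hn b a q]
  rw [hs d b, hs c b, hs c a, hs d a]
  ring_nf

/-- With three different free indices no `q` leaves a surviving product of a Kronecker delta and a
connection coefficient, so the divergence vanishes term by term. -/
theorem diagCov_div_distinct {a b c : ι} (hac : a ≠ c) (hba : b ≠ a) (hbc : b ≠ c) (q : ι) :
    (e q x)⁻¹ * diagCov e l p n q a c b q x = 0 := by
  have hca : c ≠ a := hac.symm
  have hab := hba.symm
  have hcb := hbc.symm
  unfold diagCov
  by_cases hqc : c = q
  · subst hqc
    simp [diagGamma, hac, hab, hca, hba, hcb]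
  · by_cases hqa : a = q
    · subst hqa
      simp [diagGamma, hac, hab, hca, hbc, hcb]
    · simp [hqc, hqa, hab, hcb]

/-- The divergence has three free indices `a, c, b`, antisymmetric in `a, c`. Only `b = a` and `b =
c` can contribute, and antisymmetry exchanges these two, so one scalar equation per ordered pair `a
≠ c` suffices. -/
theorem diagCov_div_eq_zero (h : IsLogDeriv e l x) (hs : ∀ a b, p a b x = p b a x)
    (hn : ∀ a b q, n a b q x = n b a q x)
    (hdiv : ∀ a c, a ≠ c →
      n a c c x + ∑ q, (if q = a then 0 else l q c x * (p a c x - p a q x)) = 0)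
    (a c b : ι) : ∑ q, (e q x)⁻¹ * diagCov e l p n q a c b q x = 0 := by
  by_cases hac : a = c
  · subst hac
    refine Finset.sum_eq_zero fun q _ => ?_
    have := diagCov_antisymm (e := e) (l := l) hs hn q a a b q
    rw [show diagCov e l p n q a a b q x = 0 by linarith, mul_zero]
  by_cases hba : b = a
  · subst hba
    rw [diagCov_div_same h hac, hdiv _ _ hac, mul_zero]
  by_cases hbc : b = c
  · subst hbc
    rw [Finset.sum_congr rfl fun q _ => by rw [diagCov_antisymm hs hn q a b b q, mul_neg],
      Finset.sum_neg_distrib, diagCov_div_same h (Ne.symm hac), hdiv _ _ (Ne.symm hac),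
      mul_zero, neg_zero]
  exact Finset.sum_eq_zero fun q _ => diagCov_div_distinct hac hba hbc q

/-- A covariantly contracted derivative of a tensor with vanishing divergence vanishes. -/
theorem sum_covDeriv4Twice_eq_zero (h : IsLogDeriv e l x) (T : (ι → ℝ) → Tensor4 ι)
    (hdiv : ∀ᶠ y in nhds x, ∀ a c b,
      ∑ q, (e q y)⁻¹ * covDeriv4 (diagMetric e) T y q a c b q = 0)
    (hT : ∀ r q a b c d, ∃ u, HasPd r (fun y => covDeriv4 (diagMetric e) T y q a b c d) u x)
    (r a c b : ι) :
    ∑ d, (e d x)⁻¹ * covDeriv4Twice (diagMetric e) T x r d a c b d = 0 := by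
  have h0 := hdiv.self_of_nhds
  choose u hu using hT
  -- The divergence vanishes near `x`, hence so does its derivative along `r`; the second term comes
  -- from differentiating the inverse metric.
  have h1 : ∑ d, ((e d x)⁻¹ * u r d a c b d
      - 2 * l d r x * ((e d x)⁻¹ * covDeriv4 (diagMetric e) T x d a c b d)) = 0 := by
    have h2 : HasPd r (fun y => ∑ d, (e d y)⁻¹ * covDeriv4 (diagMetric e) T y d a c b d)
        (∑ d, ((e d x)⁻¹ * u r d a c b d
          - 2 * l d r x * ((e d x)⁻¹ * covDeriv4 (diagMetric e) T x d a c b d))) x := by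
      refine HasPd.sum _ fun d _ => ?_
      refine (((h.2 d r).inv (h.1 d)).mul (hu r d a c b d)).congr_value ?_
      have := h.1 d
      field_simp
      ring
    have h3 : (fun y => ∑ d, (e d y)⁻¹ * covDeriv4 (diagMetric e) T y d a c b d)
        =ᶠ[nhds x] fun _ => 0 := hdiv.mono fun y hy => hy a c b
    rw [← h2.pd_eq, pd_congr h3, (hasPd_const 0).pd_eq]
  unfold covDeriv4Twice
  simp only [christoffel_diagMetric h, (hu _ _ _ _ _ _).pd_eq]
  generalize hU : covDeriv4 (diagMetric e) T x = U at *
  -- Connection terms acting on a free index are multiples of the divergence itself and contribute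
  -- nothing.
  have swap : ∀ (G : ι → ℝ) (V : ι → ι → ℝ), (∀ f, ∑ d, (e d x)⁻¹ * V f d = 0) →
      ∑ d, (e d x)⁻¹ * ∑ f, G f * V f d = 0 := by
    intro G V hV
    simp only [Finset.mul_sum]
    rw [Finset.sum_comm]
    refine Finset.sum_eq_zero fun f _ => ?_
    rw [← mul_zero (G f), ← hV f, Finset.mul_sum]
    exact Finset.sum_congr rfl fun d _ => by ring
  have e1 := swap (fun f => diagGamma e l r a f x) (fun f d => U d f c b d) fun f => h0 f c b
  have e2 := swap (fun f => diagGamma e l r c f x) (fun f d => U d a f b d) fun f => h0 a f b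
  have e3 := swap (fun f => diagGamma e l r b f x) (fun f d => U d a c f d) fun f => h0 a c f
  -- Metric compatibility: the two connection terms acting on the contracted pair amount to the
  -- derivative of the inverse metric found in `h1`. Off the diagonal `f = d` they cancel against
  -- each other.
  have key : ∑ d, (e d x)⁻¹ * ∑ f, (diagGamma e l r d f x * U f a c b d
      + diagGamma e l r d f x * U d a c b f)
      = ∑ d, 2 * l d r x * ((e d x)⁻¹ * U d a c b d) := by
    simp only [Finset.mul_sum, mul_add, Finset.sum_add_distrib]
    rw [Finset.sum_comm, ← Finset.sum_add_distrib]
    refine Finset.sum_congr rfl fun d _ => ?_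
    rw [← Finset.sum_add_distrib, Finset.sum_eq_single d]
    · rw [diagGamma_swap r d, diagGamma_self h]; ring
    · intro f _ hf
      have hd := h.1 d
      have hf' := h.1 f
      have hr := h.1 r
      unfold diagGamma
      by_cases hrd : r = d <;> by_cases hrf : r = f
      · exact absurd (hrf.symm.trans hrd) hf
      · subst hrd
        simp [hrf]
        field_simp
        simp [hf]
      · subst hrf
        simp [hrd, hf.symm]
        field_simp
        simp
      · simp [hrd, hrf, hf.symm, hf]
    · simp
  rw [Finset.sum_sub_distrib] at h1
  simp only [Finset.sum_add_distrib, mul_add, mul_sub, Finset.sum_sub_distrib] at e1 e2 e3 key ⊢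
  linarith

end DiagonalDivergence

/-! ### The theories as polynomials in the invariants -/

/-- The values of the curvature invariants on which the theories depend; `tₘ` is the trace of the
`m`-th power of the traceless Ricci tensor. -/
@[ext] structure CurvInv where
  (R W₂ W₃ Z₂ Z₃ X₃ X₄ Y₃ Y₄ t₂ t₃ t₄ t₅ : ℝ)

/-- The invariants of a curvature tensor. -/
def invariants (D : ℕ) (g : Matrix (Coord D) (Coord D) ℝ) (Rm : Tensor4 (Coord D)) : CurvInv where
  R := scal D g Rm
  W₂ := W2 D g Rm
  W₃ := W3 D g Rm
  Z₂ := Z2 D g Rm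
  Z₃ := Z3 D g Rm
  X₃ := X3 D g Rm
  X₄ := X4 D g Rm
  Y₃ := Y3 D g Rm
  Y₄ := Y4 D g Rm
  t₂ := zTrace D g Rm 2
  t₃ := zTrace D g Rm 3
  t₄ := zTrace D g Rm 4
  t₅ := zTrace D g Rm 5

/-- The part `𝓩_{(n)}` of the theory as a polynomial in the invariants. -/
def curlyZOf (D n : ℕ) (v : CurvInv) : ℝ :=
  v.R ^ n
    + ∑ l ∈ Finset.range (n - 1), v.R ^ (n - l - 2) *
        (gammaCoeff D n (-2) l * (v.W₂ ^ (l / 2) * (if Even l then v.W₂ else v.W₃))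
          + gammaCoeff D n l (-2) * (v.Z₂ ^ (l / 2) * (if Even l then v.Z₂ else v.Z₃)))
    + ∑ l ∈ Finset.range (n - 2), v.R ^ (n - l - 3) *
        (gammaCoeff D n (-1) l * (v.W₂ ^ (l / 2) * (if Even l then v.X₃ else v.X₄))
          + gammaCoeff D n l (-1) * (v.Z₂ ^ (l / 2) * (if Even l then v.Y₃ else v.Y₄)))
    + ∑ l ∈ Finset.range (n - 3), ∑ p ∈ Finset.range (n - l - 3),
        gammaCoeff D n l p * v.R ^ (n - l - p - 4)
          * (v.W₂ ^ (p / 2) * (if Even p then v.W₂ else v.W₃))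
          * (v.Z₂ ^ (l / 2) * (if Even l then v.Z₂ else v.Z₃))

/-- The invariants `𝓣_{(l+2)}` for `l ≥ 2`. -/
def trivialTOf (D l : ℕ) (v : CurvInv) : ℝ :=
  2 * (1 / ((D : ℝ) * ((D : ℝ) - 1)) * v.t₂) ^ (l / 2 - 1) /
      ((D : ℝ) ^ 3 * ((D : ℝ) ^ 2 - 4 * (D : ℝ) + 3)) *
    (if Even l then
      ((D : ℝ) - 2) * (v.t₄
        - ((D : ℝ) ^ 2 - 6 * (D : ℝ) + 12) / (2 * (D : ℝ) * ((D : ℝ) - 2)) * v.t₂ ^ 2)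
    else
      -(v.t₅ - ((D : ℝ) * ((D : ℝ) - 4) + 8) / (2 * (D : ℝ) * ((D : ℝ) - 2)) * (v.t₂ * v.t₃)))

/-- The theory as a polynomial in the invariants. -/
def curlyQOf (D n : ℕ) (v : CurvInv) : ℝ :=
  curlyZOf D n v
    + ∑ l ∈ Finset.range (n - 1), etaCoeff D n l * v.R ^ (n - l - 2) * trivialTOf D l v

/-- The members `n = 1, 2`, defined separately, also obey the general formula: for `n = 1` every sum
is empty, and for `n = 2` only `𝖶₂` and `𝖹₂` remain, with the two coefficients computed below. -/
theorem curlyZ_eq_curlyZOf {D n : ℕ} (hD : 5 ≤ D) (hn : 1 ≤ n)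
    (g : Matrix (Coord D) (Coord D) ℝ) (Rm : Tensor4 (Coord D)) :
    curlyZ D n g Rm = curlyZOf D n (invariants D g Rm) := by
  have h5 : (5 : ℝ) ≤ D := by exact_mod_cast hD
  unfold curlyZ
  split_ifs with h1 h2
  · subst h1
    simp [curlyZOf, invariants]
  · subst h2
    have e1 : (D : ℝ) ≠ 0 := by linarith
    have e2 : (D : ℝ) - 1 ≠ 0 := by linarith
    have e3 : (D : ℝ) - 2 ≠ 0 := by linarith
    have e4 : (D : ℝ) - 3 ≠ 0 := by linarith
    have e5 : (D : ℝ) ^ 2 - D = D * (D - 1) := by ring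
    have g1 : gammaCoeff D 2 (-2) 0 = (D : ℝ) * (D - 1) ^ 2 * (D - 2) / 4 := by
      simp only [gammaCoeff]
      norm_num [e5, show Int.toNat 2 = 2 from rfl]
      field_simp
      ring
    have g2 : gammaCoeff D 2 0 (-2) = - (2 * (D : ℝ) ^ 2 * (D - 1) / (D - 2)) := by
      simp only [gammaCoeff]
      norm_num [e5, show Int.toNat 2 = 2 from rfl]
      field_simp
      ring
    simp [curlyZOf, invariants, g1, g2, W2, Z2]
    field_simp
    ring
  · rfl

/-- After division by `D - 4` the second summand of the bracket is `-2 (D - 2)` and cancels the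
first; the same happens for `l = 1`. No inverse power of `𝓚₂` therefore enters the theories. -/
theorem etaCoeff_zero {D n : ℕ} (hD : 5 ≤ D) : etaCoeff D n 0 = 0 := by
  have h5 : (5 : ℝ) ≤ D := by exact_mod_cast hD
  have e1 : (D : ℝ) - 4 ≠ 0 := by linarith
  unfold etaCoeff
  refine mul_eq_zero_of_right _ ?_
  simp
  field_simp
  ring

theorem etaCoeff_one {D n : ℕ} (hD : 5 ≤ D) : etaCoeff D n 1 = 0 := by
  have h5 : (5 : ℝ) ≤ D := by exact_mod_cast hD
  have e1 : (D : ℝ) - 4 ≠ 0 := by linarith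
  unfold etaCoeff
  refine mul_eq_zero_of_right _ ?_
  norm_num
  field_simp
  ring

/-- For `l < 2` the truncated exponent in `trivialTOf` differs from the integer exponent `-1` in
`trivialT`, but the coefficient is zero. For `n ≤ 3` only these values of `l` occur, which makes the
correction sum vanish and covers both branches of `curlyQ`. -/
theorem curlyQ_eq_curlyQOf {D n : ℕ} (hD : 5 ≤ D) (hn : 1 ≤ n)
    (g : Matrix (Coord D) (Coord D) ℝ) (Rm : Tensor4 (Coord D)) :
    curlyQ D n g Rm = curlyQOf D n (invariants D g Rm) := by
  have key : ∀ l, etaCoeff D n l * scal D g Rm ^ (n - l - 2) * trivialT D l g Rm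
      = etaCoeff D n l * (invariants D g Rm).R ^ (n - l - 2)
        * trivialTOf D l (invariants D g Rm) := by
    intro l
    rcases Nat.lt_or_ge l 2 with hl | hl
    · interval_cases l
      · simp [etaCoeff_zero hD]
      · simp [etaCoeff_one hD]
    · have : (((l : ℤ) - 2 - (l : ℤ) % 2) / 2) = ((l / 2 - 1 : ℕ) : ℤ) := by omega
      simp only [trivialT, trivialTOf, this, zpow_natCast, invariants, K2]
  unfold curlyQ curlyQOf
  rw [curlyZ_eq_curlyZOf hD hn, Finset.sum_congr rfl fun l _ => key l]
  split_ifs with h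
  · rw [Finset.sum_eq_zero, add_zero]
    intro l hl
    have : l < 2 := by have := Finset.mem_range.1 hl; omega
    interval_cases l
    · simp [etaCoeff_zero hD]
    · simp [etaCoeff_one hD]
  · rfl

/-! ### Invariants for a diagonal metric -/

section DiagonalInvariants

variable {D : ℕ} {e : Coord D → ℝ}

theorem ricci_diagonal (he : ∀ a, e a ≠ 0) (T : Tensor4 (Coord D)) (a b : Coord D) :
    ricci D (Matrix.diagonal e) T a b = ∑ d, (e d)⁻¹ * T a d b d := by
  unfold ricci
  rw [inv_diagonal_of_ne he]
  refine Finset.sum_congr rfl fun d _ => ?_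
  rw [Finset.sum_eq_single d]
  · rw [Matrix.diagonal_apply_eq]
  · intro f _ hf
    rw [Matrix.diagonal_apply_ne _ hf, zero_mul]
  · simp

theorem scal_diagonal (he : ∀ a, e a ≠ 0) (T : Tensor4 (Coord D)) :
    scal D (Matrix.diagonal e) T = ∑ a, (e a)⁻¹ * ricci D (Matrix.diagonal e) T a a := by
  unfold scal
  rw [inv_diagonal_of_ne he]
  refine Finset.sum_congr rfl fun d _ => ?_
  rw [Finset.sum_eq_single d]
  · rw [Matrix.diagonal_apply_eq]
  · intro f _ hf
    rw [Matrix.diagonal_apply_ne _ hf.symm, zero_mul]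
  · simp

theorem zMix_diagonal (he : ∀ a, e a ≠ 0) (T : Tensor4 (Coord D)) (a b : Coord D) :
    zMix D (Matrix.diagonal e) T a b = (e a)⁻¹ * zLow D (Matrix.diagonal e) T a b := by
  unfold zMix
  rw [inv_diagonal_of_ne he, Matrix.diagonal_mul]

theorem zUp_diagonal (he : ∀ a, e a ≠ 0) (T : Tensor4 (Coord D)) (a b : Coord D) :
    zUp D (Matrix.diagonal e) T a b = (e a)⁻¹ * zLow D (Matrix.diagonal e) T a b * (e b)⁻¹ := by
  unfold zUp
  rw [inv_diagonal_of_ne he, Matrix.mul_diagonal, Matrix.diagonal_mul]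

theorem raise4_diagonal (he : ∀ a, e a ≠ 0) (T : Tensor4 (Coord D)) (a b c d : Coord D) :
    raise4 (Matrix.diagonal e) T a b c d =
      (e a)⁻¹ * (e b)⁻¹ * (e c)⁻¹ * (e d)⁻¹ * T a b c d := by
  unfold raise4
  simp only [inv_diagonal_of_ne he, Matrix.diagonal_apply, ite_mul, mul_ite, zero_mul, mul_zero,
    Finset.sum_ite_eq, Finset.mem_univ, if_true]

theorem lower4_diagonal (T : Tensor4 (Coord D)) (a b c d : Coord D) :
    lower4 (Matrix.diagonal e) T a b c d = e a * e b * e c * e d * T a b c d := by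
  unfold lower4
  simp only [Matrix.diagonal_apply, ite_mul, mul_ite, zero_mul, mul_zero,
    Finset.sum_ite_eq, Finset.mem_univ, if_true]

theorem weylMix_diagonal (he : ∀ a, e a ≠ 0) (T : Tensor4 (Coord D)) (a b c d : Coord D) :
    weylMix D (Matrix.diagonal e) T a b c d =
      (e c)⁻¹ * (e d)⁻¹ * weyl D (Matrix.diagonal e) T a b c d := by
  unfold weylMix
  simp only [inv_diagonal_of_ne he, Matrix.diagonal_apply, ite_mul, mul_ite, zero_mul, mul_zero,
    Finset.sum_ite_eq, Finset.mem_univ, if_true]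

/-! ### Invariance under reflections of the coordinates -/

/-- The tensor in coordinates with some of the axes reflected. -/
def reflect (ε : Coord D → ℝ) (T : Tensor4 (Coord D)) : Tensor4 (Coord D) :=
  fun a b c d => ε a * ε b * ε c * ε d * T a b c d

variable {ε : Coord D → ℝ}

theorem ricci_reflect (he : ∀ a, e a ≠ 0) (hε : ∀ a, ε a * ε a = 1) (T : Tensor4 (Coord D))
    (a b : Coord D) : ricci D (Matrix.diagonal e) (reflect ε T) a b =
      ε a * ε b * ricci D (Matrix.diagonal e) T a b := by
  rw [ricci_diagonal he, ricci_diagonal he, Finset.mul_sum]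
  refine Finset.sum_congr rfl fun d _ => ?_
  unfold reflect
  linear_combination (e d)⁻¹ * ε a * ε b * T a d b d * hε d

theorem scal_reflect (he : ∀ a, e a ≠ 0) (hε : ∀ a, ε a * ε a = 1) (T : Tensor4 (Coord D)) :
    scal D (Matrix.diagonal e) (reflect ε T) = scal D (Matrix.diagonal e) T := by
  rw [scal_diagonal he, scal_diagonal he]
  simp only [ricci_reflect he hε, hε, one_mul]

theorem diagonal_reflect (hε : ∀ a, ε a * ε a = 1) (a b : Coord D) :
    Matrix.diagonal e a b = ε a * ε b * Matrix.diagonal e a b := by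
  by_cases h : a = b
  · subst h; rw [hε, one_mul]
  · rw [Matrix.diagonal_apply_ne _ h, mul_zero]

theorem zLow_reflect (he : ∀ a, e a ≠ 0) (hε : ∀ a, ε a * ε a = 1) (T : Tensor4 (Coord D))
    (a b : Coord D) : zLow D (Matrix.diagonal e) (reflect ε T) a b =
      ε a * ε b * zLow D (Matrix.diagonal e) T a b := by
  unfold zLow
  rw [ricci_reflect he hε, scal_reflect he hε]
  linear_combination (-1 / (D : ℝ)) * scal D (Matrix.diagonal e) T
    * diagonal_reflect (e := e) hε a b

theorem zMix_reflect (he : ∀ a, e a ≠ 0) (hε : ∀ a, ε a * ε a = 1) (T : Tensor4 (Coord D))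
    (a b : Coord D) : zMix D (Matrix.diagonal e) (reflect ε T) a b =
      ε a * ε b * zMix D (Matrix.diagonal e) T a b := by
  rw [zMix_diagonal he, zMix_diagonal he, zLow_reflect he hε]
  ring

theorem zUp_reflect (he : ∀ a, e a ≠ 0) (hε : ∀ a, ε a * ε a = 1) (T : Tensor4 (Coord D))
    (a b : Coord D) : zUp D (Matrix.diagonal e) (reflect ε T) a b =
      ε a * ε b * zUp D (Matrix.diagonal e) T a b := by
  rw [zUp_diagonal he, zUp_diagonal he, zLow_reflect he hε]
  ring

/-- A reflection conjugates `Z^a_b` by a diagonal matrix whose square is the identity. -/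
theorem zTrace_reflect (he : ∀ a, e a ≠ 0) (hε : ∀ a, ε a * ε a = 1) (T : Tensor4 (Coord D))
    (m : ℕ) : zTrace D (Matrix.diagonal e) (reflect ε T) m = zTrace D (Matrix.diagonal e) T m := by
  have hS : Matrix.diagonal ε * Matrix.diagonal ε = (1 : Matrix (Coord D) (Coord D) ℝ) := by
    rw [Matrix.diagonal_mul_diagonal, ← Matrix.diagonal_one]
    congr 1
    funext a
    exact hε a
  have hZ : zMix D (Matrix.diagonal e) (reflect ε T) =
      Matrix.diagonal ε * zMix D (Matrix.diagonal e) T * Matrix.diagonal ε := by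
    ext a b
    rw [zMix_reflect he hε, Matrix.mul_diagonal, Matrix.diagonal_mul]
    ring
  have hP : ∀ m : ℕ, zMix D (Matrix.diagonal e) (reflect ε T) ^ m =
      Matrix.diagonal ε * zMix D (Matrix.diagonal e) T ^ m * Matrix.diagonal ε := by
    intro m
    induction m with
    | zero => simp [hS]
    | succ m ih =>
      rw [pow_succ, ih, hZ, pow_succ]
      calc _ = Matrix.diagonal ε * zMix D (Matrix.diagonal e) T ^ m
            * (Matrix.diagonal ε * Matrix.diagonal ε)
            * zMix D (Matrix.diagonal e) T * Matrix.diagonal ε := by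
              simp only [Matrix.mul_assoc]
        _ = _ := by rw [hS, Matrix.mul_one]; simp only [Matrix.mul_assoc]
  unfold zTrace
  rw [hP, Matrix.trace_mul_comm, ← Matrix.mul_assoc, hS, Matrix.one_mul]

theorem weyl_reflect (he : ∀ a, e a ≠ 0) (hε : ∀ a, ε a * ε a = 1) (T : Tensor4 (Coord D)) :
    weyl D (Matrix.diagonal e) (reflect ε T) = reflect ε (weyl D (Matrix.diagonal e) T) := by
  funext a b c d
  have h1 : ∀ a b c d : Coord D, Matrix.diagonal e a b * (ε c * ε d *
      ricci D (Matrix.diagonal e) T c d) = ε a * ε b * ε c * ε d * (Matrix.diagonal e a b *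
        ricci D (Matrix.diagonal e) T c d) := by
    intro a b c d
    linear_combination (ε c * ε d * ricci D (Matrix.diagonal e) T c d)
      * diagonal_reflect (e := e) hε a b
  have h2 : ∀ a b c d : Coord D, Matrix.diagonal e a b * Matrix.diagonal e c d =
      ε a * ε b * ε c * ε d * (Matrix.diagonal e a b * Matrix.diagonal e c d) := by
    intro a b c d
    conv_lhs => rw [diagonal_reflect hε a b, diagonal_reflect hε c d]
    ring
  unfold weyl
  simp only [ricci_reflect he hε, scal_reflect he hε, h1]
  rw [h2 c a b d, h2 c b a d]
  simp only [reflect]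
  ring

theorem weylUp_reflect (he : ∀ a, e a ≠ 0) (hε : ∀ a, ε a * ε a = 1) (T : Tensor4 (Coord D))
    (a b c d : Coord D) : weylUp D (Matrix.diagonal e) (reflect ε T) a b c d =
      ε a * ε b * ε c * ε d * weylUp D (Matrix.diagonal e) T a b c d := by
  unfold weylUp
  rw [raise4_diagonal he, raise4_diagonal he, weyl_reflect he hε, reflect]
  ring

theorem weylMix_reflect (he : ∀ a, e a ≠ 0) (hε : ∀ a, ε a * ε a = 1) (T : Tensor4 (Coord D))
    (a b c d : Coord D) : weylMix D (Matrix.diagonal e) (reflect ε T) a b c d =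
      ε a * ε b * ε c * ε d * weylMix D (Matrix.diagonal e) T a b c d := by
  rw [weylMix_diagonal he, weylMix_diagonal he, weyl_reflect he hε, reflect]
  ring

theorem weylSq_reflect (he : ∀ a, e a ≠ 0) (hε : ∀ a, ε a * ε a = 1) (T : Tensor4 (Coord D)) :
    weylSq D (Matrix.diagonal e) (reflect ε T) = weylSq D (Matrix.diagonal e) T := by
  unfold weylSq
  refine Finset.sum_congr rfl fun a _ => Finset.sum_congr rfl fun b _ =>
    Finset.sum_congr rfl fun c _ => Finset.sum_congr rfl fun d _ => ?_
  rw [weylUp_reflect he hε, weyl_reflect he hε, reflect]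
  calc _ = (ε a * ε a) * (ε b * ε b) * (ε c * ε c) * (ε d * ε d)
        * (weyl D (Matrix.diagonal e) T a b c d * weylUp D (Matrix.diagonal e) T a b c d) := by
        ring
    _ = _ := by simp only [hε, one_mul]

theorem W3_reflect (he : ∀ a, e a ≠ 0) (hε : ∀ a, ε a * ε a = 1) (T : Tensor4 (Coord D)) :
    W3 D (Matrix.diagonal e) (reflect ε T) = W3 D (Matrix.diagonal e) T := by
  unfold W3
  refine congrArg _ ?_
  refine Finset.sum_congr rfl fun a _ => Finset.sum_congr rfl fun b _ =>
    Finset.sum_congr rfl fun c _ => Finset.sum_congr rfl fun d _ =>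
    Finset.sum_congr rfl fun p _ => Finset.sum_congr rfl fun q _ => ?_
  simp only [weylMix_reflect he hε]
  generalize weylMix D (Matrix.diagonal e) T = W
  calc _ = (ε a * ε a) * (ε b * ε b) * (ε c * ε c) * (ε d * ε d) * (ε p * ε p) * (ε q * ε q)
        * (W a b c d * W c d p q * W p q a b) := by ring
    _ = _ := by simp only [hε, one_mul]

theorem X3_reflect (he : ∀ a, e a ≠ 0) (hε : ∀ a, ε a * ε a = 1) (T : Tensor4 (Coord D)) :
    X3 D (Matrix.diagonal e) (reflect ε T) = X3 D (Matrix.diagonal e) T := by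
  unfold X3
  refine congrArg _ ?_
  refine Finset.sum_congr rfl fun a _ => Finset.sum_congr rfl fun b _ =>
    Finset.sum_congr rfl fun c _ => Finset.sum_congr rfl fun d _ =>
    Finset.sum_congr rfl fun p _ => ?_
  simp only [weylUp_reflect he hε, zMix_reflect he hε, weyl_reflect he hε, reflect]
  generalize weyl D (Matrix.diagonal e) T = W
  generalize weylUp D (Matrix.diagonal e) T = V
  generalize zMix D (Matrix.diagonal e) T = Z
  calc _ = (ε a * ε a) * (ε b * ε b) * (ε c * ε c) * (ε d * ε d) * (ε p * ε p)
        * (W a c d p * V b c d p * Z a b) := by ring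
    _ = _ := by simp only [hε, one_mul]

theorem X4_reflect (he : ∀ a, e a ≠ 0) (hε : ∀ a, ε a * ε a = 1) (T : Tensor4 (Coord D)) :
    X4 D (Matrix.diagonal e) (reflect ε T) = X4 D (Matrix.diagonal e) T := by
  unfold X4
  refine congrArg _ ?_
  refine Finset.sum_congr rfl fun a _ => Finset.sum_congr rfl fun b _ =>
    Finset.sum_congr rfl fun c _ => Finset.sum_congr rfl fun d _ =>
    Finset.sum_congr rfl fun p _ => Finset.sum_congr rfl fun q _ =>
    Finset.sum_congr rfl fun r _ => ?_
  simp only [inv_diagonal_of_ne he, Matrix.diagonal_apply, ite_mul, zero_mul, Finset.sum_ite_eq,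
    Finset.mem_univ, if_true]
  simp only [weylUp_reflect he hε, zUp_reflect he hε, weyl_reflect he hε, reflect]
  generalize weyl D (Matrix.diagonal e) T = W
  generalize weylUp D (Matrix.diagonal e) T = V
  generalize zUp D (Matrix.diagonal e) T = Z
  calc _ = (ε a * ε a) * (ε b * ε b) * (ε c * ε c) * (ε d * ε d) * (ε p * ε p)
        * (ε q * ε q) * (ε r * ε r)
        * (Z a b * W a c b d * V c p q r * ((e d)⁻¹ * W d p q r)) := by ring
    _ = _ := by simp only [hε, one_mul]

theorem Y3_reflect (he : ∀ a, e a ≠ 0) (hε : ∀ a, ε a * ε a = 1) (T : Tensor4 (Coord D)) :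
    Y3 D (Matrix.diagonal e) (reflect ε T) = Y3 D (Matrix.diagonal e) T := by
  unfold Y3
  refine congrArg _ ?_
  refine Finset.sum_congr rfl fun a _ => Finset.sum_congr rfl fun b _ =>
    Finset.sum_congr rfl fun c _ => Finset.sum_congr rfl fun d _ => ?_
  simp only [weylMix_reflect he hε, zMix_reflect he hε]
  generalize weylMix D (Matrix.diagonal e) T = W
  generalize zMix D (Matrix.diagonal e) T = Z
  calc _ = (ε a * ε a) * (ε b * ε b) * (ε c * ε c) * (ε d * ε d)
        * (W a c b d * Z a b * Z c d) := by ring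
    _ = _ := by simp only [hε, one_mul]

theorem Y4_reflect (he : ∀ a, e a ≠ 0) (hε : ∀ a, ε a * ε a = 1) (T : Tensor4 (Coord D)) :
    Y4 D (Matrix.diagonal e) (reflect ε T) = Y4 D (Matrix.diagonal e) T := by
  unfold Y4
  refine congrArg _ ?_
  refine Finset.sum_congr rfl fun a _ => Finset.sum_congr rfl fun b _ =>
    Finset.sum_congr rfl fun c _ => Finset.sum_congr rfl fun d _ =>
    Finset.sum_congr rfl fun p _ => ?_
  simp only [weylUp_reflect he hε, zMix_reflect he hε, zLow_reflect he hε]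
  generalize weylUp D (Matrix.diagonal e) T = W
  generalize zMix D (Matrix.diagonal e) T = Z
  generalize zLow D (Matrix.diagonal e) T = V
  calc _ = (ε a * ε a) * (ε b * ε b) * (ε c * ε c) * (ε d * ε d) * (ε p * ε p)
        * (Z a b * V a c * W b d c p * V d p) := by ring
    _ = _ := by simp only [hε, one_mul]

/-- Every index is summed in a pair and so each sign occurs squared. This symmetry later kills the
components of `P` that are not sectional. -/
theorem invariants_reflect (he : ∀ a, e a ≠ 0) (hε : ∀ a, ε a * ε a = 1)
    (T : Tensor4 (Coord D)) : invariants D (Matrix.diagonal e) (reflect ε T) =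
      invariants D (Matrix.diagonal e) T := by
  simp only [invariants, scal_reflect he hε, W2, weylSq_reflect he hε, W3_reflect he hε, Z2, Z3,
    zTrace_reflect he hε, X3_reflect he hε, X4_reflect he hε, Y3_reflect he hε, Y4_reflect he hε]

end DiagonalInvariants

/-! ### Invariants in terms of sectional curvatures -/

section SectionalInvariants

variable {D : ℕ}

/-- The eigenvalues of the Ricci tensor for the sectional curvatures `K`. -/
def secRic (K : Coord D → Coord D → ℝ) (a : Coord D) : ℝ := ∑ b, K a b

/-- The Ricci scalar for the sectional curvatures `K`. -/
def secScal (K : Coord D → Coord D → ℝ) : ℝ := ∑ a, secRic K a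

/-- The eigenvalues of the traceless Ricci tensor for the sectional curvatures `K`. -/
def secZ (K : Coord D → Coord D → ℝ) (a : Coord D) : ℝ :=
  secRic K a - 1 / (D : ℝ) * secScal K

/-- The eigenvalues of the Weyl tensor for the sectional curvatures `K`. -/
def secW (K : Coord D → Coord D → ℝ) (a b : Coord D) : ℝ :=
  if a = b then 0 else K a b - 1 / ((D : ℝ) - 2) * (secRic K a + secRic K b)
    + 1 / (((D : ℝ) - 1) * ((D : ℝ) - 2)) * secScal K

/-- The curvature invariants for the sectional curvatures `K`. -/
def secInv (K : Coord D → Coord D → ℝ) : CurvInv where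
  R := secScal K
  W₂ := 4 / (((D : ℝ) - 2) ^ 2 * ((D : ℝ) - 1) * ((D : ℝ) - 3)) *
    ∑ a, ∑ b, 2 * secW K a b ^ 2
  W₃ := 8 / (((D : ℝ) - 3) * ((D : ℝ) - 2) *
      (2 * (2 - ((D : ℝ) - 3) ^ 2) + ((D : ℝ) - 2) ^ 2 * ((D : ℝ) - 3) ^ 2)) *
    ∑ a, ∑ b, 4 * secW K a b ^ 3
  Z₂ := 2 / ((D : ℝ) * ((D : ℝ) - 2)) * ∑ a, secZ K a ^ 2
  Z₃ := -4 / ((D : ℝ) * ((D : ℝ) - 2) * ((D : ℝ) - 4)) * ∑ a, secZ K a ^ 3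
  X₃ := -8 / (((D : ℝ) - 1) ^ 2 * ((D : ℝ) - 2) * ((D : ℝ) - 3) * ((D : ℝ) - 4)) *
    ∑ a, ∑ c, 2 * secW K a c ^ 2 * secZ K a
  X₄ := -32 / ((D : ℝ) * ((D : ℝ) - 1) ^ 2 * ((D : ℝ) - 2) * ((D : ℝ) - 3) ^ 2
      * ((D : ℝ) - 4)) * ∑ a, ∑ c, secZ K a * secW K a c * ∑ b, 2 * secW K c b ^ 2
  Y₃ := 8 / ((D : ℝ) ^ 2 * ((D : ℝ) - 2) * ((D : ℝ) - 3)) *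
    ∑ a, ∑ c, secW K a c * secZ K a * secZ K c
  Y₄ := -16 / ((D : ℝ) ^ 2 * ((D : ℝ) - 2) * ((D : ℝ) - 3) * ((D : ℝ) - 4)) *
    ∑ a, ∑ c, secZ K a ^ 2 * secW K a c * secZ K c
  t₂ := ∑ a, secZ K a ^ 2
  t₃ := ∑ a, secZ K a ^ 3
  t₄ := ∑ a, secZ K a ^ 4
  t₅ := ∑ a, secZ K a ^ 5

/-- The generalized Kronecker delta `δ_{ac} δ_{bd} - δ_{ad} δ_{bc}`. -/
def pairDelta (a b c d : Coord D) : ℝ :=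
  (if a = c then 1 else 0) * (if b = d then 1 else 0)
    - (if a = d then 1 else 0) * (if b = c then 1 else 0)

/-- Each contraction over an antisymmetric index pair of a sectional tensor has two terms; all the
Weyl contractions below are evaluated in this way. -/
theorem sum_pairDelta_mul (a b : Coord D) (F : Coord D → Coord D → ℝ) :
    ∑ c, ∑ d, pairDelta a b c d * F c d = F a b - F b a := by
  simp only [pairDelta, sub_mul, Finset.sum_sub_distrib]
  simp only [mul_ite, ite_mul, mul_one, mul_zero, one_mul, zero_mul]
  congr 1
  · simp
  · rw [Finset.sum_comm]; simp

theorem pairDelta_self {a b : Coord D} (h : a ≠ b) : pairDelta a b a b = 1 := by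
  simp [pairDelta, h]

theorem pairDelta_swap {a b : Coord D} (h : a ≠ b) : pairDelta a b b a = -1 := by
  simp [pairDelta, h]

theorem diagCurv_apply (e : Coord D → ℝ) (K : Coord D → Coord D → ℝ) (a b c d : Coord D) :
    diagCurv e K a b c d = e a * e b * K a b * pairDelta a b c d := rfl

variable {e : Coord D → ℝ} {K : Coord D → Coord D → ℝ}

theorem ricci_diagCurv (he : ∀ a, e a ≠ 0) (h0 : ∀ a, K a a = 0) (a b : Coord D) :
    ricci D (Matrix.diagonal e) (diagCurv e K) a b = if a = b then e a * secRic K a else 0 := by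
  rw [ricci_diagonal he]
  split_ifs with h
  · subst h
    rw [secRic, Finset.mul_sum]
    refine Finset.sum_congr rfl fun d _ => ?_
    have := he d
    by_cases h : a = d
    · subst h; simp [diagCurv, h0]
    · have h' : d ≠ a := fun t => h t.symm
      simp [diagCurv, h, h']
      field_simp
  · refine Finset.sum_eq_zero fun d _ => ?_
    simp only [diagCurv, if_neg h]
    by_cases hd : a = d
    · subst hd; simp [h, h0]
    · simp [hd]

theorem scal_diagCurv (he : ∀ a, e a ≠ 0) (h0 : ∀ a, K a a = 0) :
    scal D (Matrix.diagonal e) (diagCurv e K) = secScal K := by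
  rw [scal_diagonal he, secScal]
  refine Finset.sum_congr rfl fun a _ => ?_
  rw [ricci_diagCurv he h0, if_pos rfl]
  exact inv_mul_cancel_left₀ (he a) _

theorem zLow_diagCurv (he : ∀ a, e a ≠ 0) (h0 : ∀ a, K a a = 0) (a b : Coord D) :
    zLow D (Matrix.diagonal e) (diagCurv e K) a b = if a = b then e a * secZ K a else 0 := by
  unfold zLow
  rw [ricci_diagCurv he h0, scal_diagCurv he h0, Matrix.diagonal_apply, secZ]
  split_ifs <;> ring

theorem zMix_diagCurv (he : ∀ a, e a ≠ 0) (h0 : ∀ a, K a a = 0) :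
    zMix D (Matrix.diagonal e) (diagCurv e K) = Matrix.diagonal (secZ K) := by
  ext a b
  rw [zMix_diagonal he, zLow_diagCurv he h0, Matrix.diagonal_apply]
  split_ifs
  · exact inv_mul_cancel_left₀ (he a) _
  · rw [mul_zero]

theorem zTrace_diagCurv (he : ∀ a, e a ≠ 0) (h0 : ∀ a, K a a = 0) (m : ℕ) :
    zTrace D (Matrix.diagonal e) (diagCurv e K) m = ∑ a, secZ K a ^ m := by
  unfold zTrace
  rw [zMix_diagCurv he h0, Matrix.diagonal_pow, Matrix.trace_diagonal]
  simp

theorem weyl_diagCurv (he : ∀ a, e a ≠ 0) (h0 : ∀ a, K a a = 0) :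
    weyl D (Matrix.diagonal e) (diagCurv e K) = diagCurv e (secW K) := by
  funext a b c d
  unfold weyl
  simp only [ricci_diagCurv he h0, scal_diagCurv he h0, Matrix.diagonal_apply, diagCurv, secW]
  by_cases hab : a = b
  · subst hab
    simp only [if_true]
    ring
  have hba : b ≠ a := fun t => hab t.symm
  simp only [if_neg hab]
  by_cases hca : a = c
  · subst hca
    simp only [if_true, if_neg hab, if_neg hba]
    by_cases hdb : b = d
    · subst hdb
      simp only [if_true, if_neg hab, if_neg hba]
      ring
    · have hdb' : d ≠ b := fun t => hdb t.symm
      simp only [if_neg hdb, if_neg hdb']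
      ring
  · have hca' : c ≠ a := fun t => hca t.symm
    by_cases hda : a = d
    · subst hda
      simp only [if_true, if_neg hab, if_neg hba, if_neg hca, if_neg hca']
      by_cases hbc : b = c
      · subst hbc
        simp only [if_true]
        ring
      · have hbc' : c ≠ b := fun t => hbc t.symm
        simp only [if_neg hbc, if_neg hbc']
        ring
    · have hda' : d ≠ a := fun t => hda t.symm
      simp only [if_neg hca, if_neg hca', if_neg hda, if_neg hda']
      split_ifs <;> ring

theorem secW_self (a : Coord D) : secW K a a = 0 := if_pos rfl

theorem secW_comm (hs : ∀ a b, K a b = K b a) (a b : Coord D) : secW K a b = secW K b a := by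
  unfold secW
  by_cases h : a = b
  · rw [h]
  · rw [if_neg h, if_neg (Ne.symm h), hs a b]
    ring

/-- Setting the diagonal of `secW` to zero removes the need to treat `a = b` separately in the
contractions. -/
theorem secW_mul_pairDelta_self (a b : Coord D) :
    secW K a b * pairDelta a b a b = secW K a b := by
  by_cases h : a = b
  · subst h; rw [secW_self, zero_mul]
  · rw [pairDelta_self h, mul_one]

theorem secW_mul_pairDelta_swap (a b : Coord D) :
    secW K a b * pairDelta a b b a = - secW K a b := by
  by_cases h : a = b
  · subst h; rw [secW_self, zero_mul, neg_zero]
  · rw [pairDelta_swap h, mul_neg_one]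

theorem weylSq_diagCurv (he : ∀ a, e a ≠ 0) (h0 : ∀ a, K a a = 0) :
    weylSq D (Matrix.diagonal e) (diagCurv e K) = ∑ a, ∑ b, 2 * secW K a b ^ 2 := by
  unfold weylSq weylUp
  rw [weyl_diagCurv he h0]
  refine Finset.sum_congr rfl fun a _ => Finset.sum_congr rfl fun b _ => ?_
  have h1 : ∀ c d, diagCurv e (secW K) a b c d *
      raise4 (Matrix.diagonal e) (diagCurv e (secW K)) a b c d = pairDelta a b c d *
      (secW K a b * (e c)⁻¹ * (e d)⁻¹ * e a * e b * (secW K a b * pairDelta a b c d)) := by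
    intro c d
    have := he a
    have := he b
    rw [raise4_diagonal he, diagCurv_apply]
    field_simp
  simp only [h1]
  rw [sum_pairDelta_mul, secW_mul_pairDelta_self, secW_mul_pairDelta_swap]
  have := he a
  have := he b
  field_simp
  ring

theorem weylMix_diagCurv (he : ∀ a, e a ≠ 0) (h0 : ∀ a, K a a = 0) (a b c d : Coord D) :
    weylMix D (Matrix.diagonal e) (diagCurv e K) a b c d =
      e a * e b * (e c)⁻¹ * (e d)⁻¹ * (secW K a b * pairDelta a b c d) := by
  rw [weylMix_diagonal he, weyl_diagCurv he h0, diagCurv_apply]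
  ring

theorem weylUp_diagCurv (he : ∀ a, e a ≠ 0) (h0 : ∀ a, K a a = 0) (a b c d : Coord D) :
    weylUp D (Matrix.diagonal e) (diagCurv e K) a b c d =
      (e c)⁻¹ * (e d)⁻¹ * (secW K a b * pairDelta a b c d) := by
  have := he a
  have := he b
  rw [weylUp, raise4_diagonal he, weyl_diagCurv he h0, diagCurv_apply]
  field_simp

theorem sum_weylMix_cubed (he : ∀ a, e a ≠ 0) (h0 : ∀ a, K a a = 0)
    (hs : ∀ a b, K a b = K b a) :
    ∑ a, ∑ b, ∑ c, ∑ d, ∑ p, ∑ q, weylMix D (Matrix.diagonal e) (diagCurv e K) a b c d *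
        weylMix D (Matrix.diagonal e) (diagCurv e K) c d p q *
        weylMix D (Matrix.diagonal e) (diagCurv e K) p q a b
      = ∑ a, ∑ b, 4 * secW K a b ^ 3 := by
  refine Finset.sum_congr rfl fun a _ => Finset.sum_congr rfl fun b _ => ?_
  have hsw := secW_comm hs
  have h1 : ∀ c d p q, weylMix D (Matrix.diagonal e) (diagCurv e K) a b c d *
        weylMix D (Matrix.diagonal e) (diagCurv e K) c d p q *
        weylMix D (Matrix.diagonal e) (diagCurv e K) p q a b =
      pairDelta c d p q * (pairDelta a b c d *
        (secW K a b * secW K c d * (secW K p q * pairDelta p q a b))) := by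
    intro c d p q
    have := he a
    have := he b
    have := he c
    have := he d
    have := he p
    have := he q
    simp only [weylMix_diagCurv he h0]
    field_simp
  simp only [h1, sum_pairDelta_mul, ← mul_sub]
  rw [hsw b a, secW_mul_pairDelta_self]
  have h2 : secW K a b * pairDelta b a a b = - secW K a b := by
    rw [hsw, secW_mul_pairDelta_swap]
  rw [h2]
  ring

theorem sum_weyl_weyl_z (he : ∀ a, e a ≠ 0) (h0 : ∀ a, K a a = 0) :
    ∑ a, ∑ b, ∑ c, ∑ d, ∑ p, weyl D (Matrix.diagonal e) (diagCurv e K) a c d p *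
        weylUp D (Matrix.diagonal e) (diagCurv e K) b c d p *
        zMix D (Matrix.diagonal e) (diagCurv e K) a b
      = ∑ a, ∑ c, 2 * secW K a c ^ 2 * secZ K a := by
  refine Finset.sum_congr rfl fun a _ => ?_
  rw [Finset.sum_eq_single a]
  · refine Finset.sum_congr rfl fun c _ => ?_
    have h1 : ∀ d p, weyl D (Matrix.diagonal e) (diagCurv e K) a c d p *
        weylUp D (Matrix.diagonal e) (diagCurv e K) a c d p *
        zMix D (Matrix.diagonal e) (diagCurv e K) a a = pairDelta a c d p *
        (e a * e c * (e d)⁻¹ * (e p)⁻¹ * secW K a c * secZ K a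
          * (secW K a c * pairDelta a c d p)) := by
      intro d p
      rw [weylUp_diagCurv he h0, weyl_diagCurv he h0, zMix_diagCurv he h0, diagCurv_apply,
        Matrix.diagonal_apply_eq]
      ring
    simp only [h1]
    rw [sum_pairDelta_mul, secW_mul_pairDelta_self, secW_mul_pairDelta_swap]
    have := he a
    have := he c
    field_simp
    ring
  · intro b _ hb
    rw [zMix_diagCurv he h0, Matrix.diagonal_apply_ne _ hb.symm]
    simp
  · simp

theorem z_weyl_weyl_weyl_apply (he : ∀ a, e a ≠ 0) (h0 : ∀ a, K a a = 0) (a c p q r : Coord D) :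
    zUp D (Matrix.diagonal e) (diagCurv e K) a a *
        weyl D (Matrix.diagonal e) (diagCurv e K) a c a c *
        weylUp D (Matrix.diagonal e) (diagCurv e K) c p q r *
        (∑ s, (Matrix.diagonal e)⁻¹ c s * weyl D (Matrix.diagonal e) (diagCurv e K) s p q r)
      = pairDelta c p q r * (secZ K a * secW K a c * e c * e p * (e q)⁻¹ * (e r)⁻¹
        * secW K c p * (secW K c p * pairDelta c p q r)) := by
  have := he a
  have := he c
  rw [zUp_diagonal he, zLow_diagCurv he h0, if_pos rfl, weyl_diagCurv he h0,
    weylUp_diagCurv he h0, inv_diagonal_of_ne he, Finset.sum_eq_single c]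
  · rw [Matrix.diagonal_apply_eq, diagCurv_apply, diagCurv_apply, mul_assoc (e a * e c),
      secW_mul_pairDelta_self]
    field_simp
  · intro s _ hs
    rw [Matrix.diagonal_apply_ne _ hs.symm, zero_mul]
  · exact fun h => absurd (Finset.mem_univ c) h

theorem sum_z_weyl_weyl_weyl (he : ∀ a, e a ≠ 0) (h0 : ∀ a, K a a = 0) :
    ∑ a, ∑ b, ∑ c, ∑ d, ∑ p, ∑ q, ∑ r, zUp D (Matrix.diagonal e) (diagCurv e K) a b *
        weyl D (Matrix.diagonal e) (diagCurv e K) a c b d *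
        weylUp D (Matrix.diagonal e) (diagCurv e K) c p q r *
        ∑ s, (Matrix.diagonal e)⁻¹ d s * weyl D (Matrix.diagonal e) (diagCurv e K) s p q r
      = ∑ a, ∑ c, secZ K a * secW K a c * ∑ b, 2 * secW K c b ^ 2 := by
  refine Finset.sum_congr rfl fun a _ => ?_
  rw [Finset.sum_eq_single a]
  · refine Finset.sum_congr rfl fun c _ => ?_
    rw [Finset.sum_eq_single c]
    · rw [Finset.mul_sum]
      refine Finset.sum_congr rfl fun p _ => ?_
      simp only [z_weyl_weyl_weyl_apply he h0]
      rw [sum_pairDelta_mul, secW_mul_pairDelta_self, secW_mul_pairDelta_swap]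
      have := he c
      have := he p
      field_simp
      ring
    · intro d _ hd
      have : weyl D (Matrix.diagonal e) (diagCurv e K) a c a d = 0 := by
        rw [weyl_diagCurv he h0, diagCurv_apply]
        by_cases h : a = c
        · subst h; rw [secW_self]; ring
        · have h' : c ≠ a := fun t => h t.symm
          simp [pairDelta, hd.symm, h']
      simp only [this, mul_zero, zero_mul, Finset.sum_const_zero]
    · exact fun h => absurd (Finset.mem_univ c) h
  · intro b _ hb
    have : zUp D (Matrix.diagonal e) (diagCurv e K) a b = 0 := by
      rw [zUp_diagonal he, zLow_diagCurv he h0, if_neg hb.symm]; ring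
    simp only [this, zero_mul, Finset.sum_const_zero]
  · exact fun h => absurd (Finset.mem_univ a) h

theorem sum_weyl_z_z (he : ∀ a, e a ≠ 0) (h0 : ∀ a, K a a = 0) :
    ∑ a, ∑ b, ∑ c, ∑ d, weylMix D (Matrix.diagonal e) (diagCurv e K) a c b d *
        zMix D (Matrix.diagonal e) (diagCurv e K) a b *
        zMix D (Matrix.diagonal e) (diagCurv e K) c d
      = ∑ a, ∑ c, secW K a c * secZ K a * secZ K c := by
  refine Finset.sum_congr rfl fun a _ => ?_
  rw [Finset.sum_eq_single a]
  · refine Finset.sum_congr rfl fun c _ => ?_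
    rw [Finset.sum_eq_single c]
    · rw [zMix_diagCurv he h0, weylMix_diagCurv he h0, secW_mul_pairDelta_self,
        Matrix.diagonal_apply_eq, Matrix.diagonal_apply_eq]
      have := he a
      have := he c
      field_simp
    · intro d _ hd
      rw [zMix_diagCurv he h0, Matrix.diagonal_apply_ne _ hd.symm, mul_zero]
    · simp
  · intro b _ hb
    rw [zMix_diagCurv he h0, Matrix.diagonal_apply_ne _ hb.symm]
    simp
  · simp

theorem sum_z_z_weyl_z (he : ∀ a, e a ≠ 0) (h0 : ∀ a, K a a = 0) :
    ∑ a, ∑ b, ∑ c, ∑ d, ∑ p, zMix D (Matrix.diagonal e) (diagCurv e K) a b *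
        zLow D (Matrix.diagonal e) (diagCurv e K) a c *
        weylUp D (Matrix.diagonal e) (diagCurv e K) b d c p *
        zLow D (Matrix.diagonal e) (diagCurv e K) d p
      = ∑ a, ∑ c, secZ K a ^ 2 * secW K a c * secZ K c := by
  refine Finset.sum_congr rfl fun a _ => ?_
  rw [Finset.sum_eq_single a]
  · rw [Finset.sum_eq_single a]
    · refine Finset.sum_congr rfl fun c _ => ?_
      rw [Finset.sum_eq_single c]
      · rw [zMix_diagCurv he h0, zLow_diagCurv he h0, zLow_diagCurv he h0,
          weylUp_diagCurv he h0, secW_mul_pairDelta_self, Matrix.diagonal_apply_eq, if_pos rfl,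
          if_pos rfl]
        have := he a
        have := he c
        field_simp
      · intro d _ hd
        rw [zLow_diagCurv he h0 c d, if_neg hd.symm, mul_zero]
      · simp
    · intro b _ hb
      simp [zLow_diagCurv he h0 a b, hb.symm]
    · simp
  · intro b _ hb
    rw [zMix_diagCurv he h0, Matrix.diagonal_apply_ne _ hb.symm]
    simp
  · simp

theorem invariants_diagCurv (he : ∀ a, e a ≠ 0) (h0 : ∀ a, K a a = 0)
    (hs : ∀ a b, K a b = K b a) :
    invariants D (Matrix.diagonal e) (diagCurv e K) = secInv K := by
  simp only [invariants, secInv, W2, W3, Z2, Z3, X3, X4, Y3, Y4, scal_diagCurv he h0,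
    weylSq_diagCurv he h0, sum_weylMix_cubed he h0 hs, zTrace_diagCurv he h0,
    sum_weyl_weyl_z he h0, sum_z_weyl_weyl_weyl he h0, sum_weyl_z_z he h0,
    sum_z_z_weyl_z he h0]

end SectionalInvariants

/-! ### Sectional curvatures with spherical symmetry -/

section Block

variable {D : ℕ}

/-- The symmetric matrix with the entry `k₁` at `tr`, the entries `k₂` at `ti` and `k₃` at `ri`,
and the entries `k₄` at `ij`, where `i ≠ j` are coordinates on the sphere. -/
def blockK (k₁ k₂ k₃ k₄ : ℝ) : Coord D → Coord D → ℝ :=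
  Sum.elim
    (fun i => Sum.elim (fun j => if i = j then 0 else k₁) (fun _ => ![k₂, k₃] i))
    (fun i => Sum.elim (fun j => ![k₂, k₃] j) (fun j => if i = j then 0 else k₄))

theorem blockK_self (k₁ k₂ k₃ k₄ : ℝ) (a : Coord D) : blockK k₁ k₂ k₃ k₄ a a = 0 := by
  rcases a with i | i <;> simp [blockK]

theorem blockK_comm (k₁ k₂ k₃ k₄ : ℝ) (a b : Coord D) :
    blockK k₁ k₂ k₃ k₄ a b = blockK k₁ k₂ k₃ k₄ b a := by
  rcases a with i | i <;> rcases b with j | j <;> simp [blockK, eq_comm]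

/-- The vector with the entry `u` at `t`, `v` at `r` and `w` at the coordinates on the sphere. -/
def blockV (u v w : ℝ) : Coord D → ℝ := Sum.elim ![u, v] (fun _ => w)

theorem cast_sub_two (hD : 5 ≤ D) : ((D - 2 : ℕ) : ℝ) = (D : ℝ) - 2 := by
  rw [Nat.cast_sub (by omega)]; norm_num

theorem sum_blockV (hD : 5 ≤ D) (u v w : ℝ) :
    ∑ a : Coord D, blockV u v w a = u + v + ((D : ℝ) - 2) * w := by
  simp [blockV, Fintype.sum_sum_type, cast_sub_two hD]

theorem sum_ite_fin (hD : 5 ≤ D) (i : Fin (D - 2)) (c : ℝ) :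
    ∑ j, (if i = j then 0 else c) = ((D : ℝ) - 3) * c := by
  have : ∀ j, (if i = j then 0 else c) = c - (if i = j then c else 0) := by
    intro j; split_ifs <;> simp
  simp only [this, Finset.sum_sub_distrib, Finset.sum_ite_eq, Finset.mem_univ, if_true,
    Finset.sum_const, Finset.card_univ, Fintype.card_fin, nsmul_eq_mul, cast_sub_two hD]
  ring

theorem secRic_blockK (hD : 5 ≤ D) (k₁ k₂ k₃ k₄ : ℝ) :
    secRic (D := D) (blockK k₁ k₂ k₃ k₄) = blockV (k₁ + ((D : ℝ) - 2) * k₂)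
      (k₁ + ((D : ℝ) - 2) * k₃) (k₂ + k₃ + ((D : ℝ) - 3) * k₄) := by
  funext a
  rcases a with i | i
  · fin_cases i <;> simp [secRic, blockK, blockV, Fintype.sum_sum_type, cast_sub_two hD]
  · simp [secRic, blockK, blockV, Fintype.sum_sum_type, sum_ite_fin hD]

theorem sum_blockK_mul (hD : 5 ≤ D) (k₁ k₂ k₃ k₄ u v w u' v' w' : ℝ) :
    ∑ a : Coord D, ∑ b : Coord D, blockK k₁ k₂ k₃ k₄ a b * blockV u v w a * blockV u' v' w' b
      = k₁ * (u * v' + v * u') + ((D : ℝ) - 2) * (k₂ * (u * w' + w * u') + k₃ * (v * w' + w * v'))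
        + ((D : ℝ) - 2) * ((D : ℝ) - 3) * k₄ * w * w' := by
  have h1 : ∀ i : Fin (D - 2), ∑ j, (if i = j then 0 else k₄) * w * w' =
      ((D : ℝ) - 3) * k₄ * w * w' := by
    intro i
    rw [← Finset.sum_mul, ← Finset.sum_mul, sum_ite_fin hD]
  simp only [blockK, blockV, Fintype.sum_sum_type, Fin.sum_univ_two, Sum.elim_inl, Sum.elim_inr,
    h1, Finset.sum_const, Finset.card_univ, Fintype.card_fin, nsmul_eq_mul, cast_sub_two hD,
    Finset.sum_add_distrib]
  simp
  ring

theorem blockK_pow (k₁ k₂ k₃ k₄ : ℝ) {m : ℕ} (hm : m ≠ 0) (a b : Coord D) :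
    blockK k₁ k₂ k₃ k₄ a b ^ m = blockK (k₁ ^ m) (k₂ ^ m) (k₃ ^ m) (k₄ ^ m) a b := by
  rcases a with i | i <;> rcases b with j | j
  · simp [blockK, ite_pow, hm]
  · fin_cases i <;> simp [blockK]
  · fin_cases j <;> simp [blockK]
  · simp [blockK, ite_pow, hm]

theorem blockV_pow (u v w : ℝ) (m : ℕ) (a : Coord D) :
    blockV u v w a ^ m = blockV (u ^ m) (v ^ m) (w ^ m) a := by
  rcases a with i | i
  · fin_cases i <;> simp [blockV]
  · simp [blockV]

theorem blockV_one (a : Coord D) : blockV 1 1 1 a = 1 := by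
  rcases a with i | i
  · fin_cases i <;> simp [blockV]
  · simp [blockV]

theorem secScal_blockK (hD : 5 ≤ D) (k₁ k₂ k₃ k₄ : ℝ) :
    secScal (D := D) (blockK k₁ k₂ k₃ k₄) = 2 * k₁ + 2 * ((D : ℝ) - 2) * (k₂ + k₃)
      + ((D : ℝ) - 2) * ((D : ℝ) - 3) * k₄ := by
  rw [secScal, secRic_blockK hD, sum_blockV hD]
  ring

theorem secZ_eq_blockV (K : Coord D → Coord D → ℝ) {u v w : ℝ} (h : secRic K = blockV u v w) :
    secZ K = blockV (u - 1 / D * secScal K) (v - 1 / D * secScal K) (w - 1 / D * secScal K) := by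
  funext a
  rw [secZ, h]
  rcases a with i | i
  · fin_cases i <;> simp [blockV]
  · simp [blockV]

/-- The trace-free part parameter of the static curvatures: the eigenvalue of the traceless Ricci
tensor on the sphere. -/
def staticZ (D : ℕ) (A B ψ : ℝ) : ℝ :=
  (-2 * A + (8 - 2 * (D : ℝ)) * B + 2 * ((D : ℝ) - 3) * ψ) / D

/-- The parameter of the Weyl tensor of the static curvatures. -/
def staticW (D : ℕ) (A B ψ : ℝ) : ℝ := 4 / (((D : ℝ) - 1) * ((D : ℝ) - 2)) * (A - 2 * B + ψ)

/-- The eigenvalues at `t` and `r` coincide because the `ti` and `ri` curvatures do; tracelessness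
then expresses them through the common eigenvalue on the `D - 2` directions of the sphere. -/
theorem secZ_static (hD : 5 ≤ D) (A B ψ : ℝ) :
    secZ (D := D) (blockK A B B ψ) = blockV (-((D : ℝ) - 2) / 2 * staticZ D A B ψ)
      (-((D : ℝ) - 2) / 2 * staticZ D A B ψ) (staticZ D A B ψ) := by
  have h5 : (5 : ℝ) ≤ D := by exact_mod_cast hD
  have e1 : (D : ℝ) ≠ 0 := by linarith
  rw [secZ_eq_blockV _ (secRic_blockK hD A B B ψ), secScal_blockK hD]
  congr 1 <;> (unfold staticZ; field_simp; ring)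

/-- Tracelessness of each row of the Weyl matrix leaves a single free parameter. -/
theorem secW_static (hD : 5 ≤ D) (A B ψ : ℝ) :
    secW (D := D) (blockK A B B ψ) =
      blockK (((D : ℝ) - 2) * (D - 3) / 4 * staticW D A B ψ) (-((D : ℝ) - 3) / 4 * staticW D A B ψ)
        (-((D : ℝ) - 3) / 4 * staticW D A B ψ) (staticW D A B ψ / 2) := by
  have h5 : (5 : ℝ) ≤ D := by exact_mod_cast hD
  have e2 : (D : ℝ) - 1 ≠ 0 := by linarith
  have e3 : (D : ℝ) - 2 ≠ 0 := by linarith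
  funext a b
  unfold secW
  rw [secRic_blockK hD, secScal_blockK hD]
  by_cases hab : a = b
  · subst hab; rw [if_pos rfl, blockK_self]
  rw [if_neg hab]
  rcases a with i | i <;> rcases b with j | j
  · fin_cases i <;> fin_cases j <;> first | exact absurd rfl hab | skip
    all_goals
      simp [blockK, blockV, staticW]
      field_simp
      ring
  · fin_cases i
    all_goals
      simp [blockK, blockV, staticW]
      field_simp
      ring
  · fin_cases j
    all_goals
      simp [blockK, blockV, staticW]
      field_simp
      ring
  · have : i ≠ j := fun h => hab (by rw [h])
    simp [blockK, blockV, staticW, this]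
    field_simp
    ring

/-- The invariants of the curvature with Ricci scalar `R` and with the parameters `z` and `w` of
the traceless Ricci tensor and of the Weyl tensor. -/
def staticInv (D : ℕ) (R z w : ℝ) : CurvInv where
  R := R
  W₂ := w ^ 2
  W₃ := w ^ 3
  Z₂ := z ^ 2
  Z₃ := z ^ 3
  X₃ := z * w ^ 2
  X₄ := z * w ^ 3
  Y₃ := w * z ^ 2
  Y₄ := w * z ^ 3
  t₂ := D * (D - 2) / 2 * z ^ 2
  t₃ := - D * (D - 2) * (D - 4) / 4 * z ^ 3
  t₄ := (D - 2) * (((D : ℝ) - 2) ^ 3 + 8) / 8 * z ^ 4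
  t₅ := - (D - 2) * (((D : ℝ) - 2) ^ 4 - 16) / 16 * z ^ 5

/-- It equals `4 + (D-3)² ((D-2)² - 2)`, which is positive. -/
theorem weyl_cubic_ne_zero (hD : 5 ≤ D) :
    2 * (2 - ((D : ℝ) - 3) ^ 2) + ((D : ℝ) - 2) ^ 2 * ((D : ℝ) - 3) ^ 2 ≠ 0 := by
  have h5 : (5 : ℝ) ≤ D := by exact_mod_cast hD
  nlinarith [sq_nonneg (((D : ℝ) - 3)), sq_nonneg ((D : ℝ) - 2),
    mul_nonneg (sq_nonneg ((D : ℝ) - 3)) (show (0 : ℝ) ≤ ((D : ℝ) - 2) ^ 2 - 2 by nlinarith)]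

/-- The constants in the building blocks are the normalisations that turn each of them into a
monomial in `z` and `w` with coefficient one. The odd blocks `𝖶₃` and `𝖹₃` keep the signs of `w` and
`z`, which squares alone would lose. -/
theorem secInv_static (hD : 5 ≤ D) (A B ψ : ℝ) :
    secInv (D := D) (blockK A B B ψ) = staticInv D (secScal (D := D) (blockK A B B ψ))
      (staticZ D A B ψ) (staticW D A B ψ) := by
  have h5 : (5 : ℝ) ≤ D := by exact_mod_cast hD
  have e1 : (D : ℝ) ≠ 0 := by linarith
  have e2 : (D : ℝ) - 1 ≠ 0 := by linarith
  have e3 : (D : ℝ) - 2 ≠ 0 := by linarith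
  have e4 : (D : ℝ) - 3 ≠ 0 := by linarith
  have e5 : (D : ℝ) - 4 ≠ 0 := by linarith
  have e6 := weyl_cubic_ne_zero hD
  unfold secInv staticInv
  rw [secZ_static hD, secW_static hD]
  generalize staticZ D A B ψ = z
  generalize staticW D A B ψ = w
  set d : ℝ := (D : ℝ)
  have s1 : ∀ (c k₁ k₂ k₃ k₄ : ℝ), ∑ a : Coord D, ∑ b : Coord D, c * blockK k₁ k₂ k₃ k₄ a b
      = c * (2 * k₁ + 2 * (d - 2) * (k₂ + k₃) + (d - 2) * (d - 3) * k₄) := by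
    intro c k₁ k₂ k₃ k₄
    have := sum_blockK_mul hD k₁ k₂ k₃ k₄ 1 1 1 1 1 1
    simp only [blockV_one, mul_one] at this
    simp only [← Finset.mul_sum, this]
    ring
  have s2 : ∀ (k₁ k₂ k₃ k₄ u v w : ℝ), ∑ a : Coord D, ∑ b : Coord D,
      2 * blockK k₁ k₂ k₃ k₄ a b * blockV u v w a
      = 2 * (k₁ * (u + v) + (d - 2) * (k₂ * (u + w) + k₃ * (v + w))
        + (d - 2) * (d - 3) * k₄ * w) := by
    intro k₁ k₂ k₃ k₄ u v w
    have := sum_blockK_mul hD k₁ k₂ k₃ k₄ u v w 1 1 1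
    simp only [blockV_one, mul_one] at this
    simp only [mul_assoc, ← Finset.mul_sum] at this ⊢
    rw [this]
  have s3 : ∀ (k₁ k₂ k₃ k₄ u v w u' v' w' : ℝ), ∑ a : Coord D, ∑ b : Coord D,
      blockV u v w a * blockK k₁ k₂ k₃ k₄ a b * blockV u' v' w' b =
      k₁ * (u * v' + v * u') + (d - 2) * (k₂ * (u * w' + w * u') + k₃ * (v * w' + w * v'))
        + (d - 2) * (d - 3) * k₄ * w * w' := by
    intro k₁ k₂ k₃ k₄ u v w u' v' w'
    rw [← sum_blockK_mul hD]
    exact Finset.sum_congr rfl fun a _ => Finset.sum_congr rfl fun b _ => by ring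
  have s4 : ∀ (k₁ k₂ k₃ k₄ : ℝ), (fun a : Coord D => ∑ b : Coord D, 2 * blockK k₁ k₂ k₃ k₄ a b)
      = blockV (2 * (k₁ + (d - 2) * k₂)) (2 * (k₁ + (d - 2) * k₃))
        (2 * (k₂ + k₃ + (d - 3) * k₄)) := by
    intro k₁ k₂ k₃ k₄
    funext a
    rw [← Finset.mul_sum]
    have := congrFun (secRic_blockK hD k₁ k₂ k₃ k₄) a
    rw [secRic] at this
    rw [this]
    rcases a with i | i
    · fin_cases i <;> simp [blockV, d]
    · simp [blockV, d]
  simp only [blockK_pow _ _ _ _ (two_ne_zero), blockK_pow _ _ _ _ (three_ne_zero), blockV_pow,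
    sum_blockV hD, s1, s2, sum_blockK_mul hD, s3]
  simp only [fun k₁ k₂ k₃ k₄ a => congrFun (s4 k₁ k₂ k₃ k₄) a, s3]
  rw [CurvInv.mk.injEq]
  refine ⟨rfl, ?_, ?_, ?_, ?_, ?_, ?_, ?_, ?_, ?_, ?_, ?_, ?_⟩
  -- The normalisation of `𝖶₃` has a factor that is not a product of linear terms in `D`, so its
  -- denominator is cleared by hand.
  case refine_2 =>
    rw [div_mul_eq_mul_div, div_eq_iff (mul_ne_zero (mul_ne_zero e4 e3) e6)]
    ring
  all_goals
    try field_simp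
    ring

end Block

/-! ### Weighted binomial sums -/

section BinomialSums

/-- The absorption identity `i C(k+1, i) = (k+1) C(k, i-1)` under the sum: each factor `i` lowers
the exponent of the binomial theorem by one. -/
theorem sum_mul_choose (k : ℕ) (g : ℕ → ℝ) :
    ∑ i ∈ Finset.range (k + 2), (i : ℝ) * ((k + 1).choose i * g i) =
      (k + 1) * ∑ i ∈ Finset.range (k + 1), k.choose i * g (i + 1) := by
  rw [Finset.sum_range_succ', Finset.mul_sum]
  simp only [Nat.cast_zero, zero_mul, add_zero]
  refine Finset.sum_congr rfl fun i _ => ?_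
  have := congrArg (Nat.cast (R := ℝ)) (Nat.add_one_mul_choose_eq k i)
  push_cast at this ⊢
  linear_combination (-g (i + 1)) * this

/-- The companion identity `(k+1-i) C(k+1, i) = (k+1) C(k, i)`, needed because an inner binomial sum
of length `n - i` produces factors `n - i`. -/
theorem sum_sub_mul_choose (k : ℕ) (g : ℕ → ℝ) :
    ∑ i ∈ Finset.range (k + 2), ((k : ℝ) + 1 - i) * ((k + 1).choose i * g i) =
      (k + 1) * ∑ i ∈ Finset.range (k + 1), k.choose i * g i := by
  rw [Finset.sum_range_succ, Finset.mul_sum]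
  simp only [Nat.cast_add, Nat.cast_one, sub_self, zero_mul, add_zero]
  refine Finset.sum_congr rfl fun i hi => ?_
  have hi' : i ≤ k + 1 := by have := Finset.mem_range.1 hi; omega
  have := congrArg (Nat.cast (R := ℝ)) (Nat.choose_mul_succ_eq k i)
  push_cast [Nat.cast_sub hi'] at this ⊢
  linear_combination (-g i) * this

variable (x y : ℝ)

theorem sum_choose_pow (n : ℕ) :
    ∑ i ∈ Finset.range (n + 1), (n.choose i : ℝ) * (x ^ i * y ^ (n - i)) = (x + y) ^ n := by
  rw [add_pow]
  exact Finset.sum_congr rfl fun i _ => by ring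

theorem sum_choose_pow_mul (n : ℕ) :
    ∑ i ∈ Finset.range (n + 1), (i : ℝ) * (n.choose i * (x ^ i * y ^ (n - i))) =
      n * x * (x + y) ^ (n - 1) := by
  rcases n with _ | k
  · simp
  rw [sum_mul_choose k fun i => x ^ i * y ^ (k + 1 - i), Nat.add_sub_cancel, ← sum_choose_pow]
  simp only [Finset.mul_sum]
  refine Finset.sum_congr rfl fun i _ => ?_
  rw [Nat.add_sub_add_right]
  push_cast
  ring

theorem sum_choose_pow_sq (n : ℕ) :
    ∑ i ∈ Finset.range (n + 1), (i : ℝ) ^ 2 * (n.choose i * (x ^ i * y ^ (n - i))) =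
      n * x * (x + y) ^ (n - 1) + n * (n - 1) * x ^ 2 * (x + y) ^ (n - 2) := by
  rcases n with _ | k
  · simp
  have := sum_mul_choose k fun i => i * (x ^ i * y ^ (k + 1 - i))
  have e1 : ∀ i : ℕ, (i : ℝ) ^ 2 * ((k + 1).choose i * (x ^ i * y ^ (k + 1 - i))) =
      i * ((k + 1).choose i * (i * (x ^ i * y ^ (k + 1 - i)))) := fun i => by ring
  simp only [e1]
  rw [this]
  have e2 : ∀ i : ℕ, (k.choose i : ℝ) * (((i + 1 : ℕ) : ℝ) * (x ^ (i + 1) * y ^ (k + 1 - (i + 1))))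
      = x * (i * (k.choose i * (x ^ i * y ^ (k - i)))) + x * (k.choose i * (x ^ i * y ^ (k - i))) := by
    intro i
    rw [Nat.add_sub_add_right]
    push_cast
    ring
  simp only [e2, Finset.sum_add_distrib, ← Finset.mul_sum, sum_choose_pow, sum_choose_pow_mul]
  simp only [Nat.add_sub_cancel, show k + 1 - 2 = k - 1 by omega]
  push_cast
  ring

theorem sum_choose_pow_sub (n : ℕ) :
    ∑ i ∈ Finset.range (n + 1), ((n : ℝ) - i) * (n.choose i * (x ^ i * y ^ (n - i - 1))) =
      n * (x + y) ^ (n - 1) := by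
  rcases n with _ | k
  · simp
  have := sum_sub_mul_choose k fun i => x ^ i * y ^ (k + 1 - i - 1)
  push_cast at this ⊢
  rw [this, ← sum_choose_pow]
  refine congrArg _ (Finset.sum_congr rfl fun i _ => ?_)
  rw [show k + 1 - i - 1 = k - i by omega]

theorem sum_choose_pow_mul_sub (n : ℕ) :
    ∑ i ∈ Finset.range (n + 1),
        (i : ℝ) * ((n : ℝ) - i) * (n.choose i * (x ^ i * y ^ (n - i - 1))) =
      n * (n - 1) * x * (x + y) ^ (n - 2) := by
  rcases n with _ | k
  · simp
  have := sum_sub_mul_choose k fun i => i * (x ^ i * y ^ (k + 1 - i - 1))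
  have e1 : ∀ i : ℕ, (i : ℝ) * (((k + 1 : ℕ) : ℝ) - i)
      * ((k + 1).choose i * (x ^ i * y ^ (k + 1 - i - 1))) =
      ((k : ℝ) + 1 - i) * ((k + 1).choose i * (i * (x ^ i * y ^ (k + 1 - i - 1)))) := by
    intro i; push_cast; ring
  have e2 : ∀ i : ℕ, (k.choose i : ℝ) * (i * (x ^ i * y ^ (k + 1 - i - 1))) =
      i * (k.choose i * (x ^ i * y ^ (k - i))) := by
    intro i
    rw [show k + 1 - i - 1 = k - i by omega]; ring
  simp only [e1, this, e2, sum_choose_pow_mul]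
  rw [show k + 1 - 2 = k - 1 by omega]
  push_cast
  ring

theorem sum_choose_pow_sub_sub (n : ℕ) :
    ∑ i ∈ Finset.range (n + 1),
        ((n : ℝ) - i) * ((n : ℝ) - i - 1) * (n.choose i * (x ^ i * y ^ (n - i - 2))) =
      n * (n - 1) * (x + y) ^ (n - 2) := by
  rcases n with _ | k
  · simp
  have := sum_sub_mul_choose k fun i => ((k : ℝ) - i) * (x ^ i * y ^ (k + 1 - i - 2))
  have e1 : ∀ i : ℕ, (((k + 1 : ℕ) : ℝ) - i) * (((k + 1 : ℕ) : ℝ) - i - 1)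
      * ((k + 1).choose i * (x ^ i * y ^ (k + 1 - i - 2))) =
      ((k : ℝ) + 1 - i) * ((k + 1).choose i * (((k : ℝ) - i) * (x ^ i * y ^ (k + 1 - i - 2)))) := by
    intro i; push_cast; ring
  have e2 : ∀ i : ℕ, (k.choose i : ℝ) * (((k : ℝ) - i) * (x ^ i * y ^ (k + 1 - i - 2))) =
      ((k : ℝ) - i) * (k.choose i * (x ^ i * y ^ (k - i - 1))) := by
    intro i
    rw [show k + 1 - i - 2 = k - i - 1 by omega]; ring
  simp only [e1, this, e2, sum_choose_pow_sub]
  rw [show k + 1 - 2 = k - 1 by omega]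
  push_cast
  ring

/-- The sum of a quadratic polynomial in `i, j` against the trinomial distribution. -/
theorem sum_trinomial_quadratic (n : ℕ) (z w R a₀ a₁ a₂ b₀ b₁ c : ℝ) :
    ∑ i ∈ Finset.range (n + 1), ∑ j ∈ Finset.range (n - i + 1),
      (a₀ + a₁ * i + a₂ * (i : ℝ) ^ 2 + (b₀ + b₁ * i) * j + c * (j : ℝ) ^ 2) *
        ((n.choose i * (n - i).choose j) * (z ^ i * w ^ j * R ^ (n - i - j)))
      = a₀ * (z + (w + R)) ^ n
        + (a₁ * z + a₂ * z + b₀ * w + c * w) * (n * (z + (w + R)) ^ (n - 1))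
        + (a₂ * z ^ 2 + b₁ * z * w + c * w ^ 2) * (n * (n - 1) * (z + (w + R)) ^ (n - 2)) := by
  -- The inner sum over `j` is binomial in `w` and `R` with exponent `n - i`; its first two moments
  -- bring the factors `n - i` and `(n - i)(n - i - 1)`.
  have h1 : ∀ i ∈ Finset.range (n + 1), ∑ j ∈ Finset.range (n - i + 1),
      (a₀ + a₁ * i + a₂ * (i : ℝ) ^ 2 + (b₀ + b₁ * i) * j + c * (j : ℝ) ^ 2) *
        ((n.choose i * (n - i).choose j) * (z ^ i * w ^ j * R ^ (n - i - j))) =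
      a₀ * (n.choose i * (z ^ i * (w + R) ^ (n - i)))
      + a₁ * (i * (n.choose i * (z ^ i * (w + R) ^ (n - i))))
      + a₂ * ((i : ℝ) ^ 2 * (n.choose i * (z ^ i * (w + R) ^ (n - i))))
      + (b₀ + c) * w * (((n : ℝ) - i) * (n.choose i * (z ^ i * (w + R) ^ (n - i - 1))))
      + b₁ * w * ((i : ℝ) * ((n : ℝ) - i) * (n.choose i * (z ^ i * (w + R) ^ (n - i - 1))))
      + c * w ^ 2 * (((n : ℝ) - i) * ((n : ℝ) - i - 1)
          * (n.choose i * (z ^ i * (w + R) ^ (n - i - 2)))) := by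
    intro i hi
    have hi' : i ≤ n := by have := Finset.mem_range.1 hi; omega
    have e1 : ∀ j : ℕ, (a₀ + a₁ * i + a₂ * (i : ℝ) ^ 2 + (b₀ + b₁ * i) * j + c * (j : ℝ) ^ 2) *
        ((n.choose i * (n - i).choose j) * (z ^ i * w ^ j * R ^ (n - i - j))) =
        (a₀ + a₁ * i + a₂ * (i : ℝ) ^ 2) * n.choose i * z ^ i *
          ((n - i).choose j * (w ^ j * R ^ (n - i - j)))
        + (b₀ + b₁ * i) * n.choose i * z ^ i * (j * ((n - i).choose j * (w ^ j * R ^ (n - i - j))))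
        + c * n.choose i * z ^ i * ((j : ℝ) ^ 2 * ((n - i).choose j * (w ^ j * R ^ (n - i - j)))) :=
      fun j => by ring
    simp only [e1, Finset.sum_add_distrib, ← Finset.mul_sum, sum_choose_pow, sum_choose_pow_mul,
      sum_choose_pow_sq, Nat.cast_sub hi']
    ring
  rw [Finset.sum_congr rfl h1]
  simp only [Finset.sum_add_distrib, ← Finset.mul_sum, sum_choose_pow, sum_choose_pow_mul,
    sum_choose_pow_sq, sum_choose_pow_sub, sum_choose_pow_mul_sub, sum_choose_pow_sub_sub]
  ring

/-- A sum over a triangle, with its first two rows and columns split off. -/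
theorem sum_triangle_split (n : ℕ) (hn : 1 ≤ n) (F : ℕ → ℕ → ℝ) (h01 : F 0 1 = 0)
    (h10 : F 1 0 = 0) (h11 : 2 ≤ n → F 1 1 = 0) :
    ∑ i ∈ Finset.range (n + 1), ∑ j ∈ Finset.range (n - i + 1), F i j =
      F 0 0 + ∑ l ∈ Finset.range (n - 1), (F 0 (l + 2) + F (l + 2) 0)
        + ∑ l ∈ Finset.range (n - 2), (F 1 (l + 2) + F (l + 2) 1)
        + ∑ l ∈ Finset.range (n - 3), ∑ p ∈ Finset.range (n - l - 3), F (l + 2) (p + 2) := by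
  rcases n with _ | _ | m
  · omega
  · simp [Finset.sum_range_succ, h01, h10]
  -- These are the rows `i ≥ 2`. The last one, `i = n`, has an entry only in column `0`, and the one
  -- before it only in columns `0` and `1`; this explains the three different ranges.
  have h3 : ∑ l ∈ Finset.range (m + 1), ∑ j ∈ Finset.range (m + 1 + 1 - (l + 1 + 1) + 1),
      F (l + 1 + 1) j = ∑ l ∈ Finset.range (m + 1), F (l + 2) 0 + ∑ l ∈ Finset.range m, F (l + 2) 1
        + ∑ l ∈ Finset.range (m - 1), ∑ p ∈ Finset.range (m - 1 - l), F (l + 2) (p + 2) := by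
    have h4 : ∀ l ∈ Finset.range m, ∑ j ∈ Finset.range (m + 1 + 1 - (l + 1 + 1) + 1),
        F (l + 1 + 1) j = F (l + 2) 0 + F (l + 2) 1
          + ∑ p ∈ Finset.range (m - 1 - l), F (l + 2) (p + 2) := by
      intro l hl
      have : l < m := Finset.mem_range.1 hl
      rw [show m + 1 + 1 - (l + 1 + 1) + 1 = (m - 1 - l) + 1 + 1 by omega,
        Finset.sum_range_succ', Finset.sum_range_succ']
      ring
    rw [Finset.sum_range_succ, Finset.sum_congr rfl h4, Finset.sum_add_distrib,
      Finset.sum_add_distrib, Finset.sum_range_succ (fun l => F (l + 2) 0)]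
    have h5 : ∑ l ∈ Finset.range m, ∑ p ∈ Finset.range (m - 1 - l), F (l + 2) (p + 2) =
        ∑ l ∈ Finset.range (m - 1), ∑ p ∈ Finset.range (m - 1 - l), F (l + 2) (p + 2) := by
      rcases m with _ | m
      · rfl
      · rw [Finset.sum_range_succ]
        simp
    rw [h5]
    simp
    ring
  rw [Finset.sum_range_succ', Finset.sum_range_succ', h3]
  simp only [zero_add]
  rw [show m + 1 + 1 - 0 + 1 = m + 1 + 1 + 1 by omega, show m + 1 + 1 - 1 + 1 = m + 1 + 1 by omega,
    Finset.sum_range_succ' (F 0), Finset.sum_range_succ' (fun k => F 0 (k + 1)),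
    Finset.sum_range_succ' (F 1), Finset.sum_range_succ' (fun k => F 1 (k + 1)), h01, h10]
  simp only [zero_add, h11 (by omega), show m + 1 + 1 - 1 = m + 1 by omega,
    show m + 1 + 1 - 2 = m by omega, show m + 1 + 1 - 3 = m - 1 by omega,
    Finset.sum_add_distrib]
  have h6 : ∀ l, m + 1 + 1 - l - 3 = m - 1 - l := fun l => by omega
  simp only [h6]
  ring

end BinomialSums

/-! ### The theories on the two families of curvatures -/

section Reduced

variable {D : ℕ}

/-- The parity switch in `𝓘_l` serves to produce every power `w^(l+2)` uniformly out of `w²` and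
`w³`. -/
theorem sq_pow_half_mul_ite (w : ℝ) (l : ℕ) :
    (w ^ 2) ^ (l / 2) * (if Even l then w ^ 2 else w ^ 3) = w ^ (l + 2) := by
  rw [← pow_mul]
  split_ifs with h
  · obtain ⟨m, rfl⟩ := h
    rw [← pow_add]; congr 1; omega
  · rw [← pow_add]; congr 1
    have := Nat.not_even_iff.1 h
    omega

theorem sq_pow_half_mul_ite' (z w : ℝ) (l : ℕ) :
    (w ^ 2) ^ (l / 2) * (if Even l then z * w ^ 2 else z * w ^ 3) = z * w ^ (l + 2) := by
  have := sq_pow_half_mul_ite w l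
  split_ifs at this ⊢ <;> rw [← this] <;> ring

/-- In terms of `i = l + 2` and `j = p + 2` the constant is a trinomial coefficient times a
quadratic polynomial in `i, j`, times an `i`-th and a `j`-th power that a rescaling of `z` and `w`
absorbs. This is the shape required by `sum_trinomial_quadratic`. -/
theorem gammaCoeff_eq (hD : 5 ≤ D) {n i j : ℕ} (h : i + j ≤ n) :
    gammaCoeff D n ((i : ℤ) - 2) ((j : ℤ) - 2) =
      (n.choose i * (n - i).choose j) *
      (D * (D * ((i : ℝ) - 4) + 4) * ((i : ℝ) - 1)
        + 4 * (D - 1) * (D * ((i : ℝ) - 2) + 1) * j + 4 * (D - 1) ^ 2 * (j : ℝ) ^ 2)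
      / (4 * ((D : ℝ) ^ 2 - D))
      * ((2 * ((D : ℝ) ^ 2 - D) / (D - 2)) ^ i * (((D : ℝ) ^ 2 - D) / 2) ^ j) := by
  have h5 : (5 : ℝ) ≤ D := by exact_mod_cast hD
  have e1 : (D : ℝ) - 2 ≠ 0 := by linarith
  have e2 : (D : ℝ) ^ 2 - D ≠ 0 := by nlinarith
  have hc : -2 ≤ (i : ℤ) - 2 ∧ -2 ≤ (j : ℤ) - 2 ∧ (i : ℤ) - 2 + ((j : ℤ) - 2) + 4 ≤ n := by omega
  have hfac : (n.factorial : ℝ) = (n.choose i * (n - i).choose j) *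
      (i.factorial * j.factorial * (n - i - j).factorial) := by
    have h1 := Nat.choose_mul_factorial_mul_factorial (show i ≤ n by omega)
    have h2 := Nat.choose_mul_factorial_mul_factorial (show j ≤ n - i by omega)
    rw [← h1, ← h2]
    push_cast
    ring
  have z1 : (2 : ℝ) ^ (2 - ((i : ℤ) - 2) + ((j : ℤ) - 2)) = 4 * 2 ^ j / 2 ^ i := by
    rw [show (2 - ((i : ℤ) - 2) + ((j : ℤ) - 2)) = 2 + (j : ℤ) - i by ring,
      zpow_sub₀ two_ne_zero, zpow_add₀ two_ne_zero, zpow_natCast, zpow_natCast]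
    norm_num
  have z2 : ((D : ℝ) ^ 2 - D) ^ (-((j : ℤ) - 2) - ((i : ℤ) - 2) - 3) =
      ((D : ℝ) ^ 2 - D) / (((D : ℝ) ^ 2 - D) ^ i * ((D : ℝ) ^ 2 - D) ^ j) := by
    rw [show (-((j : ℤ) - 2) - ((i : ℤ) - 2) - 3) = 1 - ((i + j : ℕ) : ℤ) by push_cast; ring,
      zpow_sub₀ e2, zpow_natCast, zpow_one, pow_add]
  have z3 : ((D : ℝ) - 2) ^ ((i : ℤ) - 2 + 2) = ((D : ℝ) - 2) ^ i := by
    rw [sub_add_cancel, zpow_natCast]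
  unfold gammaCoeff
  rw [if_pos hc, z1, z2, z3, hfac, show ((i : ℤ) - 2 + 2).toNat = i by omega,
    show ((j : ℤ) - 2 + 2).toNat = j by omega,
    show ((n : ℤ) - ((i : ℤ) - 2) - ((j : ℤ) - 2) - 4).toNat = n - i - j by omega]
  have f1 : (i.factorial : ℝ) ≠ 0 := by exact_mod_cast i.factorial_ne_zero
  have f2 : (j.factorial : ℝ) ≠ 0 := by exact_mod_cast j.factorial_ne_zero
  have f3 : ((n - i - j).factorial : ℝ) ≠ 0 := by exact_mod_cast (n - i - j).factorial_ne_zero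
  push_cast
  simp only [div_pow, mul_pow]
  generalize (n.choose i : ℝ) = c₁
  generalize ((n - i).choose j : ℝ) = c₂
  generalize (D : ℝ) ^ 2 - D = N at *
  field_simp
  ring

/-- The groups of terms of `𝓩_{(n)}` are the first two rows and columns and the remaining interior
of one trinomial array in `z^i w^j R^(n-i-j)`. The monomials `z`, `w` and `zw`, for which no
invariant is provided, are harmless: the quadratic factor of `gammaCoeff` vanishes at `(1,0)`,
`(0,1)` and `(1,1)`. -/
theorem curlyZOf_staticInv (hD : 5 ≤ D) {n : ℕ} (hn : 1 ≤ n) (R z w : ℝ) :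
    curlyZOf D n (staticInv D R z w) =
      ∑ i ∈ Finset.range (n + 1), ∑ j ∈ Finset.range (n - i + 1),
        gammaCoeff D n ((i : ℤ) - 2) ((j : ℤ) - 2) * (z ^ i * w ^ j * R ^ (n - i - j)) := by
  have h5 : (5 : ℝ) ≤ D := by exact_mod_cast hD
  have e2 : (D : ℝ) ^ 2 - D ≠ 0 := by nlinarith
  rw [sum_triangle_split n hn fun i j =>
    gammaCoeff D n ((i : ℤ) - 2) ((j : ℤ) - 2) * (z ^ i * w ^ j * R ^ (n - i - j))]
  · simp only [curlyZOf, staticInv, sq_pow_half_mul_ite, sq_pow_half_mul_ite']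
    have g0 : gammaCoeff D n (((0 : ℕ) : ℤ) - 2) (((0 : ℕ) : ℤ) - 2) = 1 := by
      have e1 : (D : ℝ) ≠ 0 := by linarith
      have e3 : (D : ℝ) - 1 ≠ 0 := by linarith
      rw [gammaCoeff_eq hD (by omega), show (D : ℝ) ^ 2 - D = D * (D - 1) by ring]
      simp
      field_simp
      ring
    have c1 : ∀ l : ℕ, (((l + 2 : ℕ) : ℤ) - 2) = l := fun l => by push_cast; ring
    have c2 : (((0 : ℕ) : ℤ) - 2) = -2 := by norm_num
    have c3 : (((1 : ℕ) : ℤ) - 2) = -1 := by norm_num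
    rw [g0]
    simp only [c1, c2, c3]
    congr 1
    · congr 1
      · congr 1
        · simp
        · refine Finset.sum_congr rfl fun l _ => ?_
          rw [show n - 0 - (l + 2) = n - l - 2 by omega, show n - (l + 2) - 0 = n - l - 2 by omega]
          ring
      · refine Finset.sum_congr rfl fun l _ => ?_
        rw [show n - 1 - (l + 2) = n - l - 3 by omega, show n - (l + 2) - 1 = n - l - 3 by omega]
        ring
    · refine Finset.sum_congr rfl fun l _ => Finset.sum_congr rfl fun p _ => ?_
      rw [show n - (l + 2) - (p + 2) = n - l - p - 4 by omega]
      ring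
  · rw [gammaCoeff_eq hD (by omega)]
    refine mul_eq_zero_of_left (mul_eq_zero_of_left ?_ _) _
    refine div_eq_zero_iff.2 (Or.inl (mul_eq_zero_of_right _ ?_))
    push_cast
    ring
  · rw [gammaCoeff_eq hD (by omega)]
    refine mul_eq_zero_of_left (mul_eq_zero_of_left ?_ _) _
    refine div_eq_zero_iff.2 (Or.inl (mul_eq_zero_of_right _ ?_))
    push_cast
    ring
  · intro h2
    rw [gammaCoeff_eq hD (by omega)]
    refine mul_eq_zero_of_left (mul_eq_zero_of_left ?_ _) _
    refine div_eq_zero_iff.2 (Or.inl (mul_eq_zero_of_right _ ?_))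
    push_cast
    ring

/-- On static curvatures the fourth and fifth traces of `Z` are fixed multiples of `t₂²` and `t₂
t₃`, precisely those subtracted in `𝓣`. The correction therefore affects only the cosmological
sector. -/
theorem trivialTOf_staticInv (hD : 5 ≤ D) (l : ℕ) (R z w : ℝ) :
    trivialTOf D l (staticInv D R z w) = 0 := by
  have h5 : (5 : ℝ) ≤ D := by exact_mod_cast hD
  have e1 : (D : ℝ) - 2 ≠ 0 := by linarith
  have e2 : (D : ℝ) ≠ 0 := by linarith
  unfold trivialTOf staticInv
  refine mul_eq_zero_of_right _ ?_
  split_ifs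
  · refine mul_eq_zero_of_right _ ?_
    simp only
    field_simp
    ring
  · simp only
    field_simp
    ring

/-- The theory on the static curvatures. -/
def staticLag (D n : ℕ) (A B ψ : ℝ) : ℝ :=
  ((D : ℝ) * (D - 1)) ^ (n - 1) * (2 * n * A * ψ ^ (n - 1) + 4 * n * (n - 1) * B ^ 2 * ψ ^ (n - 2)
    + 4 * n * (D - 2 * n) * B * ψ ^ (n - 1) + (D - 1 - 2 * n) * (D - 2 * n) * ψ ^ n)

/-- After rescaling, the sum `ζ + υ + R` of the three trinomial variables is `D (D-1) ψ`, so `A` and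
`B` disappear from the high powers. They survive only through the quadratic weights, where the terms
in `A²` and `A B` cancel. -/
theorem curlyQOf_static (hD : 5 ≤ D) {n : ℕ} (hn : 1 ≤ n) (A B ψ : ℝ) :
    curlyQOf D n (secInv (D := D) (blockK A B B ψ)) = staticLag D n A B ψ := by
  have h5 : (5 : ℝ) ≤ D := by exact_mod_cast hD
  have e1 : (D : ℝ) - 2 ≠ 0 := by linarith
  have e2 : (D : ℝ) ≠ 0 := by linarith
  have e3 : (D : ℝ) - 1 ≠ 0 := by linarith
  have e4 : (D : ℝ) ^ 2 - D ≠ 0 := by nlinarith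
  rw [secInv_static hD, curlyQOf, curlyZOf_staticInv hD hn, Finset.sum_eq_zero (s := Finset.range (n - 1))
    fun l _ => by rw [trivialTOf_staticInv hD, mul_zero], add_zero, secScal_blockK hD]
  set R := 2 * A + 2 * ((D : ℝ) - 2) * (B + B) + (D - 2) * (D - 3) * ψ with hR
  set z := staticZ D A B ψ with hz
  set w := staticW D A B ψ with hw
  set ζ := 2 * ((D : ℝ) ^ 2 - D) / (D - 2) * z with hζ
  set υ := ((D : ℝ) ^ 2 - D) / 2 * w with hυ
  have hS : ζ + (υ + R) = D * (D - 1) * ψ := by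
    rw [hζ, hυ, hR, hz, hw, staticZ, staticW]
    field_simp
    ring
  have key : ∀ i ∈ Finset.range (n + 1), ∀ j ∈ Finset.range (n - i + 1),
      gammaCoeff D n ((i : ℤ) - 2) ((j : ℤ) - 2) * (z ^ i * w ^ j * R ^ (n - i - j)) =
      (1 / (4 * ((D : ℝ) ^ 2 - D))) *
      (((D * (4 * D - 4) : ℝ) + (D * (4 - 5 * D)) * i + (D ^ 2) * (i : ℝ) ^ 2
        + (4 * (D - 1) * (1 - 2 * D) + (4 * (D - 1) * D) * i) * j + 4 * (D - 1) ^ 2 * (j : ℝ) ^ 2) *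
        ((n.choose i * (n - i).choose j) * (ζ ^ i * υ ^ j * R ^ (n - i - j)))) := by
    intro i hi j hj
    have : i + j ≤ n := by
      have := Finset.mem_range.1 hi
      have := Finset.mem_range.1 hj
      omega
    rw [gammaCoeff_eq hD this, hζ, hυ, mul_pow, mul_pow]
    ring
  rw [Finset.sum_congr rfl fun i hi => Finset.sum_congr rfl (key i hi)]
  simp only [← Finset.mul_sum]
  rw [sum_trinomial_quadratic, hS, staticLag]
  -- The exponent `n - 2` truncates at `n = 1`, where its coefficient contains the factor `n - 1 =
  -- 0`.
  rcases n with _ | _ | m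
  · omega
  · rw [hζ, hυ, hz, hw, staticZ, staticW]
    simp
    field_simp
    ring
  · simp only [show m + 1 + 1 - 1 = m + 1 by omega, show m + 1 + 1 - 2 = m by omega, pow_succ,
      mul_pow]
    rw [hζ, hυ, hz, hw, staticZ, staticW]
    push_cast
    generalize (D : ℝ) ^ m = x
    generalize ((D : ℝ) - 1) ^ m = y
    field_simp
    ring

/-! ### Cosmological curvatures -/

/-- The eigenvalue of the traceless Ricci tensor on space for the cosmological curvatures. -/
def cosmoZ (D : ℕ) (α β : ℝ) : ℝ := ((D : ℝ) - 2) * (β - α) / D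

theorem secZ_cosmo (hD : 5 ≤ D) (α β : ℝ) :
    secZ (D := D) (blockK α α β β) = blockV (-((D : ℝ) - 1) * cosmoZ D α β)
      (cosmoZ D α β) (cosmoZ D α β) := by
  have h5 : (5 : ℝ) ≤ D := by exact_mod_cast hD
  have e1 : (D : ℝ) ≠ 0 := by linarith
  rw [secZ_eq_blockV _ (secRic_blockK hD α α β β), secScal_blockK hD]
  congr 1 <;> (unfold cosmoZ; field_simp; ring)

/-- FLRW geometries are conformally flat, so of the sums in `𝓩_{(n)}` only the one with `𝓘^{(2)}`
and the pure power of `R` survive. -/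
theorem secW_cosmo (hD : 5 ≤ D) (α β : ℝ) (a b : Coord D) :
    secW (D := D) (blockK α α β β) a b = 0 := by
  have h5 : (5 : ℝ) ≤ D := by exact_mod_cast hD
  have e2 : (D : ℝ) - 1 ≠ 0 := by linarith
  have e3 : (D : ℝ) - 2 ≠ 0 := by linarith
  unfold secW
  rw [secRic_blockK hD, secScal_blockK hD]
  split_ifs with hab
  · rfl
  rcases a with i | i <;> rcases b with j | j
  · fin_cases i <;> fin_cases j <;> first | exact absurd rfl hab | skip
    all_goals
      simp [blockK, blockV]
      field_simp
      ring
  · fin_cases i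
    all_goals
      simp [blockK, blockV]
      field_simp
      ring
  · fin_cases j
    all_goals
      simp [blockK, blockV]
      field_simp
      ring
  · have : i ≠ j := fun h => hab (by rw [h])
    simp [blockK, blockV, this]
    field_simp
    ring

/-- The invariants of the curvature with Ricci scalar `R`, vanishing Weyl tensor and the
eigenvalue `k` of the traceless Ricci tensor on space. -/
def cosmoInv (D : ℕ) (R k : ℝ) : CurvInv where
  R := R
  W₂ := 0
  W₃ := 0
  Z₂ := 2 * (D - 1) / (D - 2) * k ^ 2
  Z₃ := 4 * (D - 1) / (D - 4) * k ^ 3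
  X₃ := 0
  X₄ := 0
  Y₃ := 0
  Y₄ := 0
  t₂ := D * (D - 1) * k ^ 2
  t₃ := - D * (D - 1) * (D - 2) * k ^ 3
  t₄ := (D - 1) * (((D : ℝ) - 1) ^ 3 + 1) * k ^ 4
  t₅ := - (D - 1) * (((D : ℝ) - 1) ^ 4 - 1) * k ^ 5

theorem secInv_cosmo (hD : 5 ≤ D) (α β : ℝ) :
    secInv (D := D) (blockK α α β β) = cosmoInv D (secScal (D := D) (blockK α α β β))
      (cosmoZ D α β) := by
  have h5 : (5 : ℝ) ≤ D := by exact_mod_cast hD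
  have e1 : (D : ℝ) ≠ 0 := by linarith
  have e3 : (D : ℝ) - 2 ≠ 0 := by linarith
  have e5 : (D : ℝ) - 4 ≠ 0 := by linarith
  unfold secInv cosmoInv
  rw [secZ_cosmo hD]
  simp only [secW_cosmo hD, blockV_pow, sum_blockV hD]
  rw [CurvInv.mk.injEq]
  refine ⟨rfl, ?_, ?_, ?_, ?_, ?_, ?_, ?_, ?_, ?_, ?_, ?_, ?_⟩
  all_goals
    try simp only [ne_eq, OfNat.ofNat_ne_zero, not_false_eq_true, zero_pow, mul_zero, zero_mul,
      Finset.sum_const_zero]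
  all_goals
    try field_simp
    try ring

/-- The theory on the cosmological curvatures. -/
def cosmoLag (D n : ℕ) (α β : ℝ) : ℝ :=
  ((D : ℝ) * (D - 1)) ^ (n - 1) * (D - 1) * (2 * n * α * β ^ (n - 1) + (D - 2 * n) * β ^ n)

/-- Here `𝓚₂ = k²`, and the prefactor of `𝓣` is the reciprocal of what the bracket contributes, so
`𝓣` supplies exactly the missing power of `k`. -/
theorem trivialTOf_cosmoInv (hD : 5 ≤ D) {l : ℕ} (hl : 2 ≤ l) (R k : ℝ) :
    trivialTOf D l (cosmoInv D R k) = k ^ (l + 2) := by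
  have h5 : (5 : ℝ) ≤ D := by exact_mod_cast hD
  have e1 : (D : ℝ) ≠ 0 := by linarith
  have e2 : (D : ℝ) - 1 ≠ 0 := by linarith
  have e3 : (D : ℝ) - 2 ≠ 0 := by linarith
  have e4 : (D : ℝ) - 3 ≠ 0 := by linarith
  have e6 : (D : ℝ) ^ 2 - 4 * D + 3 = (D - 1) * (D - 3) := by ring
  have k2 : 1 / ((D : ℝ) * (D - 1)) * (D * (D - 1) * k ^ 2) = k ^ 2 := by field_simp
  simp only [trivialTOf, cosmoInv, k2, e6, ← pow_mul]
  split_ifs with h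
  · rw [show k ^ (l + 2) = k ^ (2 * (l / 2 - 1)) * k ^ 4 by
      rw [← pow_add]; congr 1; have := Nat.even_iff.1 h; omega]
    generalize k ^ (2 * (l / 2 - 1)) = x
    field_simp
    ring
  · rw [show k ^ (l + 2) = k ^ (2 * (l / 2 - 1)) * k ^ 5 by
      rw [← pow_add]; congr 1; have := Nat.not_even_iff.1 h; omega]
    generalize k ^ (2 * (l / 2 - 1)) = x
    field_simp
    ring

/-- On FLRW curvatures `𝖹₂` and `𝖹₃` are not the square and the cube of one quantity, so `γ` alone
does not give a binomial expansion. The constant `η` is the difference between the `γ` contribution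
and the target weight `1 - i`, `i = l + 2`, against the binomial distribution in `σ =
2D(D-1)k/(D-2)`. -/
theorem gammaCoeff_add_etaCoeff (hD : 5 ≤ D) {n l : ℕ} (h : l + 2 ≤ n) (k : ℝ) :
    gammaCoeff D n l (-2) * ((2 * ((D : ℝ) - 1) / (D - 2) * k ^ 2) ^ (l / 2)
        * (if Even l then 2 * ((D : ℝ) - 1) / (D - 2) * k ^ 2 else 4 * (D - 1) / (D - 4) * k ^ 3))
      + etaCoeff D n l * k ^ (l + 2) =
    (1 - ((l + 2 : ℕ) : ℝ)) * (n.choose (l + 2) * (2 * ((D : ℝ) * (D - 1)) / (D - 2) * k) ^ (l + 2)) := by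
  have h5 : (5 : ℝ) ≤ D := by exact_mod_cast hD
  have e1 : (D : ℝ) ≠ 0 := by linarith
  have e2 : (D : ℝ) - 1 ≠ 0 := by linarith
  have e3 : (D : ℝ) - 2 ≠ 0 := by linarith
  have e4 : (D : ℝ) - 4 ≠ 0 := by linarith
  have e5 : (D : ℝ) ^ 2 - D = D * (D - 1) := by ring
  have g := gammaCoeff_eq hD (n := n) (i := l + 2) (j := 0) (by omega)
  rw [show (((l + 2 : ℕ) : ℤ) - 2) = l by push_cast; ring,
    show (((0 : ℕ) : ℤ) - 2) = -2 by norm_num] at g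
  rw [g, e5]
  have hη : etaCoeff D n l = -((2 * ((D : ℝ) * (D - 1)) / (D - 2)) ^ (l + 2) * ((l : ℝ) + 1) /
      (2 * (D - 2)) * (n.choose (l + 2) : ℝ) *
    (2 * ((D : ℝ) - 2)
      + ((D : ℝ) * ((l : ℝ) - 2) + 4) *
          ((D : ℝ) * ((l : ℝ) + 1 - 2 * ((l / 2 : ℕ) : ℝ)) - 4) / ((D : ℝ) - 4) *
        (2 * ((D : ℝ) - 1) / (D - 2)) ^ (l / 2))) := by
    unfold etaCoeff
    rw [show (2 * (D : ℝ) - 2) = 2 * (D - 1) by ring]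
    simp only [div_pow, mul_pow]
    generalize (2 * ((D : ℝ) - 2)
      + ((D : ℝ) * ((l : ℝ) - 2) + 4) *
          ((D : ℝ) * ((l : ℝ) + 1 - 2 * ((l / 2 : ℕ) : ℝ)) - 4) / ((D : ℝ) - 4) *
        (2 ^ (l / 2) * ((D : ℝ) - 1) ^ (l / 2) / (D - 2) ^ (l / 2))) = X
    rw [pow_succ ((D : ℝ) - 2) (l + 2), pow_succ (2 : ℝ) (l + 1)]
    field_simp
  rw [hη]
  generalize (2 * ((D : ℝ) * (D - 1)) / (D - 2)) = σ
  rw [mul_pow σ k, mul_pow _ (k ^ 2), ← pow_mul k]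
  generalize (2 * ((D : ℝ) - 1) / (D - 2)) ^ (l / 2) = c
  push_cast
  split_ifs with h
  · obtain ⟨m, rfl⟩ := h
    rw [Nat.choose_zero_right, show (m + m) / 2 = m by omega, show m + m + 2 = 2 * m + 2 by ring, pow_add k (2 * m)]
    push_cast
    generalize k ^ (2 * m) = x
    field_simp
    ring
  · obtain ⟨m, rfl⟩ := Nat.not_even_iff_odd.1 h
    rw [Nat.choose_zero_right, show (2 * m + 1) / 2 = m by omega, show 2 * m + 1 + 2 = 2 * m + 3 by ring,
      pow_add k (2 * m)]
    push_cast
    generalize k ^ (2 * m) = x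
    field_simp
    ring

/-- The weight `1 - i` is one at `i = 0`, giving `R^n`, and zero at `i = 1`, matching the absence of
a linear term. The sum is `(σ+R)^n - n σ (σ+R)^(n-1)`, where `σ + R = D (D-1) β`; hence `α` enters
only through the single factor `σ`. -/
theorem curlyQOf_cosmo (hD : 5 ≤ D) {n : ℕ} (hn : 1 ≤ n) (α β : ℝ) :
    curlyQOf D n (secInv (D := D) (blockK α α β β)) = cosmoLag D n α β := by
  have h5 : (5 : ℝ) ≤ D := by exact_mod_cast hD
  have e1 : (D : ℝ) ≠ 0 := by linarith
  have e3 : (D : ℝ) - 2 ≠ 0 := by linarith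
  rw [secInv_cosmo hD, secScal_blockK hD]
  set R := 2 * α + 2 * ((D : ℝ) - 2) * (α + β) + (D - 2) * (D - 3) * β with hR
  set k := cosmoZ D α β with hk
  set σ := 2 * ((D : ℝ) * (D - 1)) / (D - 2) * k with hσ
  have hS : σ + R = D * (D - 1) * β := by
    rw [hσ, hR, hk, cosmoZ]
    field_simp
    ring
  have hσ' : σ = 2 * (D - 1) * (β - α) := by
    rw [hσ, hk, cosmoZ]
    field_simp
  have hsum : curlyQOf D n (cosmoInv D R k) =
      ∑ i ∈ Finset.range (n + 1), (1 - (i : ℝ)) * (n.choose i * (σ ^ i * R ^ (n - i))) := by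
    have hT : ∀ l, etaCoeff D n l * (cosmoInv D R k).R ^ (n - l - 2) * trivialTOf D l (cosmoInv D R k) =
        etaCoeff D n l * R ^ (n - l - 2) * k ^ (l + 2) := by
      intro l
      rcases Nat.lt_or_ge l 2 with hl | hl
      · interval_cases l
        · simp [etaCoeff_zero hD]
        · simp [etaCoeff_one hD]
      · rw [trivialTOf_cosmoInv hD hl]
        rfl
    have hz : ∀ l : ℕ, (0 : ℝ) ^ (l / 2) * (if Even l then 0 else 0) = 0 := by
      intro l; split_ifs <;> simp
    have hr : n + 1 = n - 1 + 1 + 1 := by omega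
    rw [hr, Finset.sum_range_succ', Finset.sum_range_succ']
    simp only [curlyQOf, curlyZOf]
    rw [Finset.sum_congr rfl fun l _ => hT l]
    simp only [cosmoInv, mul_zero, zero_mul, add_zero, zero_add, Finset.sum_const_zero,
      ite_self]
    rw [add_assoc, ← Finset.sum_add_distrib, add_comm]
    congr 1
    · simp only [Nat.cast_one, sub_self, zero_mul, add_zero]
      refine Finset.sum_congr rfl fun l hl => ?_
      have hl' : l + 2 ≤ n := by have := Finset.mem_range.1 hl; omega
      have := gammaCoeff_add_etaCoeff hD hl' k
      rw [show n - (l + 1 + 1) = n - l - 2 by omega]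
      rw [← hσ] at this
      linear_combination R ^ (n - l - 2) * this
    · simp
  rw [hsum]
  simp only [sub_mul, one_mul, Finset.sum_sub_distrib]
  rw [sum_choose_pow, sum_choose_pow_mul, hS, hσ', cosmoLag]
  rcases n with _ | m
  · omega
  · simp only [Nat.add_sub_cancel, pow_succ, mul_pow]
    push_cast
    ring

end Reduced

/-! ### The derivative with respect to the curvature -/

section CurvatureDerivative

variable {D : ℕ}

/-- The theory as a function of the sectional curvatures. -/
def secLag (D n : ℕ) (K : Coord D → Coord D → ℝ) : ℝ := curlyQOf D n (secInv K)

theorem differentiable_secLag (D n : ℕ) : Differentiable ℝ (secLag D n) := by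
  have hric : ∀ a : Coord D, Differentiable ℝ fun K : Coord D → Coord D → ℝ => secRic K a := by
    intro a; unfold secRic; fun_prop
  have hscal : Differentiable ℝ fun K : Coord D → Coord D → ℝ => secScal K := by
    unfold secScal; fun_prop
  have hz : ∀ a : Coord D, Differentiable ℝ fun K : Coord D → Coord D → ℝ => secZ K a := by
    intro a; unfold secZ; fun_prop
  have hw : ∀ a b : Coord D, Differentiable ℝ fun K : Coord D → Coord D → ℝ => secW K a b := by
    intro a b; unfold secW; split_ifs <;> fun_prop
  have hite : ∀ (l : ℕ) (u v : (Coord D → Coord D → ℝ) → ℝ), Differentiable ℝ u →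
      Differentiable ℝ v → Differentiable ℝ fun K => if Even l then u K else v K := by
    intro l u v hu hv
    split_ifs <;> assumption
  unfold secLag curlyQOf curlyZOf trivialTOf secInv
  fun_prop (disch := assumption)

theorem curlyQ_diagCurv (hD : 5 ≤ D) {n : ℕ} (hn : 1 ≤ n) {e : Coord D → ℝ}
    {K : Coord D → Coord D → ℝ} (he : ∀ a, e a ≠ 0) (h0 : ∀ a, K a a = 0)
    (hs : ∀ a b, K a b = K b a) :
    curlyQ D n (Matrix.diagonal e) (diagCurv e K) = secLag D n K := by
  rw [curlyQ_eq_curlyQOf hD hn, invariants_diagCurv he h0 hs, secLag]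

/-- The symmetric matrix whose only non-zero entries are `1` at `ab` and at `ba`. -/
def pairUnit (a b : Coord D) : Coord D → Coord D → ℝ := fun p q =>
  (if p = a then 1 else 0) * (if q = b then 1 else 0)
    + (if q = a then 1 else 0) * (if p = b then 1 else 0)

theorem pairUnit_comm (a b p q : Coord D) : pairUnit a b p q = pairUnit a b q p := by
  unfold pairUnit; ring

theorem pairUnit_swap (a b : Coord D) : pairUnit a b = pairUnit b a := by
  funext p q; unfold pairUnit; ring

theorem pairUnit_self {a b : Coord D} (h : a ≠ b) (p : Coord D) : pairUnit a b p p = 0 := by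
  unfold pairUnit
  by_cases hp : p = a
  · subst hp; simp [h]
  · simp [hp]

/-- Pair symmetrisation yields a quarter of the square of the simple bivector of the `ab` plane. Its
cyclic sum vanishes, so imposing the cyclic identity changes nothing. -/
theorem riemannProj_basisTensor (a b : Coord D) (p q r s : Coord D) :
    riemannProj (basisTensor a b a b) p q r s = 1 / 4 * (pairUnit a b p q * pairDelta p q r s) := by
  have hB : ∀ p q r s, basisTensor a b a b p q r s = (if p = a then (1 : ℝ) else 0)
      * (if q = b then 1 else 0) * (if r = a then 1 else 0) * (if s = b then 1 else 0) := by
    intro p q r s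
    unfold basisTensor
    by_cases h1 : p = a <;> by_cases h2 : q = b <;> by_cases h3 : r = a <;>
      by_cases h4 : s = b <;> simp [h1, h2, h3, h4]
  have key : riemannProj (basisTensor a b a b) p q r s = 1 / 4 *
      (((if p = a then (1 : ℝ) else 0) * (if q = b then 1 else 0)
        - (if q = a then (1 : ℝ) else 0) * (if p = b then 1 else 0)) *
      ((if r = a then (1 : ℝ) else 0) * (if s = b then 1 else 0)
        - (if s = a then (1 : ℝ) else 0) * (if r = b then 1 else 0))) := by
    simp only [riemannProj, pairSymm, hB]
    ring
  rw [key, pairUnit, pairDelta]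
  congr 1
  by_cases h1 : p = a
  · by_cases h2 : q = b
    · subst h1 h2
      by_cases h : p = q
      · subst h; simp; split_ifs <;> simp
      · simp only [if_true, if_neg h, eq_comm]
        ring
    · by_cases h3 : p = b
      · by_cases h4 : q = a
        · exact absurd (h4.trans (h1.symm.trans h3)) h2
        · simp [h2, h4]
      · simp [h2, h3]
  · by_cases h2 : p = b
    · by_cases h3 : q = a
      · subst h2 h3
        simp only [if_true, if_neg h1, eq_comm]
        ring
      · simp [h1, h3]
    · simp [h1, h2]

theorem reflect_riemannProj (ε : Coord D → ℝ) (T : Tensor4 (Coord D)) :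
    reflect ε (riemannProj T) = riemannProj (reflect ε T) := by
  funext a b c d
  unfold reflect riemannProj pairSymm
  ring

theorem riemannProj_smul (u : ℝ) (T : Tensor4 (Coord D)) :
    riemannProj (u • T) = u • riemannProj T := by
  funext a b c d
  simp only [riemannProj, pairSymm, Pi.smul_apply, smul_eq_mul]
  ring

theorem reflect_basisTensor (ε : Coord D → ℝ) (a b c d : Coord D) :
    reflect ε (basisTensor a b c d) = (ε a * ε b * ε c * ε d) • basisTensor a b c d := by
  funext p q r s
  simp only [reflect, basisTensor, Pi.smul_apply, smul_eq_mul]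
  split_ifs with h
  · obtain ⟨rfl, rfl, rfl, rfl⟩ := h
    rfl
  · simp

theorem reflect_diagCurv {ε : Coord D → ℝ} (hε : ∀ a, ε a * ε a = 1) (e : Coord D → ℝ)
    (K : Coord D → Coord D → ℝ) : reflect ε (diagCurv e K) = diagCurv e K := by
  funext a b c d
  have h1 : ε a * ε b * ε c * ε d * pairDelta a b c d = pairDelta a b c d := by
    unfold pairDelta
    by_cases h1 : a = c
    · subst h1
      by_cases h2 : b = d
      · subst h2
        simp only [if_true]
        linear_combination (ε b * ε b * hε a + hε b)
          * (1 - (if a = b then (1 : ℝ) else 0) * (if b = a then 1 else 0))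
      · by_cases h3 : a = d
        · subst h3; simp [h2]
        · simp [h2, h3]
    · by_cases h2 : a = d
      · subst h2
        by_cases h3 : b = c
        · subst h3
          simp [h1]
          linear_combination (ε b * ε b * hε a + hε b)
        · simp [h1, h3]
      · simp [h1, h2]
  rw [reflect, diagCurv_apply]
  linear_combination e a * e b * K a b * h1

/-- The reflection fixes the sectional curvature and reverses the direction of variation, so the
Lagrangian is an even function of the variation parameter. -/
theorem derivCurv_eq_zero_of_reflect (hD : 5 ≤ D) {n : ℕ} (hn : 1 ≤ n) {e : Coord D → ℝ}
    (K : Coord D → Coord D → ℝ) (he : ∀ a, e a ≠ 0) {ε : Coord D → ℝ}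
    (hε : ∀ a, ε a * ε a = 1) {a b c d : Coord D} (h : ε a * ε b * ε c * ε d = -1) :
    derivCurv (curlyQ D n) (Matrix.diagonal e) (diagCurv e K) a b c d = 0 := by
  unfold derivCurv
  set φ : ℝ → ℝ := fun s => curlyQ D n (Matrix.diagonal e)
    (diagCurv e K + s • riemannProj (basisTensor a b c d)) with hφ
  have hX : reflect ε (riemannProj (basisTensor a b c d)) = - riemannProj (basisTensor a b c d) := by
    rw [reflect_riemannProj, reflect_basisTensor, h, riemannProj_smul, neg_one_smul]
  have hev : (fun s => φ (-s)) = φ := by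
    funext s
    rw [hφ]
    simp only
    rw [curlyQ_eq_curlyQOf hD hn, curlyQ_eq_curlyQOf hD hn,
      ← invariants_reflect he hε (diagCurv e K + s • riemannProj (basisTensor a b c d))]
    congr 2
    have : reflect ε (diagCurv e K + s • riemannProj (basisTensor a b c d)) =
        reflect ε (diagCurv e K) + s • reflect ε (riemannProj (basisTensor a b c d)) := by
      funext p q r t
      simp only [reflect, Pi.add_apply, Pi.smul_apply, smul_eq_mul]
      ring
    rw [this, hX, reflect_diagCurv hε]
    simp
  -- The derivative of an even function at `0` equals its own negative; no differentiability is
  -- needed for this.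
  have h2 := deriv_comp_neg φ 0
  rw [hev, neg_zero] at h2
  linarith

/-- Variation along the `ab` plane stays within sectional tensors, where the theory is `secLag`. The
factor `u` serves the components `abab` and `abba`, with `u = 1` and `u = -1`. -/
theorem derivCurv_pair (hD : 5 ≤ D) {n : ℕ} (hn : 1 ≤ n) {e : Coord D → ℝ}
    {K : Coord D → Coord D → ℝ} (he : ∀ a, e a ≠ 0) (h0 : ∀ a, K a a = 0)
    (hs : ∀ a b, K a b = K b a) {a b : Coord D} (hab : a ≠ b) (u : ℝ)
    {X : Tensor4 (Coord D)} (hX : X = u • riemannProj (basisTensor a b a b)) :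
    deriv (fun s : ℝ => curlyQ D n (Matrix.diagonal e) (diagCurv e K + s • X)) 0
      = u / (4 * (e a * e b)) * fderiv ℝ (secLag D n) K (pairUnit a b) := by
  have ha := he a
  have hb := he b
  have h1 : ∀ s : ℝ, curlyQ D n (Matrix.diagonal e) (diagCurv e K + s • X) =
      secLag D n (K + s • ((u / (4 * (e a * e b))) • pairUnit a b)) := by
    intro s
    rw [← curlyQ_diagCurv hD hn he]
    · congr 1
      funext p q r t
      rw [hX]
      simp only [Pi.add_apply, Pi.smul_apply, smul_eq_mul, riemannProj_basisTensor,
        diagCurv_apply]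
      have h3 : e p * e q * pairUnit a b p q = e a * e b * pairUnit a b p q := by
        unfold pairUnit
        by_cases h1 : p = a
        · by_cases h2 : q = b
          · rw [h1, h2]
          · by_cases h3 : q = a
            · by_cases h4 : p = b
              · rw [h3, h4]; ring
              · simp [h2, h4]
            · simp [h2, h3]
        · by_cases h3 : q = a
          · by_cases h4 : p = b
            · rw [h3, h4]; ring
            · simp [h1, h4]
          · simp [h1, h3]
      field_simp
      linear_combination (-s * u * pairDelta p q r t) * h3
    · intro c
      simp [h0, pairUnit_self hab]
    · intro c d
      simp [hs c d, pairUnit_comm a b c d]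
  simp only [h1]
  have h2 := ((differentiable_secLag D n) K).hasFDerivAt.hasLineDerivAt
    ((u / (4 * (e a * e b))) • pairUnit a b)
  have h3 := h2.lineDeriv
  rw [lineDeriv] at h3
  rw [h3, map_smul, smul_eq_mul]

theorem riemannProj_basisTensor_same (a c d : Coord D) :
    riemannProj (basisTensor a a c d) = 0 ∧ riemannProj (basisTensor c d a a) = 0 := by
  constructor
  · funext p q r s
    simp only [riemannProj, pairSymm, basisTensor, Pi.zero_apply]
    have h : ∀ p q r s : Coord D, (if p = a ∧ q = a ∧ r = c ∧ s = d then (1 : ℝ) else 0) =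
        if q = a ∧ p = a ∧ r = c ∧ s = d then 1 else 0 := by
      intro p q r s
      simp only [and_left_comm]
    rw [h q p r s, h q p s r, h s r p q, h s r q p, h r p s q, h r p q s, h q s p r, h q s r p,
      h s p q r, h s p r q, h r q p s, h r q s p]
    ring
  · funext p q r s
    simp only [riemannProj, pairSymm, basisTensor, Pi.zero_apply]
    have h : ∀ p q r s : Coord D, (if p = c ∧ q = d ∧ r = a ∧ s = a then (1 : ℝ) else 0) =
        if p = c ∧ q = d ∧ s = a ∧ r = a then 1 else 0 := by
      intro p q r s
      simp only [and_comm (a := r = a)]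
    rw [h p q s r, h q p s r, h r s q p, h s r q p, h p r q s, h r p q s, h s q r p, h q s r p,
      h p s r q, h s p r q, h q r s p, h r q s p]
    ring

/-- The components of `P_{abcd}` for a diagonal metric. -/
theorem lower4_derivCurv (hD : 5 ≤ D) {n : ℕ} (hn : 1 ≤ n) {e : Coord D → ℝ}
    {K : Coord D → Coord D → ℝ} (he : ∀ a, e a ≠ 0) (h0 : ∀ a, K a a = 0)
    (hs : ∀ a b, K a b = K b a) :
    lower4 (Matrix.diagonal e) (derivCurv (curlyQ D n) (Matrix.diagonal e) (diagCurv e K)) =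
      diagCurv e (fun a b => 1 / 4 * fderiv ℝ (secLag D n) K (pairUnit a b)) := by
  funext a b c d
  rw [lower4_diagonal, diagCurv_apply]
  have ha := he a
  have hb := he b
  by_cases hab : a = b
  · subst hab
    have h1 : derivCurv (curlyQ D n) (Matrix.diagonal e) (diagCurv e K) a a c d = 0 := by
      unfold derivCurv
      simp only [(riemannProj_basisTensor_same a c d).1, smul_zero, add_zero, deriv_const]
    rw [h1, pairDelta]
    ring
  by_cases hcd : c = d
  · subst hcd
    have h1 : derivCurv (curlyQ D n) (Matrix.diagonal e) (diagCurv e K) a b c c = 0 := by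
      unfold derivCurv
      simp only [(riemannProj_basisTensor_same c a b).2, smul_zero, add_zero, deriv_const]
    rw [h1, pairDelta]
    ring
  by_cases h1 : c = a
  · subst h1
    by_cases h2 : d = b
    · subst h2
      rw [pairDelta_self hab, derivCurv, derivCurv_pair hD hn he h0 hs hab 1 (one_smul _ _).symm]
      field_simp
    · have hbc : b ≠ c := fun t => hab t.symm
      have hbd : b ≠ d := fun t => h2 t.symm
      have : pairDelta c b c d = 0 := by simp [pairDelta, hbc, hbd]
      -- The index `b` occurs exactly once, so reflecting this axis changes the sign of the
      -- component. The other off-diagonal cases also reflect an axis that occurs once.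
      rw [this, derivCurv_eq_zero_of_reflect hD hn K he (ε := fun i => if i = b then -1 else 1)]
      · ring
      · intro i; split_ifs <;> norm_num
      · simp [hab, h2]
  · have hac : a ≠ c := fun t => h1 t.symm
    by_cases h2 : d = a
    · subst h2
      by_cases h3 : c = b
      · subst h3
        rw [pairDelta_swap hab, derivCurv, derivCurv_pair hD hn he h0 hs hab (-1)]
        · field_simp
        · rw [← riemannProj_smul]
          have : ∀ T : Tensor4 (Coord D), riemannProj (fun p q r s => T p q s r)
              = riemannProj ((-1 : ℝ) • T) := by
            intro T
            funext p q r s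
            simp only [riemannProj, pairSymm, Pi.smul_apply, smul_eq_mul]
            ring
          rw [← this]
          congr 1
          funext p q r s
          simp only [basisTensor, and_comm (a := r = c)]
      · have hbc : b ≠ c := fun t => h3 t.symm
        have hbd : b ≠ d := fun t => hab t.symm
        have : pairDelta d b c d = 0 := by simp [pairDelta, hbc, hbd]
        rw [this, derivCurv_eq_zero_of_reflect hD hn K he (ε := fun i => if i = b then -1 else 1)]
        · ring
        · intro i; split_ifs <;> norm_num
        · simp [hab, h3]
    · have had : a ≠ d := fun t => h2 t.symm
      have : pairDelta a b c d = 0 := by simp [pairDelta, hac, had]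
      have hba : b ≠ a := fun t => hab t.symm
      rw [this, derivCurv_eq_zero_of_reflect hD hn K he (ε := fun i => if i = a then -1 else 1)]
      · ring
      · intro i; split_ifs <;> norm_num
      · simp [hba, h1, h2]

end CurvatureDerivative

/-! ### The derivative for spherically symmetric curvatures -/

section ReducedDerivative

variable {D : ℕ}

theorem secRic_perm (σ : Equiv.Perm (Coord D)) (K : Coord D → Coord D → ℝ) (a : Coord D) :
    secRic (fun a b => K (σ a) (σ b)) a = secRic K (σ a) :=
  Equiv.sum_comp σ fun b => K (σ a) b

theorem secScal_perm (σ : Equiv.Perm (Coord D)) (K : Coord D → Coord D → ℝ) :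
    secScal (fun a b => K (σ a) (σ b)) = secScal K := by
  unfold secScal
  simp only [secRic_perm]
  exact Equiv.sum_comp σ fun a => secRic K a

theorem secZ_perm (σ : Equiv.Perm (Coord D)) (K : Coord D → Coord D → ℝ) (a : Coord D) :
    secZ (fun a b => K (σ a) (σ b)) a = secZ K (σ a) := by
  unfold secZ
  rw [secRic_perm, secScal_perm]

theorem secW_perm (σ : Equiv.Perm (Coord D)) (K : Coord D → Coord D → ℝ) (a b : Coord D) :
    secW (fun a b => K (σ a) (σ b)) a b = secW K (σ a) (σ b) := by
  unfold secW
  rw [secRic_perm, secRic_perm, secScal_perm]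
  simp only [EmbeddingLike.apply_eq_iff_eq]

theorem secInv_perm (σ : Equiv.Perm (Coord D)) (K : Coord D → Coord D → ℝ) :
    secInv (fun a b => K (σ a) (σ b)) = secInv K := by
  have h1 : ∀ F : Coord D → ℝ, ∑ a, F (σ a) = ∑ a, F a := Equiv.sum_comp σ
  have h2 : ∀ F : Coord D → Coord D → ℝ, ∑ a, ∑ b, F (σ a) (σ b) = ∑ a, ∑ b, F a b := by
    intro F
    exact (Finset.sum_congr rfl fun a _ => h1 (F (σ a))).trans (h1 fun a => ∑ b, F a b)
  unfold secInv
  simp only [secScal_perm, secZ_perm, secW_perm]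
  congr 1
  · congr 1; exact h2 fun a b => 2 * secW K a b ^ 2
  · congr 1; exact h2 fun a b => 4 * secW K a b ^ 3
  · congr 1; exact h1 fun a => secZ K a ^ 2
  · congr 1; exact h1 fun a => secZ K a ^ 3
  · congr 1; exact h2 fun a c => 2 * secW K a c ^ 2 * secZ K a
  · congr 1
    rw [← h2 fun a c => secZ K a * secW K a c * ∑ b, 2 * secW K c b ^ 2]
    refine Finset.sum_congr rfl fun a _ => Finset.sum_congr rfl fun c _ => ?_
    rw [← h1 fun b => 2 * secW K (σ c) b ^ 2]
  · congr 1; exact h2 fun a c => secW K a c * secZ K a * secZ K c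
  · congr 1; exact h2 fun a c => secZ K a ^ 2 * secW K a c * secZ K c
  · exact h1 fun a => secZ K a ^ 2
  · exact h1 fun a => secZ K a ^ 3
  · exact h1 fun a => secZ K a ^ 4
  · exact h1 fun a => secZ K a ^ 5

theorem fderiv_secLag_apply (n : ℕ) (K V : Coord D → Coord D → ℝ) :
    fderiv ℝ (secLag D n) K V = deriv (fun s : ℝ => secLag D n (K + s • V)) 0 := by
  have h2 := ((differentiable_secLag D n) K).hasFDerivAt.hasLineDerivAt V
  exact h2.lineDeriv.symm

/-- The invariants do not see the labels of the axes; a relabelling that fixes `K` therefore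
identifies the derivatives along the planes it permutes. This allows derivatives in all directions
to be recovered from the Lagrangian on symmetric `K` only. -/
theorem fderiv_secLag_perm (n : ℕ) (σ : Equiv.Perm (Coord D)) {K : Coord D → Coord D → ℝ}
    (hK : ∀ a b, K (σ a) (σ b) = K a b) (a b : Coord D) :
    fderiv ℝ (secLag D n) K (pairUnit (σ a) (σ b)) = fderiv ℝ (secLag D n) K (pairUnit a b) := by
  rw [fderiv_secLag_apply, fderiv_secLag_apply]
  congr 1
  funext s
  rw [secLag, ← secInv_perm σ, secLag]
  congr 2
  funext c d
  simp only [Pi.add_apply, Pi.smul_apply, hK, pairUnit, EmbeddingLike.apply_eq_iff_eq]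

/-- The factor `1/2` compensates that each plane `ab` appears in both orders; on the diagonal
`pairUnit a a` has the entry `2`. -/
theorem fderiv_secLag_eq_sum (n : ℕ) (K : Coord D → Coord D → ℝ) {V : Coord D → Coord D → ℝ}
    (hV : ∀ a b, V a b = V b a) : fderiv ℝ (secLag D n) K V =
      1 / 2 * ∑ a, ∑ b, V a b * fderiv ℝ (secLag D n) K (pairUnit a b) := by
  have h : V = (1 / 2 : ℝ) • ∑ a, ∑ b, V a b • pairUnit a b := by
    funext p q
    simp only [Pi.smul_apply, Finset.sum_apply, smul_eq_mul, pairUnit, mul_add,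
      Finset.sum_add_distrib]
    simp only [mul_ite, mul_one, mul_zero, Finset.sum_ite_eq,
      Finset.mem_univ, if_true]
    simp [hV q p]
    ring
  conv_lhs => rw [h]
  simp only [map_smul, map_sum, smul_eq_mul]

/-- Two successive transpositions do this. The points left fixed matter because the time axis must
not move in the cosmological case. -/
theorem exists_perm_pair {κ : Type} [DecidableEq κ] {a b c d : κ} (hab : a ≠ b) (hcd : c ≠ d) :
    ∃ σ : Equiv.Perm κ, σ a = c ∧ σ b = d ∧
      ∀ x, x ≠ a → x ≠ b → x ≠ c → x ≠ d → σ x = x := by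
  have h1 : Equiv.swap a c b ≠ c := by
    intro h
    have : Equiv.swap a c b = Equiv.swap a c a := by rw [h, Equiv.swap_apply_left]
    exact hab ((Equiv.swap a c).injective this).symm
  refine ⟨Equiv.swap (Equiv.swap a c b) d * Equiv.swap a c, ?_, ?_, ?_⟩
  · simp [Equiv.swap_apply_of_ne_of_ne h1.symm hcd]
  · simp
  · intro x ha hb hc hd
    rw [Equiv.Perm.mul_apply, Equiv.swap_apply_of_ne_of_ne ha hc,
      Equiv.swap_apply_of_ne_of_ne _ hd]
    intro h
    have : Equiv.swap a c x = Equiv.swap a c b := by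
      rw [Equiv.swap_apply_of_ne_of_ne ha hc, h]
    exact hb ((Equiv.swap a c).injective this)

/-- Exchanging `t` with `r` is a symmetry because the `ti` and `ri` entries agree. -/
theorem blockK_static_perm (σ : Equiv.Perm (Fin 2)) (τ : Equiv.Perm (Fin (D - 2))) (A B ψ : ℝ)
    (a b : Coord D) :
    blockK A B B ψ (Equiv.sumCongr σ τ a) (Equiv.sumCongr σ τ b) = blockK A B B ψ a b := by
  have h : ∀ i : Fin 2, ![B, B] i = B := by intro i; fin_cases i <;> rfl
  rcases a with i | i <;> rcases b with j | j <;> simp [blockK, h]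

theorem blockK_cosmo (α β : ℝ) (a b : Coord D) :
    blockK α α β β a b = if a = b then 0 else if a = tIdx D ∨ b = tIdx D then α else β := by
  rcases a with i | i <;> rcases b with j | j
  · fin_cases i <;> fin_cases j <;> simp [blockK]
  · fin_cases i <;> simp [blockK]
  · fin_cases j <;> simp [blockK]
  · simp [blockK]

theorem blockK_cosmo_perm (σ : Equiv.Perm (Coord D)) (hσ : σ (tIdx D) = tIdx D) (α β : ℝ)
    (a b : Coord D) : blockK α α β β (σ a) (σ b) = blockK α α β β a b := by
  have h : ∀ a, σ a = tIdx D ↔ a = tIdx D := by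
    intro a
    constructor
    · intro h; exact σ.injective (h.trans hσ.symm)
    · intro h; rw [h, hσ]
  simp only [blockK_cosmo, EmbeddingLike.apply_eq_iff_eq, h]

theorem sum_blockK_mul_blockK (hD : 5 ≤ D) (k₁ k₂ k₃ k₄ m₁ m₂ m₃ m₄ : ℝ) :
    ∑ a : Coord D, ∑ b : Coord D, blockK k₁ k₂ k₃ k₄ a b * blockK m₁ m₂ m₃ m₄ a b =
      2 * (k₁ * m₁) + 2 * ((D : ℝ) - 2) * (k₂ * m₂ + k₃ * m₃)
        + ((D : ℝ) - 2) * ((D : ℝ) - 3) * (k₄ * m₄) := by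
  rw [← secScal_blockK hD]
  unfold secScal secRic
  refine Finset.sum_congr rfl fun a _ => Finset.sum_congr rfl fun b _ => ?_
  rcases a with i | i <;> rcases b with j | j
  · simp only [blockK, Sum.elim_inl]; split_ifs <;> simp
  · fin_cases i <;> simp [blockK]
  · fin_cases j <;> simp [blockK]
  · simp only [blockK, Sum.elim_inr]; split_ifs <;> simp

theorem blockK_add_smul (k₁ k₂ k₃ k₄ m₁ m₂ m₃ m₄ s : ℝ) :
    (blockK k₁ k₂ k₃ k₄ + s • blockK m₁ m₂ m₃ m₄ : Coord D → Coord D → ℝ) =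
      blockK (k₁ + s * m₁) (k₂ + s * m₂) (k₃ + s * m₃) (k₄ + s * m₄) := by
  funext a b
  rcases a with i | i <;> rcases b with j | j
  · simp only [Pi.add_apply, Pi.smul_apply, smul_eq_mul, blockK, Sum.elim_inl]
    split_ifs <;> simp
  · fin_cases i <;> simp [blockK]
  · fin_cases j <;> simp [blockK]
  · simp only [Pi.add_apply, Pi.smul_apply, smul_eq_mul, blockK, Sum.elim_inr]
    split_ifs <;> simp

/-- The derivative of `staticLag` with respect to `A`. -/
def staticLagA (D n : ℕ) (ψ : ℝ) : ℝ := ((D : ℝ) * (D - 1)) ^ (n - 1) * (2 * n * ψ ^ (n - 1))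

/-- The derivative of `staticLag` with respect to `B`. -/
def staticLagB (D n : ℕ) (B ψ : ℝ) : ℝ := ((D : ℝ) * (D - 1)) ^ (n - 1) *
  (8 * n * (n - 1) * B * ψ ^ (n - 2) + 4 * n * (D - 2 * n) * ψ ^ (n - 1))

/-- The derivative of `staticLag` with respect to `ψ`. -/
def staticLagPsi (D n : ℕ) (A B ψ : ℝ) : ℝ := ((D : ℝ) * (D - 1)) ^ (n - 1) *
  (2 * n * (n - 1) * A * ψ ^ (n - 2) + 4 * n * (n - 1) * (n - 2) * B ^ 2 * ψ ^ (n - 3)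
    + 4 * n * (D - 2 * n) * (n - 1) * B * ψ ^ (n - 2)
    + (D - 1 - 2 * n) * (D - 2 * n) * n * ψ ^ (n - 1))

/-- The derivative of `cosmoLag` with respect to `α`. -/
def cosmoLagA (D n : ℕ) (β : ℝ) : ℝ :=
  ((D : ℝ) * (D - 1)) ^ (n - 1) * (D - 1) * (2 * n * β ^ (n - 1))

/-- The derivative of `cosmoLag` with respect to `β`. -/
def cosmoLagB (D n : ℕ) (α β : ℝ) : ℝ := ((D : ℝ) * (D - 1)) ^ (n - 1) * (D - 1) *
  (2 * n * (n - 1) * α * β ^ (n - 2) + (D - 2 * n) * n * β ^ (n - 1))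

theorem hasDerivAt_staticLag {n : ℕ} (hn : 1 ≤ n) (A B ψ x y z : ℝ) :
    HasDerivAt (fun s => staticLag D n (A + s * x) (B + s * y) (ψ + s * z))
      (staticLagA D n ψ * x + staticLagB D n B ψ * y + staticLagPsi D n A B ψ * z) 0 := by
  have h : ∀ a b : ℝ, HasDerivAt (fun s : ℝ => a + s * b) b 0 := by
    intro a b
    simpa using ((hasDerivAt_id (0 : ℝ)).mul_const b).const_add a
  have hp : ∀ m : ℕ, HasDerivAt (fun s : ℝ => (ψ + s * z) ^ m) (m * ψ ^ (m - 1) * z) 0 := by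
    intro m
    simpa using (h ψ z).fun_pow m
  have hB : HasDerivAt (fun s : ℝ => (B + s * y) ^ 2) (2 * B * y) 0 := by
    simpa using (h B y).fun_pow 2
  unfold staticLag
  refine HasDerivAt.congr_deriv (HasDerivAt.const_mul _ (HasDerivAt.fun_add (HasDerivAt.fun_add
    (HasDerivAt.fun_add (HasDerivAt.fun_mul (HasDerivAt.const_mul _ (h A x)) (hp _))
      (HasDerivAt.fun_mul (HasDerivAt.const_mul _ hB) (hp _)))
      (HasDerivAt.fun_mul (HasDerivAt.const_mul _ (h B y)) (hp _)))
      (HasDerivAt.const_mul _ (hp n)))) ?_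
  unfold staticLagA staticLagB staticLagPsi
  obtain ⟨m, rfl⟩ : ∃ m, n = m + 1 := ⟨n - 1, by omega⟩
  rcases m with _ | m
  · simp
  · simp only [show m + 1 + 1 - 1 = m + 1 by omega, show m + 1 + 1 - 2 = m by omega,
      show m + 1 + 1 - 3 = m - 1 by omega, show m + 1 - 1 = m by omega]
    push_cast
    simp only [zero_mul, add_zero]
    ring

theorem hasDerivAt_cosmoLag {n : ℕ} (hn : 1 ≤ n) (α β x y : ℝ) :
    HasDerivAt (fun s => cosmoLag D n (α + s * x) (β + s * y))
      (cosmoLagA D n β * x + cosmoLagB D n α β * y) 0 := by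
  have h : ∀ a b : ℝ, HasDerivAt (fun s : ℝ => a + s * b) b 0 := by
    intro a b
    simpa using ((hasDerivAt_id (0 : ℝ)).mul_const b).const_add a
  have hp : ∀ m : ℕ, HasDerivAt (fun s : ℝ => (β + s * y) ^ m) (m * β ^ (m - 1) * y) 0 := by
    intro m
    simpa using (h β y).fun_pow m
  unfold cosmoLag
  refine HasDerivAt.congr_deriv (HasDerivAt.const_mul _ (HasDerivAt.fun_add
    (HasDerivAt.fun_mul (HasDerivAt.const_mul _ (h α x)) (hp _))
      (HasDerivAt.const_mul _ (hp n)))) ?_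
  unfold cosmoLagA cosmoLagB
  obtain ⟨m, rfl⟩ : ∃ m, n = m + 1 := ⟨n - 1, by omega⟩
  simp only [show m + 1 - 1 = m by omega, show m + 1 - 2 = m - 1 by omega]
  push_cast
  simp only [zero_mul, add_zero]
  ring

/-- Permutation symmetry leaves one unknown for each of the three types of plane, and the three
partial derivatives of `staticLag` determine them. -/
theorem fderiv_secLag_static (hD : 5 ≤ D) {n : ℕ} (hn : 1 ≤ n) (A B ψ : ℝ) {a b : Coord D}
    (hab : a ≠ b) :
    fderiv ℝ (secLag D n) (blockK A B B ψ) (pairUnit a b) =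
      blockK (staticLagA D n ψ) (staticLagB D n B ψ / (2 * (D - 2)))
        (staticLagB D n B ψ / (2 * (D - 2)))
        (2 * staticLagPsi D n A B ψ / ((D - 2) * (D - 3))) a b := by
  have h5 : (5 : ℝ) ≤ D := by exact_mod_cast hD
  have e3 : (D : ℝ) - 2 ≠ 0 := by linarith
  have e4 : (D : ℝ) - 3 ≠ 0 := by linarith
  set Λ := fderiv ℝ (secLag D n) (blockK A B B ψ) with hΛ
  let i₀ : Fin (D - 2) := ⟨0, by omega⟩
  let i₁ : Fin (D - 2) := ⟨1, by omega⟩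
  have hi : i₀ ≠ i₁ := by simp [i₀, i₁]
  set c₁ := Λ (pairUnit (tIdx D) (rIdx D)) with hc₁
  set c₂ := Λ (pairUnit (tIdx D) (Sum.inr i₀)) with hc₂
  set c₃ := Λ (pairUnit (Sum.inr i₀) (Sum.inr i₁)) with hc₃
  have hperm : ∀ σ τ (a b : Coord D), Λ (pairUnit (Equiv.sumCongr σ τ a) (Equiv.sumCongr σ τ b)) =
      Λ (pairUnit a b) := fun σ τ a b =>
    fderiv_secLag_perm n _ (blockK_static_perm σ τ A B ψ) a b
  have hti : ∀ (k : Fin 2) (i : Fin (D - 2)), Λ (pairUnit (Sum.inl k) (Sum.inr i)) = c₂ := by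
    intro k i
    have := hperm (Equiv.swap 0 k) (Equiv.swap i₀ i) (tIdx D) (Sum.inr i₀)
    simpa using this
  have hij : ∀ i j : Fin (D - 2), i ≠ j → Λ (pairUnit (Sum.inr i) (Sum.inr j)) = c₃ := by
    intro i j h
    obtain ⟨τ, h1, h2, -⟩ := exists_perm_pair hi h
    have := hperm 1 τ (Sum.inr i₀) (Sum.inr i₁)
    simpa [h1, h2] using this
  have hall : ∀ a b : Coord D, a ≠ b → Λ (pairUnit a b) = blockK c₁ c₂ c₂ c₃ a b := by
    intro a b h
    rcases a with i | i <;> rcases b with j | j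
    · have h' : i ≠ j := fun t => h (by rw [t])
      fin_cases i <;> fin_cases j
      · exact absurd rfl h'
      · simp [blockK, hc₁]
      · rw [pairUnit_swap]; simp [blockK, hc₁]
      · exact absurd rfl h'
    · rw [hti]; fin_cases i <;> simp [blockK]
    · rw [pairUnit_swap, hti]; fin_cases j <;> simp [blockK]
    · have h' : i ≠ j := fun t => h (by rw [t])
      rw [hij i j h']; simp [blockK, h']
  -- Both sides are the derivative along `blockK x y y z`. The weights count planes: one `tr` plane,
  -- `2 (D-2)` mixed ones and `(D-2)(D-3)/2` tangent to the sphere.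
  have hdir : ∀ x y z : ℝ, staticLagA D n ψ * x + staticLagB D n B ψ * y
      + staticLagPsi D n A B ψ * z = x * c₁ + 2 * (D - 2) * (y * c₂)
        + (D - 2) * (D - 3) / 2 * (z * c₃) := by
    intro x y z
    have h1 : Λ (blockK x y y z) = staticLagA D n ψ * x + staticLagB D n B ψ * y
      + staticLagPsi D n A B ψ * z := by
      rw [hΛ, fderiv_secLag_apply, ← (hasDerivAt_staticLag hn A B ψ x y z).deriv]
      congr 1
      funext s
      rw [blockK_add_smul, secLag, curlyQOf_static hD hn]
    rw [← h1, hΛ, fderiv_secLag_eq_sum n _ (blockK_comm x y y z)]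
    have h2 : ∑ a : Coord D, ∑ b : Coord D, blockK x y y z a b * Λ (pairUnit a b) =
        ∑ a : Coord D, ∑ b : Coord D, blockK x y y z a b * blockK c₁ c₂ c₂ c₃ a b := by
      refine Finset.sum_congr rfl fun a _ => Finset.sum_congr rfl fun b _ => ?_
      by_cases h : a = b
      · subst h; simp [blockK_self]
      · rw [hall a b h]
    rw [← hΛ, h2, sum_blockK_mul_blockK hD]
    ring
  rw [hall a b hab]
  have k1 := hdir 1 0 0
  have k2 := hdir 0 1 0
  have k3 := hdir 0 0 1
  congr 1
  · linarith
  · field_simp; linarith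
  · field_simp; linarith
  · field_simp; linarith

theorem fderiv_secLag_cosmo (hD : 5 ≤ D) {n : ℕ} (hn : 1 ≤ n) (α β : ℝ) {a b : Coord D}
    (hab : a ≠ b) :
    fderiv ℝ (secLag D n) (blockK α α β β) (pairUnit a b) =
      blockK (cosmoLagA D n β / (D - 1)) (cosmoLagA D n β / (D - 1))
        (2 * cosmoLagB D n α β / ((D - 1) * (D - 2)))
        (2 * cosmoLagB D n α β / ((D - 1) * (D - 2))) a b := by
  have h5 : (5 : ℝ) ≤ D := by exact_mod_cast hD
  have e2 : (D : ℝ) - 1 ≠ 0 := by linarith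
  have e3 : (D : ℝ) - 2 ≠ 0 := by linarith
  set Λ := fderiv ℝ (secLag D n) (blockK α α β β) with hΛ
  let i₀ : Fin (D - 2) := ⟨0, by omega⟩
  set c₁ := Λ (pairUnit (tIdx D) (rIdx D)) with hc₁
  set c₂ := Λ (pairUnit (rIdx D) (Sum.inr i₀)) with hc₂
  have hperm : ∀ (σ : Equiv.Perm (Coord D)), σ (tIdx D) = tIdx D → ∀ a b : Coord D,
      Λ (pairUnit (σ a) (σ b)) = Λ (pairUnit a b) := fun σ h a b =>
    fderiv_secLag_perm n _ (blockK_cosmo_perm σ h α β) a b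
  have hta : ∀ a : Coord D, a ≠ tIdx D → Λ (pairUnit (tIdx D) a) = c₁ := by
    intro a ha
    have hσ : Equiv.swap (rIdx D) a (tIdx D) = tIdx D :=
      Equiv.swap_apply_of_ne_of_ne (by simp) ha.symm
    have := hperm _ hσ (tIdx D) (rIdx D)
    rwa [hσ, Equiv.swap_apply_left] at this
  have hij : ∀ a b : Coord D, a ≠ b → a ≠ tIdx D → b ≠ tIdx D → Λ (pairUnit a b) = c₂ := by
    intro a b h ha hb
    obtain ⟨τ, h1, h2, h3⟩ := exists_perm_pair (a := rIdx D) (b := Sum.inr i₀) (by simp) h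
    have := hperm τ (h3 _ (by simp) (by simp) ha.symm hb.symm) (rIdx D) (Sum.inr i₀)
    rwa [h1, h2] at this
  have hall : ∀ a b : Coord D, a ≠ b → Λ (pairUnit a b) = blockK c₁ c₁ c₂ c₂ a b := by
    intro a b h
    rw [blockK_cosmo, if_neg h]
    by_cases ha : a = tIdx D
    · subst ha; rw [hta b h.symm]; simp
    · by_cases hb : b = tIdx D
      · subst hb; rw [pairUnit_swap, hta a ha]; simp
      · rw [hij a b h ha hb]; simp [ha, hb]
  -- There are `D - 1` planes through the time axis and `(D-1)(D-2)/2` spatial ones.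
  have hdir : ∀ x y : ℝ, cosmoLagA D n β * x + cosmoLagB D n α β * y
      = (D - 1) * (x * c₁) + (D - 1) * (D - 2) / 2 * (y * c₂) := by
    intro x y
    have h1 : Λ (blockK x x y y) = cosmoLagA D n β * x + cosmoLagB D n α β * y := by
      rw [hΛ, fderiv_secLag_apply, ← (hasDerivAt_cosmoLag hn α β x y).deriv]
      congr 1
      funext s
      rw [blockK_add_smul, secLag, curlyQOf_cosmo hD hn]
    rw [← h1, hΛ, fderiv_secLag_eq_sum n _ (blockK_comm x x y y)]
    have h2 : ∑ a : Coord D, ∑ b : Coord D, blockK x x y y a b * Λ (pairUnit a b) =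
        ∑ a : Coord D, ∑ b : Coord D, blockK x x y y a b * blockK c₁ c₁ c₂ c₂ a b := by
      refine Finset.sum_congr rfl fun a _ => Finset.sum_congr rfl fun b _ => ?_
      by_cases h : a = b
      · subst h; simp [blockK_self]
      · rw [hall a b h]
    rw [← hΛ, h2, sum_blockK_mul_blockK hD]
    ring
  rw [hall a b hab]
  have k1 := hdir 1 0
  have k2 := hdir 0 1
  congr 1
  · field_simp; linarith
  · field_simp; linarith
  · field_simp; linarith
  · field_simp; linarith

end ReducedDerivative

/-! ### The field equations for diagonal metrics -/

section FieldEquations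

section Differentiability

variable {ι : Type} [Fintype ι] [DecidableEq ι]
variable {e : ι → (ι → ℝ) → ℝ} {l : ι → ι → (ι → ℝ) → ℝ} {x : ι → ℝ}
variable {p : ι → ι → (ι → ℝ) → ℝ} {n : ι → ι → ι → (ι → ℝ) → ℝ}

theorem hasPd_ite_of_exists {r : ι} {φ : (ι → ℝ) → ℝ} (P : Prop) [Decidable P]
    (h : ∃ u, HasPd r φ u x) : ∃ u, HasPd r (fun y => if P then φ y else 0) u x :=
  ⟨_, h.choose_spec.ite P⟩

theorem exists_hasPd_mul {r : ι} {φ ψ : (ι → ℝ) → ℝ} (h : ∃ u, HasPd r φ u x)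
    (k : ∃ u, HasPd r ψ u x) : ∃ u, HasPd r (fun y => φ y * ψ y) u x :=
  ⟨_, h.choose_spec.mul k.choose_spec⟩

theorem exists_hasPd_add {r : ι} {φ ψ : (ι → ℝ) → ℝ} (h : ∃ u, HasPd r φ u x)
    (k : ∃ u, HasPd r ψ u x) : ∃ u, HasPd r (fun y => φ y + ψ y) u x :=
  ⟨_, h.choose_spec.add k.choose_spec⟩

theorem exists_hasPd_sub {r : ι} {φ ψ : (ι → ℝ) → ℝ} (h : ∃ u, HasPd r φ u x)
    (k : ∃ u, HasPd r ψ u x) : ∃ u, HasPd r (fun y => φ y - ψ y) u x :=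
  ⟨_, h.choose_spec.sub k.choose_spec⟩

/-- The second covariant derivative is defined through `deriv`; one more derivative must exist
before the vanishing divergence may be differentiated. -/
theorem exists_hasPd_diagCov (h : IsLogDeriv e l x) (hl : ∀ a b c, ∃ u, HasPd c (l a b) u x)
    (hp : ∀ a b c, ∃ u, HasPd c (p a b) u x) (hn : ∀ a b c d, ∃ u, HasPd d (n a b c) u x)
    (r q a b c d : ι) : ∃ u, HasPd r (diagCov e l p n q a b c d) u x := by
  have he : ∀ a, ∃ u, HasPd r (e a) u x := fun a => ⟨_, h.2 a r⟩
  have hG : ∀ a b c, ∃ u, HasPd r (diagGamma e l a b c) u x := by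
    intro a b c
    choose m hm using hl
    exact ⟨_, hasPd_diagGamma h hm a b c r⟩
  have hc : ∀ c : ℝ, ∃ u, HasPd r (fun _ => c) u x := fun c => ⟨_, hasPd_const c⟩
  have hP : ∀ a b c d f a' b', ∀ (P : Prop) [Decidable P], ∃ u, HasPd r (fun y =>
      if P then diagGamma e l a b c y * (e d y * e f y * p a' b' y) else 0) u x := by
    intro a b c d f a' b' P _
    exact hasPd_ite_of_exists P (exists_hasPd_mul (hG a b c)
      (exists_hasPd_mul (exists_hasPd_mul (he d) (he f)) (hp a' b' r)))
  exact exists_hasPd_sub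
    (exists_hasPd_mul (hc _) (exists_hasPd_mul (exists_hasPd_mul (he a) (he b))
      (exists_hasPd_add (hn a b q r) (exists_hasPd_mul
        (exists_hasPd_mul (hc 2) (exists_hasPd_add (hl a q r) (hl b q r))) (hp a b r)))))
    (exists_hasPd_add (exists_hasPd_add (exists_hasPd_add
      (exists_hasPd_sub (hP _ _ _ _ _ _ _ _) (hP _ _ _ _ _ _ _ _))
      (exists_hasPd_sub (hP _ _ _ _ _ _ _ _) (hP _ _ _ _ _ _ _ _)))
      (exists_hasPd_sub (hP _ _ _ _ _ _ _ _) (hP _ _ _ _ _ _ _ _)))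
      (exists_hasPd_sub (hP _ _ _ _ _ _ _ _) (hP _ _ _ _ _ _ _ _)))

theorem covDeriv4_congr {g : (ι → ℝ) → Matrix ι ι ℝ} {T U : (ι → ℝ) → Tensor4 ι}
    (h : T =ᶠ[nhds x] U) (q a b c d : ι) : covDeriv4 g T x q a b c d = covDeriv4 g U x q a b c d := by
  unfold covDeriv4
  rw [pd_congr (h.mono fun y hy => by rw [hy]), h.self_of_nhds]

end Differentiability

variable {D : ℕ} {e : Coord D → (Coord D → ℝ) → ℝ} {l : Coord D → Coord D → (Coord D → ℝ) → ℝ}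
variable {x : Coord D → ℝ} {K p : Coord D → Coord D → (Coord D → ℝ) → ℝ}
variable {m : Coord D → Coord D → Coord D → (Coord D → ℝ) → ℝ}

/-- The factor `2` comes from the two orders of the antisymmetric pair of summed indices. -/
theorem sum_diagCurv_mul {e : Coord D → ℝ} (he : ∀ a, e a ≠ 0) {p K : Coord D → Coord D → ℝ}
    (h0 : ∀ a, K a a = 0) (a b : Coord D) :
    ∑ c, ∑ d, ∑ f, ∑ c', ∑ d', ∑ f', diagCurv e p a c d f *
      ((Matrix.diagonal e)⁻¹ c c' * (Matrix.diagonal e)⁻¹ d d' * (Matrix.diagonal e)⁻¹ f f' *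
        diagCurv e K b c' d' f') =
      if a = b then e a * (2 * ∑ c, p a c * K a c) else 0 := by
  rw [inv_diagonal_of_ne he]
  have h1 : ∀ c d f, ∑ c', ∑ d', ∑ f', diagCurv e p a c d f *
      (Matrix.diagonal (fun a => (e a)⁻¹) c c' * Matrix.diagonal (fun a => (e a)⁻¹) d d'
        * Matrix.diagonal (fun a => (e a)⁻¹) f f' * diagCurv e K b c' d' f') =
      diagCurv e p a c d f * ((e c)⁻¹ * (e d)⁻¹ * (e f)⁻¹ * diagCurv e K b c d f) := by
    intro c d f
    rw [Finset.sum_eq_single c, Finset.sum_eq_single d, Finset.sum_eq_single f]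
    · simp
    · intro i _ hi; simp [Matrix.diagonal_apply_ne _ hi.symm]
    · simp
    · intro i _ hi; simp [Matrix.diagonal_apply_ne _ hi.symm]
    · simp
    · intro i _ hi; simp [Matrix.diagonal_apply_ne _ hi.symm]
    · simp
  simp only [h1]
  have h2 : ∀ c, ∑ d, ∑ f, diagCurv e p a c d f *
      ((e c)⁻¹ * (e d)⁻¹ * (e f)⁻¹ * diagCurv e K b c d f) =
      if a = b then e a * (2 * (p a c * K a c)) else 0 := by
    intro c
    have h3 : ∀ d f, diagCurv e p a c d f *
      ((e c)⁻¹ * (e d)⁻¹ * (e f)⁻¹ * diagCurv e K b c d f) =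
        pairDelta a c d f * (e a * e c * p a c *
          ((e c)⁻¹ * (e d)⁻¹ * (e f)⁻¹ * diagCurv e K b c d f)) := by
      intro d f; rw [diagCurv_apply e p]; ring
    simp only [h3]
    rw [sum_pairDelta_mul a c fun d f => (e a * e c * p a c *
          ((e c)⁻¹ * (e d)⁻¹ * (e f)⁻¹ * diagCurv e K b c d f))]
    simp only [diagCurv_apply]
    have ha := he a
    have hb := he b
    have hc := he c
    by_cases hab : a = b
    · subst hab
      by_cases hac : a = c
      · subst hac; simp [h0]
      · rw [if_pos rfl, pairDelta_self hac, pairDelta_swap hac]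
        field_simp
        ring
    · have hba : b ≠ a := fun t => hab t.symm
      rw [if_neg hab]
      by_cases hbc : b = c
      · subst hbc; simp [h0]
      · simp [pairDelta, hba, hbc]
  simp only [h2]
  split_ifs
  · rw [Finset.mul_sum, Finset.mul_sum]
  · simp

/-- The field equations for a diagonal metric whose field `P_{abcd}` has vanishing divergence. -/
theorem fieldEq_diagMetric (hD : 5 ≤ D) {n : ℕ} (hn : 1 ≤ n)
    (hlog : ∀ᶠ y in nhds x, IsLogDeriv e l y)
    (hl : ∀ a b c, ∃ u, HasPd c (l a b) u x)
    (hK0 : ∀ a y, K a a y = 0) (hKs : ∀ a b y, K a b y = K b a y)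
    (hR : ∀ᶠ y in nhds x, riemann (diagMetric e) y = diagCurv (fun a => e a y) fun a b => K a b y)
    (hps : ∀ a b y, p a b y = p b a y)
    (hpK : ∀ᶠ y in nhds x, ∀ a b, a ≠ b →
      fderiv ℝ (secLag D n) (fun a b => K a b y) (pairUnit a b) = 4 * p a b y)
    (hm : ∀ᶠ y in nhds x, ∀ a b c, HasPd c (p a b) (m a b c y) y)
    (hm' : ∀ a b c d, ∃ u, HasPd d (m a b c) u x)
    (hdiv : ∀ᶠ y in nhds x, ∀ a c, a ≠ c →
      m a c c y + ∑ q, (if q = a then 0 else l q c y * (p a c y - p a q y)) = 0)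
    (a b : Coord D) :
    fieldEq (curlyQ D n) (diagMetric e) x a b = if a = b then
      e a x * (2 * ∑ c, p a c x * K a c x - 1 / 2 * secLag D n fun a b => K a b x) else 0 := by
  have h0 := hlog.self_of_nhds
  -- The sectional form is needed on a neighbourhood, since `P` is differentiated twice. The factor
  -- `4` in `hpK` cancels the `1/4` of `lower4_derivCurv`.
  have hP : pField (curlyQ D n) (diagMetric e) =ᶠ[nhds x] diagField e p := by
    filter_upwards [hlog, hR, hpK] with y h1 h2 h3
    rw [pField, h2, diagMetric, lower4_derivCurv hD hn h1.1 (fun a => hK0 a y)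
      (fun a b => hKs a b y), diagField]
    funext a b c d
    rw [diagCurv_apply, diagCurv_apply]
    by_cases hab : a = b
    · subst hab
      rw [show pairDelta a a c d = 0 by unfold pairDelta; ring]
      ring
    · rw [h3 a b hab]; ring
  have hcov : ∀ᶠ y in nhds x, ∀ q a b c d,
      covDeriv4 (diagMetric e) (pField (curlyQ D n) (diagMetric e)) y q a b c d =
        diagCov e l p m q a b c d y := by
    filter_upwards [hlog, hm, hP.eventually_nhds] with y h1 h2 h3 q a b c d
    rw [covDeriv4_congr h3, covDeriv4_diagField h1 h2]
  have hzero := sum_covDeriv4Twice_eq_zero h0 (pField (curlyQ D n) (diagMetric e))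
    (by
      filter_upwards [hcov, hlog, hm, hdiv] with y h1 h2 h3 h4 a c b
      simp only [h1]
      refine diagCov_div_eq_zero h2 (fun a b => hps a b y) ?_ h4 a c b
      intro a b q
      rw [← (h3 a b q).pd_eq, ← (h3 b a q).pd_eq, show p a b = p b a from funext (hps a b)])
    (by
      intro r q a b c d
      obtain ⟨u, hu⟩ := exists_hasPd_diagCov h0 hl
        (fun a b c => ⟨_, hm.self_of_nhds a b c⟩) hm' r q a b c d
      exact ⟨u, hu.congr_of_eventuallyEq (hcov.mono fun y hy => hy q a b c d)⟩)
  unfold fieldEq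
  have h1 : ∑ c, ∑ d, ∑ p', ∑ q, (diagMetric e x)⁻¹ c p' * (diagMetric e x)⁻¹ d q *
      covDeriv4Twice (diagMetric e) (pField (curlyQ D n) (diagMetric e)) x p' q a c b d = 0 := by
    rw [diagMetric, inv_diagonal_of_ne h0.1]
    refine Finset.sum_eq_zero fun c _ => ?_
    have h2 : ∀ d, ∑ p', ∑ q, Matrix.diagonal (fun a => (e a x)⁻¹) c p' *
        Matrix.diagonal (fun a => (e a x)⁻¹) d q * covDeriv4Twice (diagMetric e)
          (pField (curlyQ D n) (diagMetric e)) x p' q a c b d =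
        (e c x)⁻¹ * ((e d x)⁻¹ * covDeriv4Twice (diagMetric e)
          (pField (curlyQ D n) (diagMetric e)) x c d a c b d) := by
      intro d
      rw [Finset.sum_eq_single c, Finset.sum_eq_single d]
      · simp; ring
      · intro i _ hi; simp [Matrix.diagonal_apply_ne _ hi.symm]
      · simp
      · intro i _ hi; simp [Matrix.diagonal_apply_ne _ hi.symm]
      · simp
    rw [Finset.sum_congr rfl fun d _ => h2 d, ← Finset.mul_sum, hzero, mul_zero]
  rw [h1, hP.self_of_nhds, hR.self_of_nhds, diagField, diagMetric,
    sum_diagCurv_mul h0.1 (fun a => hK0 a x), curlyQ_diagCurv hD hn h0.1 (fun a => hK0 a x)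
      (fun a b => hKs a b x), Matrix.diagonal_apply]
  split_ifs <;> ring

end FieldEquations

/-! ### Warped metrics with spherical symmetry -/

section Warped

theorem hasPd_comp {ι : Type} [DecidableEq ι] {a : ι} {φ : ℝ → ℝ} {φ' : ℝ} {x : ι → ℝ}
    (h : HasDerivAt φ φ' (x a)) : HasPd a (fun y => φ (y a)) φ' x := by
  simpa [HasPd] using h

theorem hasPd_of_indep {ι : Type} [DecidableEq ι] {a : ι} {φ : (ι → ℝ) → ℝ} {x : ι → ℝ}
    (h : ∀ s, φ (Function.update x a s) = φ x) : HasPd a φ 0 x := by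
  simp only [HasPd, h]
  exact hasDerivAt_const _ _

theorem hasPd_comp_of_ne {ι : Type} [DecidableEq ι] {a c : ι} (hac : c ≠ a) (φ : ℝ → ℝ)
    (x : ι → ℝ) : HasPd a (fun y => φ (y c)) 0 x :=
  hasPd_of_indep fun s => by rw [Function.update_of_ne hac]

variable {D : ℕ}

/-- The squared Euclidean norm of the stereographic coordinates. -/
def sphereNorm (D : ℕ) (x : Coord D → ℝ) : ℝ := ∑ i, x (Sum.inr i) ^ 2

theorem one_add_sphereNorm_pos (x : Coord D → ℝ) : 0 < 1 + sphereNorm D x := by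
  have : 0 ≤ sphereNorm D x := Finset.sum_nonneg fun i _ => sq_nonneg _
  linarith

theorem hasPd_sphereNorm (j : Fin (D - 2)) (x : Coord D → ℝ) :
    HasPd (Sum.inr j) (sphereNorm D) (2 * x (Sum.inr j)) x := by
  have h : HasPd (Sum.inr j) (sphereNorm D)
      (∑ i, if i = j then 2 * x (Sum.inr j) else 0) x := by
    refine HasPd.sum _ fun i _ => ?_
    split_ifs with h
    · subst h
      exact hasPd_comp (φ := fun s => s ^ 2) (by simpa using hasDerivAt_pow 2 (x (Sum.inr i)))
    · exact hasPd_comp_of_ne (by simpa using h) (fun s => s ^ 2) x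
  simpa using h

/-- The logarithmic derivative of the conformal factor of the sphere. -/
def sphereL (j : Fin (D - 2)) (x : Coord D → ℝ) : ℝ := -2 * x (Sum.inr j) / (1 + sphereNorm D x)

theorem hasPd_sphereL (i j : Fin (D - 2)) (x : Coord D → ℝ) :
    HasPd (Sum.inr i) (sphereL j)
      ((if j = i then -2 / (1 + sphereNorm D x) else 0) + sphereL j x * sphereL i x) x := by
  have h0 := (one_add_sphereNorm_pos x).ne'
  have h1 : HasPd (Sum.inr i) (fun y : Coord D → ℝ => -2 * y (Sum.inr j))
      (if j = i then -2 else 0) x := by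
    split_ifs with h
    · subst h
      exact hasPd_comp (φ := fun s => -2 * s)
        (by simpa using (hasDerivAt_id (x (Sum.inr j))).const_mul (-2))
    · exact hasPd_comp_of_ne (by simpa using h) (fun s => -2 * s) x
  refine (h1.div ((hasPd_const 1).add (hasPd_sphereNorm i x)) h0).congr_value ?_
  unfold sphereL
  split_ifs <;> (field_simp; ring)

theorem hasPd_sphereFactor (j : Fin (D - 2)) (x : Coord D → ℝ) :
    HasPd (Sum.inr j) (sphereFactor D) (2 * sphereL j x * sphereFactor D x) x := by
  have h0 := (one_add_sphereNorm_pos x).ne'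
  have h1 := (hasPd_const (a := Sum.inr j) (x := x) 1).add (hasPd_sphereNorm j x)
  have h2 := (hasPd_const (a := Sum.inr j) (x := x) 4).div (h1.mul h1)
    (mul_ne_zero h0 h0)
  have h3 : sphereFactor D = fun y => 4 / ((1 + sphereNorm D y) * (1 + sphereNorm D y)) := by
    funext y; rw [sphereFactor, sphereNorm, sq]
  rw [h3]
  refine h2.congr_value ?_
  unfold sphereL
  field_simp
  ring

theorem sphereNorm_update_inl (i : Fin 2) (x : Coord D → ℝ) (s : ℝ) :
    sphereNorm D (Function.update x (Sum.inl i) s) = sphereNorm D x := by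
  simp [sphereNorm]

theorem hasPd_sphereFactor_inl (i : Fin 2) (x : Coord D → ℝ) :
    HasPd (Sum.inl i) (sphereFactor D) 0 x :=
  hasPd_of_indep fun s => by simp [sphereFactor]

theorem hasPd_sphereL_inl (i : Fin 2) (j : Fin (D - 2)) (x : Coord D → ℝ) :
    HasPd (Sum.inl i) (sphereL j) 0 x :=
  hasPd_of_indep fun s => by rw [sphereL, sphereNorm_update_inl]; simp [sphereL]

/-- The entries of the metric `-N(t) u(r) dt² + b(t) v(r) dr² + b(t) r² dΩ²`. -/
def warpE (N b u v : ℝ → ℝ) : Coord D → (Coord D → ℝ) → ℝ :=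
  Sum.elim
    ![fun x => -(N (x (tIdx D)) * u (x (rIdx D))), fun x => b (x (tIdx D)) * v (x (rIdx D))]
    (fun _ x => b (x (tIdx D)) * x (rIdx D) ^ 2 * sphereFactor D x)

/-- The logarithmic derivatives of the entries of a warped metric. -/
def warpL (A H τ ρ : ℝ → ℝ) : Coord D → Coord D → (Coord D → ℝ) → ℝ :=
  Sum.elim
    (fun i => Sum.elim
      (![![fun x => A (x (tIdx D)), fun x => τ (x (rIdx D))],
        ![fun x => H (x (tIdx D)), fun x => ρ (x (rIdx D))]] i) (fun _ _ => 0))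
    (fun _ => Sum.elim ![fun x => H (x (tIdx D)), fun x => (x (rIdx D))⁻¹] sphereL)

/-- The first derivatives of `warpL` at a point where the derivatives of `A`, `H`, `τ`, `ρ` are
`A'`, `H'`, `τ'`, `ρ'`. -/
def warpM (A' H' τ' ρ' : ℝ) (x : Coord D → ℝ) : Coord D → Coord D → Coord D → ℝ :=
  Sum.elim
    (fun i => Sum.elim
      (![![Sum.elim ![A', 0] fun _ => 0, Sum.elim ![0, τ'] fun _ => 0],
        ![Sum.elim ![H', 0] fun _ => 0, Sum.elim ![0, ρ'] fun _ => 0]] i) (fun _ _ => 0))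
    (fun _ => Sum.elim
      ![Sum.elim ![H', 0] fun _ => 0, Sum.elim ![0, -((x (rIdx D))⁻¹ ^ 2)] fun _ => 0]
      (fun j => Sum.elim (fun _ => 0) fun i =>
        (if j = i then -2 / (1 + sphereNorm D x) else 0) + sphereL j x * sphereL i x))

variable {N b u v A H τ ρ : ℝ → ℝ} {x : Coord D → ℝ}

theorem sphereFactor_ne_zero (x : Coord D → ℝ) : sphereFactor D x ≠ 0 := by
  have := one_add_sphereNorm_pos x
  rw [sphereNorm] at this
  unfold sphereFactor
  positivity

theorem isLogDeriv_warp (hN : HasDerivAt N (2 * A (x (tIdx D)) * N (x (tIdx D))) (x (tIdx D)))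
    (hb : HasDerivAt b (2 * H (x (tIdx D)) * b (x (tIdx D))) (x (tIdx D)))
    (hu : HasDerivAt u (2 * τ (x (rIdx D)) * u (x (rIdx D))) (x (rIdx D)))
    (hv : HasDerivAt v (2 * ρ (x (rIdx D)) * v (x (rIdx D))) (x (rIdx D)))
    (hN0 : N (x (tIdx D)) ≠ 0) (hb0 : b (x (tIdx D)) ≠ 0) (hu0 : u (x (rIdx D)) ≠ 0)
    (hv0 : v (x (rIdx D)) ≠ 0) (hr : x (rIdx D) ≠ 0) :
    IsLogDeriv (warpE N b u v) (warpL (D := D) A H τ ρ) x := by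
  have hs := sphereFactor_ne_zero x
  have htr : tIdx D ≠ rIdx D := by simp
  have hpow : HasPd (rIdx D) (fun y => y (rIdx D) ^ 2) (2 * x (rIdx D)) x :=
    hasPd_comp (φ := fun s => s ^ 2) (by simpa using hasDerivAt_pow 2 (x (rIdx D)))
  constructor
  · intro a
    rcases a with i | i
    · fin_cases i
      · simp [warpE, hN0, hu0]
      · simp [warpE, hb0, hv0]
    · simp [warpE, hb0, hr, hs]
  · intro a c
    rcases a with i | i
    · fin_cases i
      · have hneg : ∀ {y' : ℝ} {c : Coord D},
            HasPd c (fun y => N (y (tIdx D)) * u (y (rIdx D))) y' x →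
            HasPd c (fun y => -(N (y (tIdx D)) * u (y (rIdx D)))) (-y') x :=
          fun h => HasDerivAt.fun_neg h
        rcases c with j | j
        · fin_cases j
          · refine (hneg ((hasPd_comp hN).mul (hasPd_comp_of_ne htr.symm u x))).congr_value ?_
            simp [warpE, warpL]; ring
          · refine (hneg ((hasPd_comp_of_ne htr N x).mul (hasPd_comp hu))).congr_value ?_
            simp [warpE, warpL]; ring
        · refine (hneg ((hasPd_comp_of_ne (by simp) N x).mul
            (hasPd_comp_of_ne (by simp) u x))).congr_value ?_
          simp [warpL]
      · rcases c with j | j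
        · fin_cases j
          · refine ((hasPd_comp hb).mul (hasPd_comp_of_ne htr.symm v x)).congr_value ?_
            simp [warpE, warpL]; ring
          · refine ((hasPd_comp_of_ne htr b x).mul (hasPd_comp hv)).congr_value ?_
            simp [warpE, warpL]; ring
        · refine ((hasPd_comp_of_ne (by simp) b x).mul
            (hasPd_comp_of_ne (by simp) v x)).congr_value ?_
          simp [warpL]
    · rcases c with j | j
      · fin_cases j
        · refine (((hasPd_comp hb).mul (hasPd_comp_of_ne htr.symm (fun s => s ^ 2) x)).mul
            (hasPd_sphereFactor_inl _ x)).congr_value ?_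
          simp [warpE, warpL]; ring
        · refine (((hasPd_comp_of_ne htr b x).mul hpow).mul
            (hasPd_sphereFactor_inl _ x)).congr_value ?_
          simp [warpE, warpL]; field_simp
      · refine (((hasPd_comp_of_ne (by simp) b x).mul
          (hasPd_comp_of_ne (by simp) (fun s => s ^ 2) x)).mul
          (hasPd_sphereFactor j x)).congr_value ?_
        simp [warpE, warpL]; ring

theorem hasPd_warpL {A' H' τ' ρ' : ℝ} (hA : HasDerivAt A A' (x (tIdx D)))
    (hH : HasDerivAt H H' (x (tIdx D))) (hτ : HasDerivAt τ τ' (x (rIdx D)))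
    (hρ : HasDerivAt ρ ρ' (x (rIdx D))) (hr : x (rIdx D) ≠ 0) (a b c : Coord D) :
    HasPd c (warpL A H τ ρ a b) (warpM A' H' τ' ρ' x a b c) x := by
  have htr : tIdx D ≠ rIdx D := by simp
  have hinv : HasPd (rIdx D) (fun y => (y (rIdx D))⁻¹) (-((x (rIdx D))⁻¹ ^ 2)) x :=
    hasPd_comp (φ := fun s => s⁻¹) (by simpa using hasDerivAt_inv hr)
  rcases a with i | i
  · rcases b with j | j
    · rcases c with k | k
      · fin_cases i <;> fin_cases j <;> fin_cases k <;> first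
          | exact hasPd_comp (by assumption)
          | exact hasPd_comp_of_ne (by simp) _ x
      · fin_cases i <;> fin_cases j <;> exact hasPd_comp_of_ne (by simp) _ x
    · exact hasPd_const 0
  · rcases b with j | j
    · rcases c with k | k
      · fin_cases j <;> fin_cases k <;> first
          | exact hasPd_comp (by assumption)
          | exact hinv
          | exact hasPd_comp_of_ne (by simp) _ x
      · fin_cases j <;> first
          | exact hasPd_comp_of_ne (by simp) _ x
    · rcases c with k | k
      · exact hasPd_sphereL_inl _ _ _
      · exact hasPd_sphereL _ _ _

theorem warpM_symm (A' H' τ' ρ' : ℝ) (x : Coord D → ℝ) (a b c : Coord D) :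
    warpM A' H' τ' ρ' x a b c = warpM A' H' τ' ρ' x a c b := by
  rcases a with i | i
  · rcases b with j | j <;> rcases c with k | k
    · fin_cases i <;> fin_cases j <;> fin_cases k <;> simp [warpM]
    · fin_cases i <;> fin_cases j <;> simp [warpM]
    · fin_cases i <;> fin_cases k <;> simp [warpM]
    · simp [warpM]
  · rcases b with j | j <;> rcases c with k | k
    · fin_cases j <;> fin_cases k <;> simp [warpM]
    · fin_cases j <;> simp [warpM]
    · fin_cases k <;> simp [warpM]
    · simp [warpM, eq_comm, mul_comm]

/-- The only off-diagonal component not vanishing identically pairs `t` and `r` through a direction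
on the sphere, and it is proportional to `H τ`. Static metrics have `H = 0` and FLRW metrics have `τ
= 0`. -/
theorem warp_off {A' H' τ' ρ' : ℝ} (h0 : H (x (tIdx D)) * τ (x (rIdx D)) = 0)
    (a b c : Coord D) (hab : a ≠ b) (hbc : b ≠ c) (hac : a ≠ c) :
    warpM A' H' τ' ρ' x b a c + warpL A H τ ρ b a x * warpL A H τ ρ b c x =
      warpL A H τ ρ b a x * warpL A H τ ρ a c x + warpL A H τ ρ b c x * warpL A H τ ρ c a x := by
  rcases b with i | i
  · rcases a with j | j <;> rcases c with k | k
    · fin_cases i <;> fin_cases j <;> fin_cases k <;> simp_all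
    · fin_cases i <;> fin_cases j <;> simp_all [warpM, warpL]
    · fin_cases i <;> fin_cases k <;> simp_all [warpM, warpL]
    · simp [warpM, warpL]
  · rcases a with j | j <;> rcases c with k | k
    · fin_cases j <;> fin_cases k
      · simp at hac
      · simp [warpM, warpL]; linear_combination -h0
      · simp [warpM, warpL]; exact mul_eq_zero.1 h0
      · simp at hac
    · fin_cases j <;> simp [warpM, warpL] <;> ring
    · fin_cases k <;> simp [warpM, warpL]
    · have : j ≠ k := by simpa using hac
      simp [warpM, warpL, this]
      ring

/-- The sectional curvatures of a warped metric. -/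
theorem warp_diag {A' H' τ' ρ' : ℝ}
    (hN0 : N (x (tIdx D)) ≠ 0) (hb0 : b (x (tIdx D)) ≠ 0) (hu0 : u (x (rIdx D)) ≠ 0)
    (hv0 : v (x (rIdx D)) ≠ 0) (hr : x (rIdx D) ≠ 0) {k₁ k₂ k₃ k₄ : ℝ}
    (h₁ : k₁ = -(τ' + τ (x (rIdx D)) ^ 2 - τ (x (rIdx D)) * ρ (x (rIdx D)))
        / (b (x (tIdx D)) * v (x (rIdx D)))
      + (H' + H (x (tIdx D)) ^ 2 - H (x (tIdx D)) * A (x (tIdx D)))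
        / (N (x (tIdx D)) * u (x (rIdx D))))
    (h₂ : k₂ = (H' + H (x (tIdx D)) ^ 2 - H (x (tIdx D)) * A (x (tIdx D)))
        / (N (x (tIdx D)) * u (x (rIdx D)))
      - τ (x (rIdx D)) / (x (rIdx D) * (b (x (tIdx D)) * v (x (rIdx D)))))
    (h₃ : k₃ = ρ (x (rIdx D)) / (x (rIdx D) * (b (x (tIdx D)) * v (x (rIdx D))))
      + H (x (tIdx D)) ^ 2 / (N (x (tIdx D)) * u (x (rIdx D))))
    (h₄ : k₄ = 1 / (b (x (tIdx D)) * x (rIdx D) ^ 2)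
      + H (x (tIdx D)) ^ 2 / (N (x (tIdx D)) * u (x (rIdx D)))
      - 1 / (x (rIdx D) ^ 2 * (b (x (tIdx D)) * v (x (rIdx D)))))
    (a c : Coord D) (hac : a ≠ c) :
    blockK k₁ k₂ k₃ k₄ a c =
      -(warpM A' H' τ' ρ' x a c c + warpL A H τ ρ a c x ^ 2
          - 2 * warpL A H τ ρ a c x * warpL A H τ ρ c c x) / warpE N b u v c x
        - (warpM A' H' τ' ρ' x c a a + warpL A H τ ρ c a x ^ 2
          - 2 * warpL A H τ ρ c a x * warpL A H τ ρ a a x) / warpE N b u v a x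
        - ∑ f, warpL A H τ ρ a f x * warpL A H τ ρ c f x / warpE N b u v f x := by
  have hs := sphereFactor_ne_zero x
  have hY := (one_add_sphereNorm_pos x).ne'
  have hS : sphereFactor D x = 4 / (1 + sphereNorm D x) ^ 2 := rfl
  -- The squared gradient of the conformal factor; together with the derivatives of `sphereL` it
  -- produces the unit curvature of the round sphere.
  have hsum : ∀ c : ℝ, ∑ i, sphereL i x * sphereL i x / c =
      4 * sphereNorm D x / (1 + sphereNorm D x) ^ 2 / c := by
    intro c
    have : ∀ i, sphereL i x * sphereL i x / c =
        x (Sum.inr i) ^ 2 * (4 / (1 + sphereNorm D x) ^ 2 / c) := by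
      intro i; unfold sphereL; field_simp; ring
    rw [Finset.sum_congr rfl fun i _ => this i, ← Finset.sum_mul, ← sphereNorm]
    ring
  rw [Fintype.sum_sum_type, Fin.sum_univ_two]
  rcases a with i | i <;> rcases c with j | j
  · fin_cases i <;> fin_cases j
    · exact absurd rfl hac
    · simp [blockK, warpM, warpL, warpE, h₁]
      field_simp
      ring
    · simp [blockK, warpM, warpL, warpE, h₁]
      field_simp
      ring
    · exact absurd rfl hac
  · fin_cases i
    · simp [blockK, warpM, warpL, warpE, h₂]
      field_simp
      ring
    · simp [blockK, warpM, warpL, warpE, h₃]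
      field_simp
      ring
  · fin_cases j
    · simp [blockK, warpM, warpL, warpE, h₂]
      field_simp
      ring
    · simp [blockK, warpM, warpL, warpE, h₃]
      field_simp
      ring
  · have hij : i ≠ j := fun t => hac (by rw [t])
    simp [blockK, warpM, warpL, warpE, h₄, hij, hsum]
    rw [hS]
    field_simp
    ring

end Warped

/-! ### Field equations of warped metrics -/

section WarpedFieldEquations

/-- `A, H, τ, ρ` are the logarithmic derivatives of the functions `N, b, u, v` which define a warped
metric, and `A', H', τ', ρ'` their derivatives, at the values `t`, `r` of the coordinates. -/
structure IsWarp (N b u v A H τ ρ A' H' τ' ρ' : ℝ → ℝ) (t r : ℝ) : Prop where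
  hN : HasDerivAt N (2 * A t * N t) t
  hb : HasDerivAt b (2 * H t * b t) t
  hu : HasDerivAt u (2 * τ r * u r) r
  hv : HasDerivAt v (2 * ρ r * v r) r
  hN0 : N t ≠ 0
  hb0 : b t ≠ 0
  hu0 : u r ≠ 0
  hv0 : v r ≠ 0
  hr : r ≠ 0
  hA : HasDerivAt A (A' t) t
  hH : HasDerivAt H (H' t) t
  hτ : HasDerivAt τ (τ' r) r
  hρ : HasDerivAt ρ (ρ' r) r
  hHτ : H t * τ r = 0

variable {D : ℕ} {N b u v A H τ ρ A' H' τ' ρ' : ℝ → ℝ} {x : Coord D → ℝ}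

theorem IsWarp.isLogDeriv (h : IsWarp N b u v A H τ ρ A' H' τ' ρ' (x (tIdx D)) (x (rIdx D))) :
    IsLogDeriv (warpE N b u v) (warpL (D := D) A H τ ρ) x :=
  isLogDeriv_warp h.hN h.hb h.hu h.hv h.hN0 h.hb0 h.hu0 h.hv0 h.hr

theorem riemann_warp
    (h : ∀ᶠ y in nhds x, IsWarp N b u v A H τ ρ A' H' τ' ρ' (y (tIdx D)) (y (rIdx D)))
    {k₁ k₂ k₃ k₄ : ℝ}
    (h₁ : k₁ = -(τ' (x (rIdx D)) + τ (x (rIdx D)) ^ 2 - τ (x (rIdx D)) * ρ (x (rIdx D)))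
        / (b (x (tIdx D)) * v (x (rIdx D)))
      + (H' (x (tIdx D)) + H (x (tIdx D)) ^ 2 - H (x (tIdx D)) * A (x (tIdx D)))
        / (N (x (tIdx D)) * u (x (rIdx D))))
    (h₂ : k₂ = (H' (x (tIdx D)) + H (x (tIdx D)) ^ 2 - H (x (tIdx D)) * A (x (tIdx D)))
        / (N (x (tIdx D)) * u (x (rIdx D)))
      - τ (x (rIdx D)) / (x (rIdx D) * (b (x (tIdx D)) * v (x (rIdx D)))))
    (h₃ : k₃ = ρ (x (rIdx D)) / (x (rIdx D) * (b (x (tIdx D)) * v (x (rIdx D))))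
      + H (x (tIdx D)) ^ 2 / (N (x (tIdx D)) * u (x (rIdx D))))
    (h₄ : k₄ = 1 / (b (x (tIdx D)) * x (rIdx D) ^ 2)
      + H (x (tIdx D)) ^ 2 / (N (x (tIdx D)) * u (x (rIdx D)))
      - 1 / (x (rIdx D) ^ 2 * (b (x (tIdx D)) * v (x (rIdx D))))) :
    riemann (diagMetric (warpE N b u v)) x =
      diagCurv (fun a => warpE N b u v a x) (blockK k₁ k₂ k₃ k₄) := by
  have h0 := h.self_of_nhds
  exact riemann_diagMetric (h.mono fun y hy => hy.isLogDeriv)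
    ⟨hasPd_warpL h0.hA h0.hH h0.hτ h0.hρ h0.hr, warpM_symm _ _ _ _ _,
      fun a b c hab hbc hac => warp_off h0.hHτ a b c hab hbc hac,
      warp_diag h0.hN0 h0.hb0 h0.hu0 h0.hv0 h0.hr h₁ h₂ h₃ h₄⟩

/-- `blockK` for a vector of entries. -/
def blockF (P : Fin 4 → ℝ) : Coord D → Coord D → ℝ := blockK (P 0) (P 1) (P 2) (P 3)

theorem hasPd_blockF {c : Coord D} {P : Fin 4 → (Coord D → ℝ) → ℝ} {P' : Fin 4 → ℝ}
    (h : ∀ i, HasPd c (P i) (P' i) x) (a b : Coord D) :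
    HasPd c (fun y => blockF (fun i => P i y) a b) (blockF P' a b) x := by
  rcases a with i | i <;> rcases b with j | j
  · fin_cases i <;> fin_cases j
    · exact hasPd_const 0
    · exact h 0
    · exact h 0
    · exact hasPd_const 0
  · fin_cases i
    · exact h 1
    · exact h 2
  · fin_cases j
    · exact h 1
    · exact h 2
  · simp only [blockF, blockK, Sum.elim_inr]
    split_ifs
    · exact hasPd_const 0
    · exact h 3

/-- The derivatives of a field of block matrices that depends on `t` and `r` only. -/
def blockN (T R : Fin 4 → ℝ) (a b : Coord D) : Coord D → ℝ :=
  Sum.elim ![blockF T a b, blockF R a b] fun _ => 0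

/-- When `c` lies on the sphere the equation is automatic: `l q c` is non-zero only for `q` on the
sphere, and there `P` does not distinguish `c` from `q`. The hypotheses `h₁` to `h₄` are the pairs
`(r,t)`, `(i,t)`, `(t,r)` and `(i,r)`. -/
theorem warp_div (hD : 5 ≤ D) {P T R : Fin 4 → ℝ}
    (h₁ : T 0 + (D - 2) * (H (x (tIdx D)) * (P 0 - P 2)) = 0)
    (h₂ : T 1 + H (x (tIdx D)) * (P 1 - P 2) + (D - 3) * (H (x (tIdx D)) * (P 1 - P 3)) = 0)
    (h₃ : R 0 + (D - 2) * ((x (rIdx D))⁻¹ * (P 0 - P 1)) = 0)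
    (h₄ : R 2 + τ (x (rIdx D)) * (P 2 - P 1) + (D - 3) * ((x (rIdx D))⁻¹ * (P 2 - P 3)) = 0)
    (a c : Coord D) (hac : a ≠ c) :
    blockN T R a c c + ∑ q, (if q = a then 0 else
      warpL A H τ ρ q c x * (blockF P a c - blockF P a q)) = 0 := by
  have hs : ∀ (k : Fin (D - 2)) (l p : ℝ), ∑ q : Fin (D - 2), (if q = k then 0 else
      l * (p - if k = q then 0 else P 3)) = (D - 3) * (l * (p - P 3)) := by
    intro k l p
    rw [← sum_ite_fin hD k]
    refine Finset.sum_congr rfl fun q _ => ?_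
    by_cases h : q = k
    · simp [h]
    · have h' : k ≠ q := fun t => h t.symm
      simp [h, h']
  rw [Fintype.sum_sum_type, Fin.sum_univ_two]
  rcases c with j | j
  · rcases a with i | i
    · fin_cases i <;> fin_cases j
      · exact absurd rfl hac
      · simpa [blockN, blockF, blockK, warpL, cast_sub_two hD] using h₃
      · simpa [blockN, blockF, blockK, warpL, cast_sub_two hD] using h₁
      · exact absurd rfl hac
    · fin_cases j
      · simp [blockN, blockF, blockK, warpL, hs]
        linear_combination h₂
      · simp [blockN, blockF, blockK, warpL, hs]
        linear_combination h₄
  · rcases a with i | i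
    · fin_cases i <;> simp [blockN, blockF, blockK, warpL]
    · have hij : i ≠ j := fun t => hac (by rw [t])
      simp only [blockN, blockF, blockK, warpL, Sum.elim_inr, Sum.elim_inl]
      simp only [zero_mul, ite_self, zero_add, if_neg hij]
      refine Finset.sum_eq_zero fun q _ => ?_
      by_cases h : q = i
      · simp [h]
      · have h' : i ≠ q := fun t => h t.symm
        simp [h, h']

theorem fieldEq_warp (hD : 5 ≤ D) {n : ℕ} (hn : 1 ≤ n)
    (h : ∀ᶠ y in nhds x, IsWarp N b u v A H τ ρ A' H' τ' ρ' (y (tIdx D)) (y (rIdx D)))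
    {K P T R : Fin 4 → (Coord D → ℝ) → ℝ}
    (hK : ∀ᶠ y in nhds x, riemann (diagMetric (warpE N b u v)) y =
      diagCurv (fun a => warpE N b u v a y) (blockF fun i => K i y))
    (hKP : ∀ᶠ y in nhds x, ∀ a b : Coord D, a ≠ b →
      fderiv ℝ (secLag D n) (blockF fun i => K i y) (pairUnit a b) =
        4 * blockF (fun i => P i y) a b)
    (hP : ∀ᶠ y in nhds x, ∀ i, HasPd (tIdx D) (P i) (T i y) y ∧ HasPd (rIdx D) (P i) (R i y) y ∧
      ∀ j, HasPd (Sum.inr j) (P i) 0 y)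
    (hT : ∀ i d, ∃ u, HasPd d (T i) u x) (hR : ∀ i d, ∃ u, HasPd d (R i) u x)
    (hdiv : ∀ᶠ y in nhds x,
      T 0 y + (D - 2) * (H (y (tIdx D)) * (P 0 y - P 2 y)) = 0 ∧
      T 1 y + H (y (tIdx D)) * (P 1 y - P 2 y) + (D - 3) * (H (y (tIdx D)) * (P 1 y - P 3 y)) = 0 ∧
      R 0 y + (D - 2) * ((y (rIdx D))⁻¹ * (P 0 y - P 1 y)) = 0 ∧
      R 2 y + τ (y (rIdx D)) * (P 2 y - P 1 y)
        + (D - 3) * ((y (rIdx D))⁻¹ * (P 2 y - P 3 y)) = 0)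
    (a c : Coord D) :
    fieldEq (curlyQ D n) (diagMetric (warpE N b u v)) x a c = if a = c then
      warpE N b u v a x * (2 * ∑ c, blockF (fun i => P i x) a c * blockF (fun i => K i x) a c
        - 1 / 2 * secLag D n (blockF fun i => K i x)) else 0 := by
  have h0 := h.self_of_nhds
  have hl := hasPd_warpL h0.hA h0.hH h0.hτ h0.hρ h0.hr
  refine fieldEq_diagMetric hD hn (l := warpL A H τ ρ)
    (K := fun a b y => blockF (fun i => K i y) a b)
    (p := fun a b y => blockF (fun i => P i y) a b)
    (m := fun a b c y => blockN (fun i => T i y) (fun i => R i y) a b c)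
    (h.mono fun y hy => hy.isLogDeriv) (fun a b c => ⟨_, hl a b c⟩)
    (fun a y => blockK_self _ _ _ _ a) (fun a b y => blockK_comm _ _ _ _ a b) hK
    (fun a b y => blockK_comm _ _ _ _ a b) hKP ?_ ?_ ?_ a c
  · filter_upwards [hP] with y hy a b c
    rcases c with i | i
    · fin_cases i
      · exact hasPd_blockF (fun i => (hy i).1) a b
      · exact hasPd_blockF (fun i => (hy i).2.1) a b
    · refine (hasPd_blockF (fun i' => (hy i').2.2 i) a b).congr_value ?_
      rcases a with i | i <;> rcases b with j | j
      · simp [blockF, blockK, blockN]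
      · fin_cases i <;> simp [blockF, blockK, blockN]
      · fin_cases j <;> simp [blockF, blockK, blockN]
      · simp [blockF, blockK, blockN]
  · intro a b c d
    rcases c with i | i
    · choose u hu using hT
      choose w hw using hR
      fin_cases i
      · exact ⟨_, hasPd_blockF (fun i => hu i d) a b⟩
      · exact ⟨_, hasPd_blockF (fun i => hw i d) a b⟩
    · exact ⟨0, hasPd_const 0⟩
  · filter_upwards [hdiv] with y hy a c hac
    exact warp_div hD hy.1 hy.2.1 hy.2.2.1 hy.2.2.2 a c hac

end WarpedFieldEquations

/-! ### FLRW metrics -/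

section Cosmological

theorem contDiffAt_deriv {f : ℝ → ℝ} {t : ℝ} (h : ContDiffAt ℝ ∞ f t) :
    ContDiffAt ℝ ∞ (deriv f) t := by
  have h1 : ContDiffAt ℝ ∞ (fderiv ℝ f) t := h.fderiv_right (by simp)
  exact h1.clm_apply contDiffAt_const

theorem eventually_differentiableAt {f : ℝ → ℝ} {t : ℝ} (h : ContDiffAt ℝ ∞ f t) :
    ∀ᶠ s in nhds t, DifferentiableAt ℝ f s := by
  have h1 : ContDiffAt ℝ 1 f t := h.of_le (by exact_mod_cast le_top)
  exact (h1.eventually (by simp)).mono fun s hs => hs.differentiableAt (by simp)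

variable {D : ℕ}

theorem eventually_coord {x : Coord D → ℝ} (c : Coord D) {p : ℝ → Prop}
    (h : ∀ᶠ s in nhds (x c), p s) : ∀ᶠ y in nhds x, p (y c) :=
  (continuous_apply c).continuousAt.eventually h

/-- The curvature `α` of the planes which contain the time direction, as a function of
`(a, a', a'')` and `(F, F', F'')`. -/
def flrwAlpha (p q : ℝ × ℝ × ℝ) : ℝ :=
  ((p.2.2 * p.1 - p.2.1 ^ 2) / p.1 ^ 2 + (p.2.1 / p.1) ^ 2 - p.2.1 / p.1 * (q.2.1 / (2 * q.1))) / q.1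

/-- The curvature `β` of the spatial planes, as a function of `(a, a', a'')` and `(F, F', F'')`. -/
def flrwBeta (k : ℝ) (p q : ℝ × ℝ × ℝ) : ℝ := k / p.1 ^ 2 + (p.2.1 / p.1) ^ 2 / q.1

/-- A function together with its first two derivatives. -/
def jet (f : ℝ → ℝ) (t : ℝ) : ℝ × ℝ × ℝ := (f t, deriv f t, deriv (deriv f) t)

theorem flrw_eq_diagMetric (k : ℝ) (a F : ℝ → ℝ) :
    flrw D k a F = diagMetric (warpE F (fun t => a t ^ 2) (fun _ => 1)
      fun r => 1 / (1 - k * r ^ 2)) := by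
  funext x
  unfold flrw diagMetric
  congr 1
  funext c
  rcases c with i | i
  · fin_cases i
    · simp [warpE]
    · simp [warpE, div_eq_mul_inv]
  · simp [warpE]

theorem isWarp_flrw {k : ℝ} {a F : ℝ → ℝ} {t r : ℝ} (ha : DifferentiableAt ℝ a t)
    (ha' : DifferentiableAt ℝ (deriv a) t) (hF : DifferentiableAt ℝ F t)
    (hF' : DifferentiableAt ℝ (deriv F) t) (ha0 : 0 < a t) (hF0 : 0 < F t) (hr : 0 < r)
    (hk : 0 < 1 - k * r ^ 2) :
    IsWarp F (fun t => a t ^ 2) (fun _ => 1) (fun r => 1 / (1 - k * r ^ 2))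
      (fun t => deriv F t / (2 * F t)) (fun t => deriv a t / a t) (fun _ => 0)
      (fun r => k * r / (1 - k * r ^ 2)) (deriv fun t => deriv F t / (2 * F t))
      (fun t => (deriv (deriv a) t * a t - deriv a t ^ 2) / a t ^ 2) (fun _ => 0)
      (deriv fun r => k * r / (1 - k * r ^ 2)) t r where
  hN := hF.hasDerivAt.congr_deriv (by field_simp)
  hb := (ha.hasDerivAt.fun_pow 2).congr_deriv (by field_simp; ring)
  hu := (hasDerivAt_const r (1 : ℝ)).congr_deriv (by ring)
  hv := by
    have h1 : HasDerivAt (fun r : ℝ => 1 - k * r ^ 2) (-(k * (2 * r))) r := by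
      simpa using ((hasDerivAt_pow 2 r).const_mul k).const_sub 1
    refine ((hasDerivAt_const r (1 : ℝ)).fun_div h1 hk.ne').congr_deriv ?_
    have := hk.ne'
    field_simp
    ring
  hN0 := hF0.ne'
  hb0 := by positivity
  hu0 := one_ne_zero
  hv0 := by positivity
  hr := hr.ne'
  hA := (hF'.fun_div (hF.const_mul 2) (by positivity)).hasDerivAt
  hH := (ha'.hasDerivAt.fun_div ha.hasDerivAt ha0.ne').congr_deriv (by ring)
  hτ := hasDerivAt_const r (0 : ℝ)
  hρ := by
    have h1 : DifferentiableAt ℝ (fun r => k * r / (1 - k * r ^ 2)) r :=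
      DifferentiableAt.fun_div (by fun_prop) (by fun_prop) hk.ne'
    exact h1.hasDerivAt
  hHτ := mul_zero _

theorem contDiffAt_flrwAlpha {a F : ℝ → ℝ} {t : ℝ} (ha : ContDiffAt ℝ ∞ a t)
    (hF : ContDiffAt ℝ ∞ F t) (ha0 : a t ≠ 0) (hF0 : F t ≠ 0) :
    ContDiffAt ℝ ∞ (fun t => flrwAlpha (jet a t) (jet F t)) t := by
  have ha' := contDiffAt_deriv ha
  have ha'' := contDiffAt_deriv ha'
  have hF' := contDiffAt_deriv hF
  have h2 : a t ^ 2 ≠ 0 := pow_ne_zero 2 ha0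
  have h3 : 2 * F t ≠ 0 := mul_ne_zero two_ne_zero hF0
  unfold flrwAlpha jet
  exact ((((((ha''.mul ha).sub (ha'.pow 2)).div (ha.pow 2) h2).add ((ha'.div ha ha0).pow 2)).sub
    ((ha'.div ha ha0).mul (hF'.div (contDiffAt_const.mul hF) h3)))).div hF hF0

theorem contDiffAt_flrwBeta {k : ℝ} {a F : ℝ → ℝ} {t : ℝ} (ha : ContDiffAt ℝ ∞ a t)
    (hF : ContDiffAt ℝ ∞ F t) (ha0 : a t ≠ 0) (hF0 : F t ≠ 0) :
    ContDiffAt ℝ ∞ (fun t => flrwBeta k (jet a t) (jet F t)) t := by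
  have ha' := contDiffAt_deriv ha
  have h2 : a t ^ 2 ≠ 0 := pow_ne_zero 2 ha0
  unfold flrwBeta jet
  exact (contDiffAt_const.div (ha.pow 2) h2).add (((ha'.div ha ha0).pow 2).div hF hF0)

/-- The Bianchi identity of the FLRW metrics, with Hubble rate `a'/a`. The second derivative of `a`
appears only inside `flrwAlpha`. -/
theorem hasDerivAt_flrwBeta {k : ℝ} {a F : ℝ → ℝ} {t : ℝ} (ha : DifferentiableAt ℝ a t)
    (ha' : DifferentiableAt ℝ (deriv a) t) (hF : DifferentiableAt ℝ F t)
    (ha0 : a t ≠ 0) (hF0 : F t ≠ 0) :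
    HasDerivAt (fun t => flrwBeta k (jet a t) (jet F t))
      (2 * (deriv a t / a t) * (flrwAlpha (jet a t) (jet F t) - flrwBeta k (jet a t) (jet F t))) t := by
  have h2 : a t ^ 2 ≠ 0 := pow_ne_zero 2 ha0
  unfold flrwAlpha flrwBeta jet
  refine (((hasDerivAt_const t k).fun_div (ha.hasDerivAt.fun_pow 2) h2).fun_add
    (((ha'.hasDerivAt.fun_div ha.hasDerivAt ha0).fun_pow 2).fun_div hF.hasDerivAt hF0)).congr_deriv ?_
  simp only
  push_cast
  field_simp
  ring

/-- The field `P_{abcd}` on the planes which contain the time direction. -/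
def flrwP (D n : ℕ) (β : ℝ) : ℝ := cosmoLagA D n β / (4 * (D - 1))

/-- The field `P_{abcd}` on the spatial planes. -/
def flrwQ (D n : ℕ) (α β : ℝ) : ℝ := cosmoLagB D n α β / (2 * ((D - 1) * (D - 2)))

/-- The vanishing of the divergence of `P`. It works because `(D-2) (P - Q)` is `n (n-1) β^(n-2) (β
- α)` times the constant `(D (D-1))^(n-1)`, which is the derivative of `P` with respect to `β` times
`2 (β - α)`. -/
theorem hasDerivAt_flrwP (hD : 5 ≤ D) {n : ℕ} (hn : 1 ≤ n) {α H : ℝ} {β : ℝ → ℝ} {t : ℝ}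
    (h : HasDerivAt β (2 * H * (α - β t)) t) :
    HasDerivAt (fun t => flrwP D n (β t))
      (-((D - 2) * (H * (flrwP D n (β t) - flrwQ D n α (β t))))) t := by
  have h5 : (5 : ℝ) ≤ D := by exact_mod_cast hD
  have e2 : (D : ℝ) - 1 ≠ 0 := by linarith
  have e3 : (D : ℝ) - 2 ≠ 0 := by linarith
  unfold flrwP flrwQ cosmoLagA cosmoLagB
  refine ((((h.fun_pow (n - 1)).const_mul (2 * (n : ℝ))).const_mul _).div_const _).congr_deriv ?_
  obtain ⟨m, rfl⟩ : ∃ m, n = m + 1 := ⟨n - 1, by omega⟩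
  rcases m with _ | m
  · simp
    field_simp
    ring_nf
    simp
  · simp only [show m + 1 + 1 - 1 = m + 1 by omega, show m + 1 + 1 - 2 = m by omega,
      show m + 1 - 1 = m by omega]
    push_cast
    field_simp
    ring

theorem fieldEq_flrw (hD : 5 ≤ D) {n : ℕ} (hn : 1 ≤ n) {k : ℝ} {a F : ℝ → ℝ} {x : Coord D → ℝ}
    (ha : ContDiffAt ℝ ∞ a (x (tIdx D))) (hF : ContDiffAt ℝ ∞ F (x (tIdx D)))
    (ha0 : 0 < a (x (tIdx D))) (hF0 : 0 < F (x (tIdx D))) (hr : 0 < x (rIdx D))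
    (hk : 0 < 1 - k * x (rIdx D) ^ 2) {α β : ℝ}
    (hα : α = flrwAlpha (jet a (x (tIdx D))) (jet F (x (tIdx D))))
    (hβ : β = flrwBeta k (jet a (x (tIdx D))) (jet F (x (tIdx D)))) (b c : Coord D) :
    fieldEq (curlyQ D n) (flrw D k a F) x b c = if b = c then
      flrw D k a F x b b * (2 * ∑ c,
          blockK (flrwP D n β) (flrwP D n β) (flrwQ D n α β) (flrwQ D n α β) b c
            * blockK α α β β b c
        - 1 / 2 * secLag D n (blockK α α β β)) else 0 := by
  have h5 : (5 : ℝ) ≤ D := by exact_mod_cast hD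
  have e2 : (D : ℝ) - 1 ≠ 0 := by linarith
  have e3 : (D : ℝ) - 2 ≠ 0 := by linarith
  have hw : ∀ᶠ y in nhds x, DifferentiableAt ℝ a (y (tIdx D)) ∧
      DifferentiableAt ℝ (deriv a) (y (tIdx D)) ∧ DifferentiableAt ℝ F (y (tIdx D)) ∧
      DifferentiableAt ℝ (deriv F) (y (tIdx D)) ∧ 0 < a (y (tIdx D)) ∧ 0 < F (y (tIdx D)) ∧
      0 < y (rIdx D) ∧ 0 < 1 - k * y (rIdx D) ^ 2 := by
    have hcont : ContinuousAt (fun r : ℝ => 1 - k * r ^ 2) (x (rIdx D)) := by fun_prop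
    filter_upwards [eventually_coord (tIdx D) (eventually_differentiableAt ha),
      eventually_coord (tIdx D) (eventually_differentiableAt (contDiffAt_deriv ha)),
      eventually_coord (tIdx D) (eventually_differentiableAt hF),
      eventually_coord (tIdx D) (eventually_differentiableAt (contDiffAt_deriv hF)),
      eventually_coord (tIdx D) (ha.continuousAt.eventually (lt_mem_nhds ha0)),
      eventually_coord (tIdx D) (hF.continuousAt.eventually (lt_mem_nhds hF0)),
      eventually_coord (rIdx D) (lt_mem_nhds hr),
      eventually_coord (rIdx D) (hcont.eventually (lt_mem_nhds hk))]
      with y h1 h2 h3 h4 h5 h6 h7 h8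
    exact ⟨h1, h2, h3, h4, h5, h6, h7, h8⟩
  have hwarp := hw.mono fun y hy => isWarp_flrw hy.1 hy.2.1 hy.2.2.1 hy.2.2.2.1 hy.2.2.2.2.1
    hy.2.2.2.2.2.1 hy.2.2.2.2.2.2.1 hy.2.2.2.2.2.2.2
  set al : ℝ → ℝ := fun t => flrwAlpha (jet a t) (jet F t) with hal
  set be : ℝ → ℝ := fun t => flrwBeta k (jet a t) (jet F t) with hbe
  set P : ℝ → ℝ := fun t => flrwP D n (be t) with hPdef
  set Q : ℝ → ℝ := fun t => flrwQ D n (al t) (be t) with hQdef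
  have hals : ContDiffAt ℝ ∞ al (x (tIdx D)) := contDiffAt_flrwAlpha ha hF ha0.ne' hF0.ne'
  have hbes : ContDiffAt ℝ ∞ be (x (tIdx D)) := contDiffAt_flrwBeta ha hF ha0.ne' hF0.ne'
  have hPs : ContDiffAt ℝ ∞ P (x (tIdx D)) := by
    rw [hPdef]; unfold flrwP cosmoLagA; fun_prop
  have hQs : ContDiffAt ℝ ∞ Q (x (tIdx D)) := by
    rw [hQdef]; unfold flrwQ cosmoLagB; fun_prop
  have htr : tIdx D ≠ rIdx D := by simp
  have hpd : ∀ {G : ℝ → ℝ}, ContDiffAt ℝ ∞ G (x (tIdx D)) → ∀ᶠ y : Coord D → ℝ in nhds x,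
      HasPd (tIdx D) (fun y => G (y (tIdx D))) (deriv G (y (tIdx D))) y ∧
      HasPd (rIdx D) (fun y => G (y (tIdx D))) 0 y ∧
      ∀ j, HasPd (Sum.inr j) (fun y => G (y (tIdx D))) 0 y := by
    intro G hG
    filter_upwards [eventually_coord (tIdx D) (eventually_differentiableAt hG)] with y hy
    exact ⟨hasPd_comp hy.hasDerivAt, hasPd_comp_of_ne htr G y,
      fun j => hasPd_comp_of_ne (by simp) G y⟩
  have hpd' : ∀ {G : ℝ → ℝ}, ContDiffAt ℝ ∞ G (x (tIdx D)) → ∀ d : Coord D, ∃ u,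
      HasPd d (fun y => deriv G (y (tIdx D))) u x := by
    intro G hG d
    by_cases hd : tIdx D = d
    · subst hd
      exact ⟨_, hasPd_comp ((contDiffAt_deriv hG).differentiableAt (by simp)).hasDerivAt⟩
    · exact ⟨0, hasPd_comp_of_ne hd _ x⟩
  rw [flrw_eq_diagMetric]
  have key := fieldEq_warp hD hn (x := x) hwarp
    (K := ![fun y => al (y (tIdx D)), fun y => al (y (tIdx D)), fun y => be (y (tIdx D)),
      fun y => be (y (tIdx D))])
    (P := ![fun y => P (y (tIdx D)), fun y => P (y (tIdx D)), fun y => Q (y (tIdx D)),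
      fun y => Q (y (tIdx D))])
    (T := ![fun y => deriv P (y (tIdx D)), fun y => deriv P (y (tIdx D)),
      fun y => deriv Q (y (tIdx D)), fun y => deriv Q (y (tIdx D))])
    (R := fun _ _ => 0) ?_ ?_ ?_ ?_ ?_ ?_ b c
  · rw [key]
    simp only [blockF, hα, hβ]
    simp [diagMetric, hal, hbe, hPdef, hQdef]
  · filter_upwards [hwarp.eventually_nhds, hw] with y hy h
    obtain ⟨-, -, -, -, ha0, hF0, hr, hk⟩ := h
    have := hk.ne'
    refine riemann_warp hy ?_ ?_ ?_ ?_
    · simp [hal, flrwAlpha, jet]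
    · simp [hal, flrwAlpha, jet]
    · simp [hbe, flrwBeta, jet]
      field_simp
    · simp [hbe, flrwBeta, jet]
      field_simp
      ring
  · refine Filter.Eventually.of_forall fun y a b hab => ?_
    rw [show (blockF fun i => (![fun y => al (y (tIdx D)), fun y => al (y (tIdx D)),
      fun y => be (y (tIdx D)), fun y => be (y (tIdx D))] : Fin 4 → (Coord D → ℝ) → ℝ) i y) =
      (blockK (al (y (tIdx D))) (al (y (tIdx D))) (be (y (tIdx D))) (be (y (tIdx D))) :
        Coord D → Coord D → ℝ) from rfl,
      fderiv_secLag_cosmo hD hn _ _ hab]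
    have : ∀ p q : ℝ, 4 * blockK p p q q a b = blockK (4 * p) (4 * p) (4 * q) (4 * q) a b := by
      intro p q
      simp only [blockK_cosmo]
      split_ifs <;> ring
    rw [show (blockF fun i => (![fun y => P (y (tIdx D)), fun y => P (y (tIdx D)),
      fun y => Q (y (tIdx D)), fun y => Q (y (tIdx D))] : Fin 4 → (Coord D → ℝ) → ℝ) i y) =
      (blockK (P (y (tIdx D))) (P (y (tIdx D))) (Q (y (tIdx D))) (Q (y (tIdx D))) :
        Coord D → Coord D → ℝ) from rfl, this]
    congr 1 <;> (simp only [hPdef, hQdef, flrwP, flrwQ]; field_simp <;> ring)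
  · filter_upwards [hpd hPs, hpd hQs] with y h1 h2 i
    fin_cases i
    · exact h1
    · exact h1
    · exact h2
    · exact h2
  · intro i d
    fin_cases i
    · exact hpd' hPs d
    · exact hpd' hPs d
    · exact hpd' hQs d
    · exact hpd' hQs d
  · exact fun i d => ⟨0, hasPd_const 0⟩
  · filter_upwards [hw] with y hy
    have hP' := (hasDerivAt_flrwP hD hn (hasDerivAt_flrwBeta (k := k) hy.1 hy.2.1 hy.2.2.1
      hy.2.2.2.2.1.ne' hy.2.2.2.2.2.1.ne')).deriv
    have hP'' : deriv P (y (tIdx D)) = -((D - 2) * (deriv a (y (tIdx D)) / a (y (tIdx D)) *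
      (P (y (tIdx D)) - Q (y (tIdx D))))) := hP'
    -- Since the `tr` and `ti` entries agree, and so do the `ri` and `ij` entries, both time
    -- equations reduce to `hP''`, while the radial ones hold trivially because `τ = 0`.
    simp only [Matrix.cons_val_zero, Matrix.cons_val_one, Matrix.cons_val, hP'']
    refine ⟨by ring, by ring, by ring, by ring⟩

theorem isCosmological_curlyQ (hD : 5 ≤ D) {n : ℕ} (hn : 1 ≤ n) :
    IsCosmological D (curlyQ D n) := by
  intro k _ b c
  -- At a given point the metric involves only the values of `a` and `F`, so constant functions
  -- reproduce it; everything else depends on `flrwAlpha` and `flrwBeta`.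
  refine ⟨fun x p q => if b = c then
      flrw D k (fun _ => p.1) (fun _ => q.1) x b b * (2 * ∑ c,
          blockK (flrwP D n (flrwBeta k p q)) (flrwP D n (flrwBeta k p q))
            (flrwQ D n (flrwAlpha p q) (flrwBeta k p q))
            (flrwQ D n (flrwAlpha p q) (flrwBeta k p q)) b c
            * blockK (flrwAlpha p q) (flrwAlpha p q) (flrwBeta k p q) (flrwBeta k p q) b c
        - 1 / 2 * secLag D n (blockK (flrwAlpha p q) (flrwAlpha p q) (flrwBeta k p q)
          (flrwBeta k p q))) else 0, ?_⟩
  intro a F x ha hF ha0 hF0 hr hk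
  rw [fieldEq_flrw hD hn ha hF ha0 hF0 hr hk rfl rfl]
  rfl

end Cosmological

/-! ### Static spherically symmetric metrics -/

section Static

variable {D : ℕ}

/-- The curvature `A` of the `tr` planes of a static metric. -/
def staticA (f : ℝ → ℝ) (r : ℝ) : ℝ := -deriv (deriv f) r / 2

/-- The curvature `B` of the planes spanned by `t` or `r` and a direction on the sphere. -/
def staticB (f : ℝ → ℝ) (r : ℝ) : ℝ := -deriv f r / (2 * r)

/-- The curvature `ψ` of the planes tangent to the sphere. -/
def staticPsi (f : ℝ → ℝ) (r : ℝ) : ℝ := (1 - f r) / r ^ 2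

theorem staticMetric_eq_diagMetric (f : ℝ → ℝ) :
    staticMetric D f = diagMetric (warpE (fun _ => 1) (fun _ => 1) f fun r => 1 / f r) := by
  funext x
  unfold staticMetric diagMetric
  congr 1
  funext c
  rcases c with i | i
  · fin_cases i <;> simp [warpE]
  · simp [warpE]

theorem isWarp_static {f : ℝ → ℝ} {t r : ℝ} (hf : DifferentiableAt ℝ f r)
    (hf' : DifferentiableAt ℝ (deriv f) r) (hf0 : f r ≠ 0) (hr : 0 < r) :
    IsWarp (fun _ => 1) (fun _ => 1) f (fun r => 1 / f r) (fun _ => 0) (fun _ => 0)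
      (fun r => deriv f r / (2 * f r)) (fun r => -(deriv f r / (2 * f r))) (fun _ => 0)
      (fun _ => 0) (fun r => (deriv (deriv f) r * f r - deriv f r ^ 2) / (2 * f r ^ 2))
      (fun r => -((deriv (deriv f) r * f r - deriv f r ^ 2) / (2 * f r ^ 2))) t r := by
  have hτ : HasDerivAt (fun r => deriv f r / (2 * f r))
      ((deriv (deriv f) r * f r - deriv f r ^ 2) / (2 * f r ^ 2)) r := by
    refine (hf'.hasDerivAt.fun_div (hf.hasDerivAt.const_mul 2)
      (mul_ne_zero two_ne_zero hf0)).congr_deriv ?_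
    field_simp
  exact
  { hN := (hasDerivAt_const t (1 : ℝ)).congr_deriv (by ring)
    hb := (hasDerivAt_const t (1 : ℝ)).congr_deriv (by ring)
    hu := hf.hasDerivAt.congr_deriv (by field_simp)
    hv := ((hasDerivAt_const r (1 : ℝ)).fun_div hf.hasDerivAt hf0).congr_deriv
      (by field_simp; ring)
    hN0 := one_ne_zero
    hb0 := one_ne_zero
    hu0 := hf0
    hv0 := one_div_ne_zero hf0
    hr := hr.ne'
    hA := hasDerivAt_const t (0 : ℝ)
    hH := hasDerivAt_const t (0 : ℝ)
    hτ := hτ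
    hρ := hτ.fun_neg
    hHτ := zero_mul _ }

/-- This and the next statement are the Bianchi identities of the static metrics; they eliminate all
derivatives of the curvature from the divergence of `P`. -/
theorem hasDerivAt_staticPsi {f : ℝ → ℝ} {r : ℝ} (hf : DifferentiableAt ℝ f r) (hr : r ≠ 0) :
    HasDerivAt (staticPsi f) (2 * (staticB f r - staticPsi f r) / r) r := by
  refine ((hf.hasDerivAt.const_sub 1).fun_div (hasDerivAt_pow 2 r)
    (pow_ne_zero 2 hr)).congr_deriv ?_
  unfold staticB staticPsi
  field_simp
  push_cast
  ring

theorem hasDerivAt_staticB {f : ℝ → ℝ} {r : ℝ} (hf' : DifferentiableAt ℝ (deriv f) r)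
    (hr : r ≠ 0) : HasDerivAt (staticB f) ((staticA f r - staticB f r) / r) r := by
  refine (hf'.hasDerivAt.fun_neg.fun_div ((hasDerivAt_id' r).const_mul 2)
    (mul_ne_zero two_ne_zero hr)).congr_deriv ?_
  unfold staticA staticB
  field_simp

/-- The field `P_{abcd}` on the `tr` planes. -/
def staticP₁ (D n : ℕ) (ψ : ℝ) : ℝ := staticLagA D n ψ / 4

/-- The field `P_{abcd}` on the planes spanned by `t` or `r` and a direction on the sphere. -/
def staticP₂ (D n : ℕ) (B ψ : ℝ) : ℝ := staticLagB D n B ψ / (8 * (D - 2))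

/-- The field `P_{abcd}` on the planes tangent to the sphere. -/
def staticP₃ (D n : ℕ) (A B ψ : ℝ) : ℝ := staticLagPsi D n A B ψ / (2 * ((D - 2) * (D - 3)))

/-- The divergence equation for the pair `(t, r)`. The coefficient of `A` in `staticLag` depends on
`ψ` alone, so its derivative brings in only `B` and not `A`. -/
theorem hasDerivAt_staticP₁ (hD : 5 ≤ D) {n : ℕ} (hn : 1 ≤ n) {B : ℝ} {ψ : ℝ → ℝ} {r : ℝ}
    (hr : r ≠ 0) (h : HasDerivAt ψ (2 * (B - ψ r) / r) r) :
    HasDerivAt (fun r => staticP₁ D n (ψ r))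
      (-((D - 2) * (r⁻¹ * (staticP₁ D n (ψ r) - staticP₂ D n B (ψ r))))) r := by
  have h5 : (5 : ℝ) ≤ D := by exact_mod_cast hD
  have e3 : (D : ℝ) - 2 ≠ 0 := by linarith
  unfold staticP₁ staticP₂ staticLagA staticLagB
  refine ((((h.fun_pow (n - 1)).const_mul (2 * (n : ℝ))).const_mul _).div_const _).congr_deriv ?_
  obtain ⟨m, rfl⟩ : ∃ m, n = m + 1 := ⟨n - 1, by omega⟩
  rcases m with _ | m
  · norm_num
    field_simp
    ring_nf
    simp
  · simp only [show m + 1 + 1 - 1 = m + 1 by omega, show m + 1 + 1 - 2 = m by omega,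
      show m + 1 - 1 = m by omega]
    push_cast
    field_simp
    ring

/-- The divergence equation for a sphere index and `r`. The small values of `n` are separate because
the exponents `n - 2` and `n - 3` truncate. -/
theorem hasDerivAt_staticP₂ (hD : 5 ≤ D) {n : ℕ} (hn : 1 ≤ n) {A : ℝ} {B ψ : ℝ → ℝ} {r : ℝ}
    (hr : r ≠ 0) (hB : HasDerivAt B ((A - B r) / r) r)
    (h : HasDerivAt ψ (2 * (B r - ψ r) / r) r) :
    HasDerivAt (fun r => staticP₂ D n (B r) (ψ r))
      (-((D - 3) * (r⁻¹ * (staticP₂ D n (B r) (ψ r) - staticP₃ D n A (B r) (ψ r))))) r := by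
  have h5 : (5 : ℝ) ≤ D := by exact_mod_cast hD
  have e3 : (D : ℝ) - 2 ≠ 0 := by linarith
  have e4 : (D : ℝ) - 3 ≠ 0 := by linarith
  unfold staticP₂ staticP₃ staticLagB staticLagPsi
  refine ((HasDerivAt.const_mul _ (((hB.const_mul _).fun_mul (h.fun_pow (n - 2))).fun_add
    ((h.fun_pow (n - 1)).const_mul _))).div_const _).congr_deriv ?_
  obtain ⟨m, rfl⟩ : ∃ m, n = m + 1 := ⟨n - 1, by omega⟩
  rcases m with _ | _ | m
  · norm_num
    field_simp
    ring_nf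
    simp
  · norm_num
    field_simp
    ring
  · simp only [show m + 1 + 1 + 1 - 1 = m + 2 by omega, show m + 1 + 1 + 1 - 2 = m + 1 by omega,
      show m + 1 + 1 + 1 - 3 = m by omega, show m + 2 - 1 = m + 1 by omega,
      show m + 1 - 1 = m by omega]
    push_cast
    field_simp
    ring

theorem contDiffAt_staticA {f : ℝ → ℝ} {r : ℝ} (hf : ContDiffAt ℝ ∞ f r) :
    ContDiffAt ℝ ∞ (staticA f) r :=
  (contDiffAt_deriv (contDiffAt_deriv hf)).neg.div_const 2

theorem contDiffAt_staticB {f : ℝ → ℝ} {r : ℝ} (hf : ContDiffAt ℝ ∞ f r) (hr : r ≠ 0) :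
    ContDiffAt ℝ ∞ (staticB f) r :=
  (contDiffAt_deriv hf).neg.div (contDiffAt_const.mul contDiffAt_id)
    (mul_ne_zero two_ne_zero hr)

theorem contDiffAt_staticPsi {f : ℝ → ℝ} {r : ℝ} (hf : ContDiffAt ℝ ∞ f r) (hr : r ≠ 0) :
    ContDiffAt ℝ ∞ (staticPsi f) r :=
  (contDiffAt_const.sub hf).div (contDiffAt_id.pow 2) (pow_ne_zero 2 hr)

theorem fieldEq_static_sum (hD : 5 ≤ D) {n : ℕ} (hn : 1 ≤ n) {f : ℝ → ℝ} {x : Coord D → ℝ}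
    (hf : ContDiffAt ℝ ∞ f (x (rIdx D))) (hf0 : f (x (rIdx D)) ≠ 0) (hr : 0 < x (rIdx D))
    {A B ψ : ℝ} (hA : A = staticA f (x (rIdx D))) (hB : B = staticB f (x (rIdx D)))
    (hψ : ψ = staticPsi f (x (rIdx D))) (b c : Coord D) :
    fieldEq (curlyQ D n) (staticMetric D f) x b c = if b = c then
      staticMetric D f x b b * (2 * ∑ c,
          blockK (staticP₁ D n ψ) (staticP₂ D n B ψ) (staticP₂ D n B ψ) (staticP₃ D n A B ψ) b c
            * blockK A B B ψ b c
        - 1 / 2 * staticLag D n A B ψ) else 0 := by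
  have h5 : (5 : ℝ) ≤ D := by exact_mod_cast hD
  have e3 : (D : ℝ) - 2 ≠ 0 := by linarith
  have e4 : (D : ℝ) - 3 ≠ 0 := by linarith
  have hw : ∀ᶠ y in nhds x, DifferentiableAt ℝ f (y (rIdx D)) ∧
      DifferentiableAt ℝ (deriv f) (y (rIdx D)) ∧ f (y (rIdx D)) ≠ 0 ∧ 0 < y (rIdx D) := by
    filter_upwards [eventually_coord (rIdx D) (eventually_differentiableAt hf),
      eventually_coord (rIdx D) (eventually_differentiableAt (contDiffAt_deriv hf)),
      eventually_coord (rIdx D) (hf.continuousAt.eventually_ne hf0),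
      eventually_coord (rIdx D) (lt_mem_nhds hr)] with y h1 h2 h3 h4
    exact ⟨h1, h2, h3, h4⟩
  have hwarp := hw.mono fun y hy =>
    isWarp_static (t := y (tIdx D)) hy.1 hy.2.1 hy.2.2.1 hy.2.2.2
  have hAs := contDiffAt_staticA hf
  have hBs := contDiffAt_staticB hf hr.ne'
  have hψs := contDiffAt_staticPsi hf hr.ne'
  set P : ℝ → ℝ := fun r => staticP₁ D n (staticPsi f r) with hPdef
  set Q : ℝ → ℝ := fun r => staticP₂ D n (staticB f r) (staticPsi f r) with hQdef
  set S : ℝ → ℝ := fun r => staticP₃ D n (staticA f r) (staticB f r) (staticPsi f r) with hSdef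
  have hPs : ContDiffAt ℝ ∞ P (x (rIdx D)) := by
    rw [hPdef]; unfold staticP₁ staticLagA; fun_prop
  have hQs : ContDiffAt ℝ ∞ Q (x (rIdx D)) := by
    rw [hQdef]; unfold staticP₂ staticLagB; fun_prop
  have hSs : ContDiffAt ℝ ∞ S (x (rIdx D)) := by
    rw [hSdef]; unfold staticP₃ staticLagPsi; fun_prop
  have htr : rIdx D ≠ tIdx D := by simp
  have hpd : ∀ {G : ℝ → ℝ}, ContDiffAt ℝ ∞ G (x (rIdx D)) → ∀ᶠ y : Coord D → ℝ in nhds x,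
      HasPd (tIdx D) (fun y => G (y (rIdx D))) 0 y ∧
      HasPd (rIdx D) (fun y => G (y (rIdx D))) (deriv G (y (rIdx D))) y ∧
      ∀ j, HasPd (Sum.inr j) (fun y => G (y (rIdx D))) 0 y := by
    intro G hG
    filter_upwards [eventually_coord (rIdx D) (eventually_differentiableAt hG)] with y hy
    exact ⟨hasPd_comp_of_ne htr G y, hasPd_comp hy.hasDerivAt,
      fun j => hasPd_comp_of_ne (by simp) G y⟩
  have hpd' : ∀ {G : ℝ → ℝ}, ContDiffAt ℝ ∞ G (x (rIdx D)) → ∀ d : Coord D, ∃ u,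
      HasPd d (fun y => deriv G (y (rIdx D))) u x := by
    intro G hG d
    by_cases hd : rIdx D = d
    · subst hd
      exact ⟨_, hasPd_comp ((contDiffAt_deriv hG).differentiableAt (by simp)).hasDerivAt⟩
    · exact ⟨0, hasPd_comp_of_ne hd _ x⟩
  rw [staticMetric_eq_diagMetric]
  have key := fieldEq_warp hD hn (x := x) hwarp
    (K := ![fun y => staticA f (y (rIdx D)), fun y => staticB f (y (rIdx D)),
      fun y => staticB f (y (rIdx D)), fun y => staticPsi f (y (rIdx D))])
    (P := ![fun y => P (y (rIdx D)), fun y => Q (y (rIdx D)), fun y => Q (y (rIdx D)),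
      fun y => S (y (rIdx D))])
    (T := fun _ _ => 0)
    (R := ![fun y => deriv P (y (rIdx D)), fun y => deriv Q (y (rIdx D)),
      fun y => deriv Q (y (rIdx D)), fun y => deriv S (y (rIdx D))]) ?_ ?_ ?_ ?_ ?_ ?_ b c
  · rw [key, ← curlyQOf_static hD hn]
    simp only [blockF, hA, hB, hψ]
    simp [diagMetric, hPdef, hQdef, hSdef, secLag]
  · filter_upwards [hwarp.eventually_nhds, hw] with y hy h
    obtain ⟨-, -, hf0, hr⟩ := h
    refine riemann_warp hy ?_ ?_ ?_ ?_
    · simp [staticA]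
      field_simp
      ring
    · simp [staticB]
      field_simp
    · simp [staticB]
      field_simp
    · simp [staticPsi]
      field_simp
  · refine Filter.Eventually.of_forall fun y a b hab => ?_
    rw [show (blockF fun i => (![fun y => staticA f (y (rIdx D)),
      fun y => staticB f (y (rIdx D)), fun y => staticB f (y (rIdx D)),
      fun y => staticPsi f (y (rIdx D))] : Fin 4 → (Coord D → ℝ) → ℝ) i y) =
      (blockK (staticA f (y (rIdx D))) (staticB f (y (rIdx D))) (staticB f (y (rIdx D)))
        (staticPsi f (y (rIdx D))) : Coord D → Coord D → ℝ) from rfl,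
      fderiv_secLag_static hD hn _ _ _ hab]
    have : ∀ p q s : ℝ, 4 * blockK p q q s a b = blockK (4 * p) (4 * q) (4 * q) (4 * s) a b := by
      intro p q s
      have := congrFun (congrFun (blockK_add_smul (D := D) 0 0 0 0 p q q s 4) a) b
      have h0 : blockK 0 0 0 0 a b = 0 := by
        rw [blockK_cosmo]; simp
      simpa [h0] using this
    rw [show (blockF fun i => (![fun y => P (y (rIdx D)), fun y => Q (y (rIdx D)),
      fun y => Q (y (rIdx D)), fun y => S (y (rIdx D))] : Fin 4 → (Coord D → ℝ) → ℝ) i y) =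
      (blockK (P (y (rIdx D))) (Q (y (rIdx D))) (Q (y (rIdx D))) (S (y (rIdx D))) :
        Coord D → Coord D → ℝ) from rfl, this]
    congr 1 <;> (simp only [hPdef, hQdef, hSdef, staticP₁, staticP₂, staticP₃]; field_simp <;> ring)
  · filter_upwards [hpd hPs, hpd hQs, hpd hSs] with y h1 h2 h3 i
    fin_cases i
    · exact h1
    · exact h2
    · exact h2
    · exact h3
  · exact fun i d => ⟨0, hasPd_const 0⟩
  · intro i d
    fin_cases i
    · exact hpd' hPs d
    · exact hpd' hQs d
    · exact hpd' hQs d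
    · exact hpd' hSs d
  · filter_upwards [hw] with y hy
    have hr0 := hy.2.2.2.ne'
    have h1 := hasDerivAt_staticPsi hy.1 hr0
    have h2 := hasDerivAt_staticB hy.2.1 hr0
    have hP' : deriv P (y (rIdx D)) = _ := (hasDerivAt_staticP₁ hD hn hr0 h1).deriv
    have hQ' : deriv Q (y (rIdx D)) = _ := (hasDerivAt_staticP₂ hD hn hr0 h2 h1).deriv
    -- The time equations are trivial since `H = 0`, and the term with `τ` drops out because the
    -- `ti` and `ri` entries of `P` coincide.
    simp only [Matrix.cons_val_zero, Matrix.cons_val_one, Matrix.cons_val, hP', hQ']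
    simp only [hPdef, hQdef, hSdef]
    refine ⟨by ring, by ring, by ring, by ring⟩

/-- The component `𝓔^t_t = 𝓔^r_r` of the field equations of a static metric. -/
def staticEq (D n : ℕ) (B ψ : ℝ) : ℝ := -(1 / 2) * (((D : ℝ) * (D - 1)) ^ (n - 1) * (D - 2 * n)) *
  (2 * n * B * ψ ^ (n - 1) + (D - 1 - 2 * n) * ψ ^ n)

/-- By linearity in `A`, the contribution `2 P₁ A` is half the `A`-part of the Lagrangian, which
`-𝓛/2` removes; hence no second derivative of `f` remains. -/
theorem static_sum_inl (hD : 5 ≤ D) {n : ℕ} (hn : 1 ≤ n) (A B ψ : ℝ) (i : Fin 2) :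
    2 * ∑ c : Coord D, blockK (staticP₁ D n ψ) (staticP₂ D n B ψ) (staticP₂ D n B ψ)
        (staticP₃ D n A B ψ) (Sum.inl i) c * blockK A B B ψ (Sum.inl i) c
      - 1 / 2 * staticLag D n A B ψ = staticEq D n B ψ := by
  have h5 : (5 : ℝ) ≤ D := by exact_mod_cast hD
  have e3 : (D : ℝ) - 2 ≠ 0 := by linarith
  have h : ∑ c : Coord D, blockK (staticP₁ D n ψ) (staticP₂ D n B ψ) (staticP₂ D n B ψ)
        (staticP₃ D n A B ψ) (Sum.inl i) c * blockK A B B ψ (Sum.inl i) c =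
      staticP₁ D n ψ * A + (D - 2) * (staticP₂ D n B ψ * B) := by
    rw [Fintype.sum_sum_type, Fin.sum_univ_two]
    fin_cases i <;> simp [blockK, cast_sub_two hD]
  rw [h]
  unfold staticP₁ staticP₂ staticLagA staticLagB staticLag staticEq
  obtain ⟨m, rfl⟩ : ∃ m, n = m + 1 := ⟨n - 1, by omega⟩
  rcases m with _ | m
  · norm_num
    field_simp
    ring
  · simp only [show m + 1 + 1 - 1 = m + 1 by omega, show m + 1 + 1 - 2 = m by omega]
    push_cast
    field_simp
    ring

/-- This is the conservation law of the field equations: the angular component is fixed by the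
radial one and its derivative, so it vanishes wherever the latter vanishes on an interval. -/
theorem static_sum_inr (hD : 5 ≤ D) {n : ℕ} (hn : 1 ≤ n) {A : ℝ} {B ψ : ℝ → ℝ} {r : ℝ}
    (hr : r ≠ 0) (hB : HasDerivAt B ((A - B r) / r) r)
    (h : HasDerivAt ψ (2 * (B r - ψ r) / r) r) (i : Fin (D - 2)) :
    2 * ∑ c : Coord D, blockK (staticP₁ D n (ψ r)) (staticP₂ D n (B r) (ψ r))
        (staticP₂ D n (B r) (ψ r)) (staticP₃ D n A (B r) (ψ r)) (Sum.inr i) c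
          * blockK A (B r) (B r) (ψ r) (Sum.inr i) c
      - 1 / 2 * staticLag D n A (B r) (ψ r) = staticEq D n (B r) (ψ r) +
        r / (D - 2) * deriv (fun r => staticEq D n (B r) (ψ r)) r := by
  have h5 : (5 : ℝ) ≤ D := by exact_mod_cast hD
  have e3 : (D : ℝ) - 2 ≠ 0 := by linarith
  have e4 : (D : ℝ) - 3 ≠ 0 := by linarith
  have hsum : ∑ c : Coord D, blockK (staticP₁ D n (ψ r)) (staticP₂ D n (B r) (ψ r))
        (staticP₂ D n (B r) (ψ r)) (staticP₃ D n A (B r) (ψ r)) (Sum.inr i) c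
          * blockK A (B r) (B r) (ψ r) (Sum.inr i) c =
      2 * (staticP₂ D n (B r) (ψ r) * B r) + (D - 3) * (staticP₃ D n A (B r) (ψ r) * ψ r) := by
    have h1 : ∀ j : Fin (D - 2), blockK (staticP₁ D n (ψ r)) (staticP₂ D n (B r) (ψ r))
        (staticP₂ D n (B r) (ψ r)) (staticP₃ D n A (B r) (ψ r)) (Sum.inr i) (Sum.inr j)
          * blockK A (B r) (B r) (ψ r) (Sum.inr i) (Sum.inr j) =
        if i = j then 0 else staticP₃ D n A (B r) (ψ r) * ψ r := by
      intro j
      simp only [blockK, Sum.elim_inr]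
      split_ifs <;> simp
    rw [Fintype.sum_sum_type, Fin.sum_univ_two, Finset.sum_congr rfl fun j _ => h1 j,
      sum_ite_fin hD i]
    simp [blockK]
    ring
  have hE : HasDerivAt (fun r => staticEq D n (B r) (ψ r)) _ r :=
    HasDerivAt.const_mul _ (((hB.const_mul _).fun_mul (h.fun_pow (n - 1))).fun_add
      ((h.fun_pow n).const_mul _))
  rw [hsum, hE.deriv]
  unfold staticP₂ staticP₃ staticLagB staticLagPsi staticLag staticEq
  obtain ⟨m, rfl⟩ : ∃ m, n = m + 1 := ⟨n - 1, by omega⟩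
  rcases m with _ | _ | m
  · norm_num
    field_simp
    ring
  · norm_num
    field_simp
    ring
  · simp only [show m + 1 + 1 + 1 - 1 = m + 2 by omega, show m + 1 + 1 + 1 - 2 = m + 1 by omega,
      show m + 1 + 1 + 1 - 3 = m by omega, show m + 2 - 1 = m + 1 by omega]
    push_cast
    field_simp
    ring

theorem fieldEq_static (hD : 5 ≤ D) {n : ℕ} (hn : 1 ≤ n) {f : ℝ → ℝ} {x : Coord D → ℝ}
    (hf : ContDiffAt ℝ ∞ f (x (rIdx D))) (hf0 : f (x (rIdx D)) ≠ 0) (hr : 0 < x (rIdx D))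
    (b c : Coord D) :
    fieldEq (curlyQ D n) (staticMetric D f) x b c = if b = c then staticMetric D f x b b *
      (staticEq D n (staticB f (x (rIdx D))) (staticPsi f (x (rIdx D))) + Sum.elim (fun _ => 0)
        (fun _ => x (rIdx D) / (D - 2) *
          deriv (fun r => staticEq D n (staticB f r) (staticPsi f r)) (x (rIdx D))) b) else 0 := by
  rw [fieldEq_static_sum hD hn hf hf0 hr rfl rfl rfl]
  rcases b with i | i
  · rw [static_sum_inl hD hn]
    simp
  · rw [static_sum_inr hD hn hr.ne'
      (hasDerivAt_staticB ((contDiffAt_deriv hf).differentiableAt (by simp)) hr.ne')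
      (hasDerivAt_staticPsi (hf.differentiableAt (by simp)) hr.ne')]
    simp

/-- The function `H(r, φ)` whose derivative along `φ = f(r)` is the equation for `f`. -/
def staticH (D n : ℕ) (r φ : ℝ) : ℝ := -(1 / 2) * (((D : ℝ) * (D - 1)) ^ (n - 1) * (D - 2 * n)) *
  (r ^ (D - 1) * ((1 - φ) / r ^ 2) ^ n)

theorem contDiffOn_staticH (D n : ℕ) :
    ContDiffOn ℝ ∞ (Function.uncurry (staticH D n)) (Set.Ioi 0 ×ˢ Set.univ) := by
  have h1 : ContDiffOn ℝ ∞ (fun z : ℝ × ℝ => (1 - z.2) / z.1 ^ 2) (Set.Ioi 0 ×ˢ Set.univ) := by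
    refine ContDiffOn.div (by fun_prop) (by fun_prop) ?_
    rintro ⟨r, φ⟩ ⟨hr, -⟩
    exact pow_ne_zero 2 (ne_of_gt hr)
  have h2 : ContDiffOn ℝ ∞ (fun z : ℝ × ℝ => z.1 ^ (D - 1)) (Set.Ioi 0 ×ˢ Set.univ) := by
    fun_prop
  exact contDiffOn_const.mul (h2.mul (h1.pow n))

/-- Apart from a constant the function is `r^(D-1) ψ^n`, and `r ψ' = 2 (B - ψ)` gives its
derivative. For `D = 2n` the constant vanishes and both sides are identically zero. -/
theorem hasDerivAt_staticH (hD : 5 ≤ D) {n : ℕ} (hn : 1 ≤ n) {f : ℝ → ℝ} {r : ℝ}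
    (hf : DifferentiableAt ℝ f r) (hr : 0 < r) :
    HasDerivAt (fun s => staticH D n s (f s))
      (r ^ (D - 2) * staticEq D n (staticB f r) (staticPsi f r)) r := by
  have hr0 := hr.ne'
  unfold staticH
  refine (HasDerivAt.const_mul _ ((hasDerivAt_pow (D - 1) r).fun_mul
    ((hasDerivAt_staticPsi hf hr0).fun_pow n))).congr_deriv ?_
  unfold staticEq
  obtain ⟨m, rfl⟩ : ∃ m, n = m + 1 := ⟨n - 1, by omega⟩
  obtain ⟨d, rfl⟩ : ∃ d, D = d + 2 := ⟨D - 2, by omega⟩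
  simp only [show d + 2 - 1 = d + 1 by omega, show d + 2 - 2 = d by omega,
    show d + 1 - 1 = d by omega, show m + 1 - 1 = m by omega]
  push_cast
  field_simp
  ring

theorem fieldEqMixed_static (hD : 5 ≤ D) {n : ℕ} (hn : 1 ≤ n) {f : ℝ → ℝ} {x : Coord D → ℝ}
    (hf : ContDiffAt ℝ ∞ f (x (rIdx D))) (hf0 : f (x (rIdx D)) ≠ 0) (hr : 0 < x (rIdx D))
    (i : Fin 2) :
    fieldEqMixed (curlyQ D n) (staticMetric D f) x (Sum.inl i) (Sum.inl i) =
      staticEq D n (staticB f (x (rIdx D))) (staticPsi f (x (rIdx D))) := by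
  have he : ∀ a, warpE (D := D) (fun _ => 1) (fun _ => 1) f (fun r => 1 / f r) a x ≠ 0 :=
    (isWarp_static (t := x (tIdx D)) (hf.differentiableAt (by simp))
      ((contDiffAt_deriv hf).differentiableAt (by simp)) hf0 hr).isLogDeriv.1
  unfold fieldEqMixed
  rw [Finset.sum_eq_single (Sum.inl i)]
  · rw [fieldEq_static hD hn hf hf0 hr, if_pos rfl, staticMetric_eq_diagMetric, diagMetric,
      inv_diagonal_of_ne he, Matrix.diagonal_apply_eq, Matrix.diagonal_apply_eq,
      inv_mul_cancel_left₀ (he _)]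
    simp
  · intro c _ hc
    rw [fieldEq_static hD hn hf hf0 hr, if_neg hc, mul_zero]
  · simp

theorem isQuasitopological_curlyQ (hD : 5 ≤ D) {n : ℕ} (hn : 1 ≤ n) :
    IsQuasitopological D (curlyQ D n) := by
  refine ⟨staticH D n, contDiffOn_staticH D n, ?_, ?_⟩
  · intro f x hf hf0 hr
    rw [fieldEqMixed_static hD hn hf hf0 hr, fieldEqMixed_static hD hn hf hf0 hr]
    exact ⟨rfl, (hasDerivAt_staticH hD hn (hf.differentiableAt (by simp)) hr).deriv.symm⟩
  · intro I f hI hI' hI0 hf hf0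
    have hfs : ∀ s ∈ I, ContDiffAt ℝ ∞ f s := fun s hs => hf.contDiffAt (hI.mem_nhds hs)
    have hder : ∀ s ∈ I, HasDerivAt (fun s => staticH D n s (f s))
        (s ^ (D - 2) * staticEq D n (staticB f s) (staticPsi f s)) s := fun s hs =>
      hasDerivAt_staticH hD hn ((hfs s hs).differentiableAt (by simp)) (hI0 hs)
    constructor
    · intro h
      have hzero : ∀ s ∈ I, staticEq D n (staticB f s) (staticPsi f s) = 0 := by
        intro s hs
        -- Any point whose radial coordinate is `s` would do; all coordinates are set equal to `s`.
        have h1 := fieldEqMixed_static (x := fun _ => s) hD hn (hfs s hs) (hf0 s hs) (hI0 hs) 0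
        rw [← h1, fieldEqMixed]
        refine Finset.sum_eq_zero fun c _ => ?_
        rw [h (fun _ => s) hs, mul_zero]
      exact hI.exists_is_const_of_deriv_eq_zero hI'.isPreconnected
        (fun s hs => (hder s hs).differentiableAt.differentiableWithinAt)
        (fun s hs => by simpa [hzero s hs] using (hder s hs).deriv)
    · rintro ⟨C, hC⟩ x hx b c
      have hzero : ∀ s ∈ I, staticEq D n (staticB f s) (staticPsi f s) = 0 := by
        intro s hs
        have h1 : (fun s => staticH D n s (f s)) =ᶠ[nhds s] fun _ => C :=
          Filter.eventuallyEq_of_mem (hI.mem_nhds hs) hC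
        have h2 := (hder s hs).deriv
        rw [h1.deriv_eq, deriv_const] at h2
        exact (mul_eq_zero.1 h2.symm).resolve_left (pow_ne_zero _ (ne_of_gt (hI0 hs)))
      -- The angular equations also contain the derivative of the radial one, which vanishes because
      -- the radial equation holds on the whole open interval.
      have h3 : deriv (fun r => staticEq D n (staticB f r) (staticPsi f r)) (x (rIdx D)) = 0 := by
        have h1 : (fun r => staticEq D n (staticB f r) (staticPsi f r))
            =ᶠ[nhds (x (rIdx D))] fun _ => 0 :=
          Filter.eventuallyEq_of_mem (hI.mem_nhds hx) hzero
        rw [h1.deriv_eq, deriv_const]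
      rw [fieldEq_static hD hn (hfs _ hx) (hf0 _ hx) (hI0 hx), hzero _ hx, h3]
      rcases b with i | i <;> simp

end Static

end HigherCurvature

end

theorem mainTheorem6 (D n : ℕ) (hD : 5 ≤ D) (hn : 1 ≤ n) :
    HigherCurvature.IsCosmologicalQuasitopological D (HigherCurvature.curlyQ D n) :=
  ⟨HigherCurvature.isCosmological_curlyQ hD hn, HigherCurvature.isQuasitopological_curlyQ hD hn⟩
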